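/- Conventions. The link of a simplex $\sigma$ in a simplicial complex $K$ is $\mathrm{lk}_K(\sigma)=\{\tau : \tau\cup\sigma\in K,\ \tau\cap\sigma=\varnothing\}$. A combinatorial $d$-manifold without boundary is a simplicial complex in which the link of every vertex is a combinatorial $(d-1)$-sphere, i.e. a combinatorial $(d-1)$-manifold without boundary that is PL-homeomorphic to the boundary of the $d$-simplex (for $d=0$: in which the link of every vertex is empty). A combinatorial $d$-manifold (possibly with boundary) is a simplicial complex in which the link of every vertex is a combinatorial $(d-1)$-sphere or, if $d\ge 1$, a combinatorial $(d-1)$-disk, i.e. a combinatorial $(d-1)$-manifold (possibly with boundary) that is PL-homeomorphic to the $(d-1)$-simplex. The empty complex is allowed. The boundary $\partial K$ of a combinatorial manifold $K$ is the subcomplex of the simplices whose link is a combinatorial disk. Let $M$ be a combinatorial $d$-manifold, possibly with boundary, let $2\le k\le d$, and let $c:\mathrm{vertices}(M)\to\{C_1,\dots,C_k\}$ be any coloring of its vertices. To a point $x\in|M|$ with barycentric coordinates $(x_v)$ assign the set of colors $c(x)=\{c(v) : x_v=\max_w x_w\}$, and let $X=\{x\in|M| : c(x)=\{C_1,\dots,C_k\}\}$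 be the $k$-color class. Let $M'$ be the barycentric subdivision of $M$. Then $X$ is the union of the simplices of $M'$ that it contains, these simplices form a subcomplex of $M'$, and this subcomplex, again denoted $X$, is a proper combinatorial $(d-k+1)$-dimensional submanifold of $M$: it is a combinatorial $(d-k+1)$-manifold (possibly empty, possibly with boundary), and its boundary $\partial X$ is a combinatorial $(d-k)$-manifold without boundary contained in $\partial M$. Moreover $\partial X = X\cap\partial M$, both as point sets and as subcomplexes of $M'$ (with $\partial M$ replaced by its barycentric subdivision in the latter case). -/

import Mathlib

namespace ColoredManifold

/-! Simplicial complexes are Mathlib's `PreAbstractSimplicialComplex V`: downward closed sets of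
nonempty finite subsets of `V`. The vertices are the `v` with `{v} ∈ K`; the empty complex is `⊥`.
No finiteness is assumed. Points are given by barycentric coordinates, as elements of `V →₀ ℝ`. -/

section Realization

variable {V W : Type*}

/-- The closed geometric simplex `|s|` in barycentric coordinates. -/
def simplex (s : Finset V) : Set (V →₀ ℝ) :=
  {x | (∀ v, 0 ≤ x v) ∧ (x.sum fun _ r => r) = 1 ∧ x.support ⊆ s}

/-- The geometric realization `|K|`, the union of the closed simplices of `K`. -/
def realization (K : PreAbstractSimplicialComplex V) : Set (V →₀ ℝ) :=
  ⋃ s ∈ K, simplex s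

/-- `P` is a convex polytope in `|s|`: it is cut out of `|s|` by finitely many affine
inequalities. -/
def IsPolytopeIn (s : Finset V) (P : Set (V →₀ ℝ)) : Prop :=
  ∃ Φ : Finset ((V →₀ ℝ) →ᵃ[ℝ] ℝ), P = {x ∈ simplex s | ∀ φ ∈ Φ, φ x ≤ 0}

/-- `f` is piecewise linear on `|K|`: every simplex of `K` is a finite union of convex polytopes on
each of which `f` is affine. Such a map is continuous on every simplex, since the finitely many
polytopes are closed. -/
def IsPL (K : PreAbstractSimplicialComplex V) (f : (V →₀ ℝ) → (W →₀ ℝ)) : Prop :=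
  ∀ s ∈ K, ∃ (n : ℕ) (P : Fin n → Set (V →₀ ℝ)) (A : Fin n → ((V →₀ ℝ) →ᵃ[ℝ] (W →₀ ℝ))),
    simplex s = ⋃ i, P i ∧ ∀ i, IsPolytopeIn s (P i) ∧ Set.EqOn f (A i) (P i)

/-- `K` and `L` are PL-homeomorphic: there are mutually inverse piecewise linear maps between
`|K|` and `|L|`. -/
def PLHomeomorphic (K : PreAbstractSimplicialComplex V) (L : PreAbstractSimplicialComplex W) :
    Prop :=
  ∃ (f : (V →₀ ℝ) → (W →₀ ℝ)) (g : (W →₀ ℝ) → (V →₀ ℝ)),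
    Set.MapsTo f (realization K) (realization L) ∧
    Set.MapsTo g (realization L) (realization K) ∧
    Set.InvOn g f (realization K) (realization L) ∧
    IsPL K f ∧ IsPL L g

end Realization

/-- The standard `n`-simplex with all its faces. -/
def fullSimplex (n : ℕ) : PreAbstractSimplicialComplex (Fin (n + 1)) := ⊤

/-- The boundary complex of the standard `n`-simplex: all its proper faces (none if `n = 0`). -/
def simplexBoundary (n : ℕ) : PreAbstractSimplicialComplex (Fin (n + 1)) where
  faces := {s | s.Nonempty ∧ s ≠ Finset.univ}
  isRelLowerSet_faces := fun _ hs => ⟨hs.1, fun _ hts ht =>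
    ⟨ht, fun h => hs.2 (Finset.univ_subset_iff.mp (h ▸ hts))⟩⟩

section Manifold

variable {V : Type*} [DecidableEq V]

/-- The link of `s` in `K`: all faces `t` disjoint from `s` with `t ∪ s` a face of `K`. -/
def link (K : PreAbstractSimplicialComplex V) (s : Finset V) : PreAbstractSimplicialComplex V where
  faces := {t | t.Nonempty ∧ t ∪ s ∈ K ∧ Disjoint t s}
  isRelLowerSet_faces := fun _ ht => ⟨ht.1, fun _ hut hu =>
    ⟨hu, (K.isRelLowerSet_faces ht.2.1).2 (Finset.union_subset_union_left hut)
      (hu.mono Finset.subset_union_left), ht.2.2.mono_left hut⟩⟩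

/-- Combinatorial `d`-manifolds without boundary. For `d ≥ 1`, the link of every vertex is a
combinatorial `(d-1)`-sphere, that is, a combinatorial `(d-1)`-manifold without boundary that is
PL-homeomorphic to the boundary of the `d`-simplex. For `d = 0` the link of every vertex is the
`(-1)`-sphere, which is the empty complex. -/
def IsClosedCombinatorialManifold : ℕ → PreAbstractSimplicialComplex V → Prop
  | 0, K => ∀ v, {v} ∈ K → link K {v} = ⊥
  | d + 1, K => ∀ v, {v} ∈ K →
      IsClosedCombinatorialManifold d (link K {v}) ∧
        PLHomeomorphic (link K {v}) (simplexBoundary (d + 1))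

/-- Combinatorial `d`-manifolds, possibly with boundary. For `d ≥ 1`, the link of every vertex is
either a combinatorial `(d-1)`-sphere or a combinatorial `(d-1)`-disk, the latter being a
combinatorial `(d-1)`-manifold that is PL-homeomorphic to the `(d-1)`-simplex. For `d = 0` the link
of every vertex is empty. -/
def IsCombinatorialManifold : ℕ → PreAbstractSimplicialComplex V → Prop
  | 0, K => ∀ v, {v} ∈ K → link K {v} = ⊥
  | d + 1, K => ∀ v, {v} ∈ K →
      (IsClosedCombinatorialManifold d (link K {v}) ∧
        PLHomeomorphic (link K {v}) (simplexBoundary (d + 1))) ∨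
      (IsCombinatorialManifold d (link K {v}) ∧
        PLHomeomorphic (link K {v}) (fullSimplex d))

/-- Combinatorial `n`-disks. -/
def IsCombinatorialDisk (n : ℕ) (K : PreAbstractSimplicialComplex V) : Prop :=
  IsCombinatorialManifold n K ∧ PLHomeomorphic K (fullSimplex n)

/-- The boundary `∂K`, the subcomplex consisting of the faces whose link is a combinatorial disk.
(In a combinatorial manifold those faces are already closed under passing to nonempty subsets;
the closure is taken in order to have a complex without a hypothesis on `K`.) -/
def boundary (K : PreAbstractSimplicialComplex V) : PreAbstractSimplicialComplex V where
  faces := {s | s.Nonempty ∧ ∃ t ∈ K, s ⊆ t ∧ ∃ n, IsCombinatorialDisk n (link K t)}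
  isRelLowerSet_faces := fun _ hs => ⟨hs.1, fun _ hus hu =>
    ⟨hu, hs.2.imp fun _ ht => ⟨ht.1, hus.trans ht.2.1, ht.2.2⟩⟩⟩

end Manifold

section Coloring

variable {V C : Type*}

/-- The barycentric subdivision: its vertices are the faces of `K`, its faces are the nonempty
finite chains of faces of `K`. -/
def barycentricSubdivision (K : PreAbstractSimplicialComplex V) :
    PreAbstractSimplicialComplex (Finset V) where
  faces := {S | S.Nonempty ∧ (∀ s ∈ S, s ∈ K) ∧ ∀ s ∈ S, ∀ t ∈ S, s ⊆ t ∨ t ⊆ s}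
  isRelLowerSet_faces := fun _ hS => ⟨hS.1, fun _ hTS hT =>
    ⟨hT, fun s hs => hS.2.1 s (hTS hs), fun s hs t ht => hS.2.2 s (hTS hs) t (hTS ht)⟩⟩

/-- The barycenter of `|s|`. -/
noncomputable def barycenter (s : Finset V) : V →₀ ℝ :=
  ∑ v ∈ s, Finsupp.single v (1 / (s.card : ℝ))

/-- The closed simplex in `|K|` that is spanned by the barycenters of the members of the chain
`S`. -/
def chainSimplex (S : Finset (Finset V)) : Set (V →₀ ℝ) :=
  convexHull ℝ (barycenter '' (S : Set (Finset V)))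

/-- The subset of `|K|` covered by a subcomplex `X` of the barycentric subdivision of `K`. -/
def carrier (X : PreAbstractSimplicialComplex (Finset V)) : Set (V →₀ ℝ) :=
  ⋃ S ∈ X, chainSimplex S

/-- The Voronoi coloring: the colors of the vertices at which the barycentric coordinates of `x`
are maximal. -/
def voronoi (c : V → C) (x : V →₀ ℝ) : Set C :=
  {i | ∃ v ∈ x.support, c v = i ∧ ∀ w ∈ x.support, x w ≤ x v}

/-- The color class of a set `I` of colors: all points of `|K|` that have every color in `I`. -/
def colorClass (K : PreAbstractSimplicialComplex V) (c : V → C) (I : Set C) : Set (V →₀ ℝ) :=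
  {x ∈ realization K | I ⊆ voronoi c x}

/-- The subcomplex of the barycentric subdivision formed by all simplices that are contained in the
color class of `I`. -/
def colorClassComplex (K : PreAbstractSimplicialComplex V) (c : V → C) (I : Set C) :
    PreAbstractSimplicialComplex (Finset V) where
  faces := {S | S ∈ barycentricSubdivision K ∧ chainSimplex S ⊆ colorClass K c I}
  isRelLowerSet_faces := fun _ hS =>
    ⟨((barycentricSubdivision K).isRelLowerSet_faces hS.1).1, fun _ hTS hT =>
      ⟨((barycentricSubdivision K).isRelLowerSet_faces hS.1).2 hTS hT,
        (convexHull_mono (Set.image_mono (Finset.coe_subset.mpr hTS))).trans hS.2⟩⟩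

end Coloring

end ColoredManifold

/-!
The all-color class is a subcomplex for a combinatorial reason. The barycentric coordinates of a
point `x` decompose uniquely as a positive combination of indicator functions of the superlevel sets
of `x`, and these form the chain that spans the open simplex of `M'` containing `x`. The colors in
`c(x)` are those of the vertices in the smallest superlevel set. So `X` is the full subcomplex of
`M'` on the faces that have vertices of all `k` colors (`colorClassComplex_univ`).

For the links in `X`, let `S` be a chain of colorful faces with largest member `s`. Its link is the
join of two pieces: chains below `s`, that is, the link of `S \ {s}` in the complex of colorful
chains in `∂s`; and chains above `s`, that is, the barycentric subdivision of the link of `s` in `M`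
(`plHomeomorphic_link_colorfulChains`). The complex of colorful chains in `∂s` is a sphere: if a
chain vertex `t ⊆ s` is sent to the barycenter of `t` minus the color classes of `s` that are
contained in `t`, one obtains a linear homeomorphism with the join of the boundaries of the
simplices spanned by the color classes of `s` (`plHomeomorphic_colorfulChains_blockJoin`). By
induction all links in this sphere are spheres. So the link of `S` in `X` is the join of a sphere
with the link of `s` in `M`, and is therefore a sphere or a disk according to what the link of `s`
is.

This fits with the recursive definition of combinatorial manifolds, since they can be characterized
by the links of all faces (`isCombinatorialManifold_iff`), where a face whose link is a sphere must
not be contained in one whose link is a disk. The boundary then consists of the faces whose link is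
a disk (`mem_boundary_iff`), and `S` is a boundary face of `X` if and only if `s` is one of `M`.

The topological input is that a link is not both a sphere and a disk, and that the boundary of a
disk is preserved by piecewise linear homeomorphisms. Both follow from an elementary form of
invariance of the boundary (`not_interior_to_boundary`): a piecewise linear map is affine near a
generic point of a facet, and segments can be prolonged beyond interior points, but not in all
directions beyond boundary points.
-/

namespace ColoredManifold

open Filter Topology

/-! ### Faces and barycentric coordinates -/

section Basic

variable {V W U : Type*}

theorem face_nonempty {K : PreAbstractSimplicialComplex V} {s : Finset V} (hs : s ∈ K) :
    s.Nonempty :=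
  (K.isRelLowerSet_faces hs).1

theorem face_of_subset {K : PreAbstractSimplicialComplex V} {s t : Finset V} (hs : s ∈ K)
    (hts : t ⊆ s) (ht : t.Nonempty) : t ∈ K :=
  (K.isRelLowerSet_faces hs).2 hts ht

theorem complex_ext {K L : PreAbstractSimplicialComplex V} (h : ∀ s, s ∈ K ↔ s ∈ L) : K = L :=
  SetLike.ext h

/-- The sum of the barycentric coordinates, as a linear functional. -/
noncomputable def mass : (V →₀ ℝ) →ₗ[ℝ] ℝ :=
  Finsupp.linearCombination ℝ fun _ => (1 : ℝ)

theorem mass_eq_sum (x : V →₀ ℝ) : mass x = x.sum fun _ r => r := by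
  simp [mass, Finsupp.linearCombination_apply]

theorem mass_single (v : V) (r : ℝ) : mass (Finsupp.single v r) = r := by
  simp [mass]

theorem mass_eq_sum_of_support_subset {x : V →₀ ℝ} {s : Finset V} (h : x.support ⊆ s) :
    mass x = ∑ v ∈ s, x v := by
  rw [mass_eq_sum, Finsupp.sum_of_support_subset _ h _ (by simp)]

theorem mass_nonneg {x : V →₀ ℝ} (h : ∀ v, 0 ≤ x v) : 0 ≤ mass x := by
  rw [mass_eq_sum]
  exact Finset.sum_nonneg fun v _ => h v

theorem eq_zero_of_mass_eq_zero {x : V →₀ ℝ} (h : ∀ v, 0 ≤ x v) (hx : mass x = 0) : x = 0 := by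
  rw [mass_eq_sum] at hx
  have := (Finset.sum_eq_zero_iff_of_nonneg fun v _ => h v).1 hx
  ext v
  by_contra hv
  exact hv (this v (Finsupp.mem_support_iff.2 hv))

theorem mem_simplex {s : Finset V} {x : V →₀ ℝ} :
    x ∈ simplex s ↔ (∀ v, 0 ≤ x v) ∧ mass x = 1 ∧ x.support ⊆ s := by
  rw [mass_eq_sum]; rfl

theorem simplex_mono {s t : Finset V} (h : s ⊆ t) : simplex s ⊆ simplex t :=
  fun _ hx => ⟨hx.1, hx.2.1, hx.2.2.trans h⟩

theorem support_nonempty_of_mass {x : V →₀ ℝ} (h : mass x = 1) : x.support.Nonempty := by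
  rw [Finset.nonempty_iff_ne_empty]
  intro h0
  rw [Finsupp.support_eq_empty] at h0
  simp [h0] at h

theorem mem_realization {K : PreAbstractSimplicialComplex V} {x : V →₀ ℝ} :
    x ∈ realization K ↔ (∀ v, 0 ≤ x v) ∧ mass x = 1 ∧ x.support ∈ K := by
  simp only [realization, Set.mem_iUnion, exists_prop, mem_simplex]
  constructor
  · rintro ⟨s, hs, h0, h1, h2⟩
    exact ⟨h0, h1, face_of_subset hs h2 (support_nonempty_of_mass h1)⟩
  · rintro ⟨h0, h1, h2⟩
    exact ⟨_, h2, h0, h1, subset_rfl⟩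

theorem simplex_subset_realization {K : PreAbstractSimplicialComplex V} {s : Finset V}
    (hs : s ∈ K) : simplex s ⊆ realization K :=
  fun _ hx => Set.mem_iUnion₂.2 ⟨s, hs, hx⟩

theorem realization_mono {K L : PreAbstractSimplicialComplex V} (h : K ≤ L) :
    realization K ⊆ realization L :=
  fun _ hx => mem_realization.2
    ⟨(mem_realization.1 hx).1, (mem_realization.1 hx).2.1, h (mem_realization.1 hx).2.2⟩

theorem convex_simplex (s : Finset V) : Convex ℝ (simplex s) := by
  intro x hx y hy a b ha hb hab
  rw [mem_simplex] at *
  refine ⟨fun v => ?_, ?_, ?_⟩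
  · have := hx.1 v
    have := hy.1 v
    simp only [Finsupp.add_apply, Finsupp.smul_apply, smul_eq_mul]
    positivity
  · simp [hx.2.1, hy.2.1, hab]
  · classical
    refine Finsupp.support_add.trans (Finset.union_subset ?_ ?_)
    · exact Finsupp.support_smul.trans hx.2.2
    · exact Finsupp.support_smul.trans hy.2.2

theorem single_mem_simplex {s : Finset V} {v : V} (hv : v ∈ s) :
    Finsupp.single v (1 : ℝ) ∈ simplex s := by
  classical
  refine mem_simplex.2 ⟨fun w => ?_, mass_single _ _, ?_⟩
  · rw [Finsupp.single_apply]; split_ifs <;> simp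
  · exact Finsupp.support_single_subset.trans (by simpa using hv)

theorem eq_sum_single {x : V →₀ ℝ} {s : Finset V} (h : x.support ⊆ s) :
    x = ∑ v ∈ s, x v • Finsupp.single v (1 : ℝ) := by
  conv_lhs => rw [← Finsupp.sum_single x]
  rw [Finsupp.sum_of_support_subset _ h _ (by simp)]
  simp

/-- A linear map is determined on the vectors supported in `s` by the images of the vertices. -/
theorem linear_apply_eq_sum {E : Type*} [AddCommGroup E] [Module ℝ E] (F : (V →₀ ℝ) →ₗ[ℝ] E)
    {x : V →₀ ℝ} {s : Finset V} (h : x.support ⊆ s) :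
    F x = ∑ v ∈ s, x v • F (Finsupp.single v 1) := by
  conv_lhs => rw [eq_sum_single h]
  simp only [map_sum, map_smul]

theorem affine_apply_eq_sum {E : Type*} [AddCommGroup E] [Module ℝ E] (A : (V →₀ ℝ) →ᵃ[ℝ] E)
    {x : V →₀ ℝ} {s : Finset V} (h : x ∈ simplex s) :
    A x = ∑ v ∈ s, x v • A (Finsupp.single v 1) := by
  rw [mem_simplex] at h
  have h1 : ∑ v ∈ s, x v = 1 := by rw [← mass_eq_sum_of_support_subset h.2.2, h.2.1]
  have hA : ∀ y, A y = A.linear y + A 0 := fun y => congrFun A.decomp y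
  rw [hA x, linear_apply_eq_sum _ h.2.2]
  conv_rhs => enter [2, v]; rw [hA, smul_add]
  rw [Finset.sum_add_distrib, ← Finset.sum_smul, h1, one_smul]

theorem linear_mapsTo_simplex (F : (V →₀ ℝ) →ₗ[ℝ] (W →₀ ℝ)) {s : Finset V} {t : Finset W}
    (h : ∀ v ∈ s, F (Finsupp.single v 1) ∈ simplex t) {x : V →₀ ℝ} (hx : x ∈ simplex s) :
    F x ∈ simplex t := by
  rw [mem_simplex] at hx
  rw [linear_apply_eq_sum F hx.2.2]
  refine (convex_simplex t).sum_mem (fun v _ => hx.1 v) ?_ h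
  rw [← mass_eq_sum_of_support_subset hx.2.2, hx.2.1]

theorem mass_map_of_vertices (F : (V →₀ ℝ) →ₗ[ℝ] (W →₀ ℝ)) {s : Finset V}
    (h : ∀ v ∈ s, mass (F (Finsupp.single v 1)) = 1) {x : V →₀ ℝ} (hx : x.support ⊆ s) :
    mass (F x) = mass x := by
  rw [linear_apply_eq_sum F hx, map_sum, mass_eq_sum_of_support_subset hx]
  refine Finset.sum_congr rfl fun v hv => ?_
  rw [map_smul, h v hv, smul_eq_mul, mul_one]

end Basic

/-! ### Piecewise linear maps -/

section PL

variable {V W U : Type*}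

/-- `f` is piecewise affine on the closed simplex `|s|`: finitely many systems `Φ i` of affine
inequalities cut `|s|` into pieces, on each of which `f` agrees with an affine map. -/
def IsPLOn (s : Finset V) (f : (V →₀ ℝ) → (W →₀ ℝ)) : Prop :=
  ∃ (n : ℕ) (Φ : Fin n → Finset ((V →₀ ℝ) →ᵃ[ℝ] ℝ)) (A : Fin n → ((V →₀ ℝ) →ᵃ[ℝ] (W →₀ ℝ))),
    (∀ x ∈ simplex s, ∃ i, ∀ φ ∈ Φ i, φ x ≤ 0) ∧
    ∀ i, ∀ x ∈ simplex s, (∀ φ ∈ Φ i, φ x ≤ 0) → f x = A i x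

theorem isPL_iff {K : PreAbstractSimplicialComplex V} {f : (V →₀ ℝ) → (W →₀ ℝ)} :
    IsPL K f ↔ ∀ s ∈ K, IsPLOn s f := by
  refine forall₂_congr fun s _ => ?_
  constructor
  · rintro ⟨n, P, A, hP, h⟩
    choose h1 h2 using h
    choose Φ hΦ using h1
    refine ⟨n, Φ, A, fun x hx => ?_, fun i x hx hi => h2 i ?_⟩
    · obtain ⟨i, hi⟩ := Set.mem_iUnion.1 (hP ▸ hx)
      rw [hΦ i] at hi
      exact ⟨i, hi.2⟩
    · rw [hΦ i]; exact ⟨hx, hi⟩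
  · rintro ⟨n, Φ, A, hc, h⟩
    refine ⟨n, fun i => {x ∈ simplex s | ∀ φ ∈ Φ i, φ x ≤ 0}, A, ?_,
      fun i => ⟨⟨Φ i, rfl⟩, fun x hx => h i x hx.1 hx.2⟩⟩
    ext x
    simp only [Set.mem_iUnion, Set.mem_ofPred_eq]
    exact ⟨fun hx => (hc x hx).imp fun i hi => ⟨hx, hi⟩, fun ⟨i, hi⟩ => hi.1⟩

/-- The pieces may be indexed by any finite type. -/
theorem IsPLOn.of_finite {s : Finset V} {f : (V →₀ ℝ) → (W →₀ ℝ)} {ι : Type*} [Finite ι]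
    (Φ : ι → Finset ((V →₀ ℝ) →ᵃ[ℝ] ℝ)) (A : ι → ((V →₀ ℝ) →ᵃ[ℝ] (W →₀ ℝ)))
    (hc : ∀ x ∈ simplex s, ∃ i, ∀ φ ∈ Φ i, φ x ≤ 0)
    (h : ∀ i, ∀ x ∈ simplex s, (∀ φ ∈ Φ i, φ x ≤ 0) → f x = A i x) : IsPLOn s f := by
  obtain ⟨n, ⟨e⟩⟩ := Finite.exists_equiv_fin ι
  refine ⟨n, Φ ∘ e.symm, A ∘ e.symm, fun x hx => ?_, fun i x hx hi => h _ x hx hi⟩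
  obtain ⟨i, hi⟩ := hc x hx
  exact ⟨e i, by simpa using hi⟩

theorem IsPLOn.affine (s : Finset V) (A : (V →₀ ℝ) →ᵃ[ℝ] (W →₀ ℝ)) : IsPLOn s A :=
  IsPLOn.of_finite (ι := Unit) (fun _ => ∅) (fun _ => A) (by simp) (by simp)

theorem isPL_linear (K : PreAbstractSimplicialComplex V) (F : (V →₀ ℝ) →ₗ[ℝ] (W →₀ ℝ)) :
    IsPL K F :=
  isPL_iff.2 fun s _ => IsPLOn.affine s F.toAffineMap

theorem isPL_mono {K L : PreAbstractSimplicialComplex V} (h : K ≤ L) {f : (V →₀ ℝ) → (W →₀ ℝ)}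
    (hf : IsPL L f) : IsPL K f :=
  fun s hs => hf s (h hs)

/-- The `w`-coordinate of an affine map, as an affine functional. -/
noncomputable def coordAffine (A : (V →₀ ℝ) →ᵃ[ℝ] (W →₀ ℝ)) (w : W) : (V →₀ ℝ) →ᵃ[ℝ] ℝ :=
  (Finsupp.lapply w : (W →₀ ℝ) →ₗ[ℝ] ℝ).toAffineMap.comp A

@[simp]
theorem coordAffine_apply (A : (V →₀ ℝ) →ᵃ[ℝ] (W →₀ ℝ)) (w : W) (x : V →₀ ℝ) :
    coordAffine A w x = A x w := rfl

/-- If `f` maps `|s|` into `|L|` and every simplex of `L` is cut into finitely many pieces, then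
`|s|` is cut into finitely many pieces on which `f` is affine and each of which is mapped into a
single piece of a single simplex of `L`. Finitely many simplices of `L` suffice because an affine
piece of `f` only involves the supports of the images of the vertices of `s`. -/
theorem IsPLOn.refine {s : Finset V} {f : (V →₀ ℝ) → (W →₀ ℝ)} (hf : IsPLOn s f)
    {L : PreAbstractSimplicialComplex W} (hm : ∀ x ∈ simplex s, f x ∈ realization L)
    (N : Finset W → ℕ) (Ψ : ∀ u, Fin (N u) → Finset ((W →₀ ℝ) →ᵃ[ℝ] ℝ))
    (hΨ : ∀ u ∈ L, ∀ y ∈ simplex u, ∃ j, ∀ ψ ∈ Ψ u j, ψ y ≤ 0) :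
    ∃ (n : ℕ) (Φ : Fin n → Finset ((V →₀ ℝ) →ᵃ[ℝ] ℝ)) (A : Fin n → ((V →₀ ℝ) →ᵃ[ℝ] (W →₀ ℝ)))
      (u : Fin n → Finset W) (j : ∀ i, Fin (N (u i))),
      (∀ x ∈ simplex s, ∃ i, ∀ φ ∈ Φ i, φ x ≤ 0) ∧ (∀ i, u i ∈ L) ∧
      ∀ i, ∀ x ∈ simplex s, (∀ φ ∈ Φ i, φ x ≤ 0) →
        f x = A i x ∧ f x ∈ simplex (u i) ∧ ∀ ψ ∈ Ψ (u i) (j i), ψ (f x) ≤ 0 := by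
  classical
  obtain ⟨n, Φ, A, hc, h⟩ := hf
  -- Every image of a point of `|s|` has its support in `F`.
  let F : Finset W := Finset.univ.biUnion fun i : Fin n =>
    s.biUnion fun v => (A i (Finsupp.single v 1)).support
  have hF : ∀ i, ∀ x ∈ simplex s, (A i x).support ⊆ F := by
    intro i x hx
    rw [affine_apply_eq_sum _ hx]
    refine Finsupp.support_finsetSum.trans (Finset.biUnion_subset.2 fun v hv => ?_)
    refine Finsupp.support_smul.trans fun w hw => ?_
    simp only [F, Finset.mem_biUnion]
    exact ⟨i, Finset.mem_univ _, v, hv, hw⟩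
  let ι := Σ p : Fin n × {u : F.powerset // (u : Finset W) ∈ L}, Fin (N p.2.1.1)
  obtain ⟨m, ⟨e⟩⟩ := Finite.exists_equiv_fin ι
  let Θ : ι → Finset ((V →₀ ℝ) →ᵃ[ℝ] ℝ) := fun q =>
    Φ q.1.1 ∪ ((F \ q.1.2.1.1).image fun w => coordAffine (A q.1.1) w) ∪
      (Ψ q.1.2.1.1 q.2).image fun ψ => ψ.comp (A q.1.1)
  refine ⟨m, fun i => Θ (e.symm i), fun i => A (e.symm i).1.1, fun i => (e.symm i).1.2.1.1,
    fun i => (e.symm i).2, fun x hx => ?_, fun i => (e.symm i).1.2.2, fun i x hx hi => ?_⟩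
  · obtain ⟨i, hi⟩ := hc x hx
    have hfx := mem_realization.1 (hm x hx)
    have hAx := h i x hx hi
    obtain ⟨j, hj⟩ := hΨ _ hfx.2.2 (f x) (mem_simplex.2 ⟨hfx.1, hfx.2.1, subset_rfl⟩)
    let q : ι := ⟨(i, ⟨⟨(f x).support, Finset.mem_powerset.2 (hAx ▸ hF i x hx)⟩, hfx.2.2⟩), j⟩
    refine ⟨e q, ?_⟩
    change ∀ φ ∈ Θ (e.symm (e q)), φ x ≤ 0
    rw [Equiv.symm_apply_apply]
    intro φ hφ
    simp only [Θ, q, Finset.mem_union, Finset.mem_image, Finset.mem_sdiff] at hφ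
    rcases hφ with (hφ | ⟨w, ⟨_, hw⟩, rfl⟩) | ⟨ψ, hψ, rfl⟩
    · exact hi φ hφ
    · rw [coordAffine_apply, ← hAx]
      exact (Finsupp.notMem_support_iff.1 hw).le
    · simpa [← hAx] using hj ψ hψ
  · beta_reduce at hi ⊢
    generalize e.symm i = q at hi ⊢
    simp only [Θ, Finset.mem_union, Finset.mem_image, Finset.mem_sdiff] at hi
    have hAx := h q.1.1 x hx fun φ hφ => hi φ (Or.inl (Or.inl hφ))
    have hfx := mem_realization.1 (hm x hx)
    refine ⟨hAx, mem_simplex.2 ⟨hfx.1, hfx.2.1, fun w hw => ?_⟩, fun ψ hψ => ?_⟩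
    · by_contra hwu
      have := hi _ (Or.inl (Or.inr ⟨w, ⟨hF q.1.1 x hx (hAx ▸ hw), hwu⟩, rfl⟩))
      rw [coordAffine_apply, ← hAx] at this
      exact Finsupp.mem_support_iff.1 hw (le_antisymm this (hfx.1 w))
    · have := hi _ (Or.inr ⟨ψ, hψ, rfl⟩)
      simpa [← hAx] using this

theorem IsPLOn.comp {s : Finset V} {f : (V →₀ ℝ) → (W →₀ ℝ)} (hf : IsPLOn s f)
    {L : PreAbstractSimplicialComplex W} (hm : ∀ x ∈ simplex s, f x ∈ realization L)
    {g : (W →₀ ℝ) → (U →₀ ℝ)} (hg : IsPL L g) : IsPLOn s (g ∘ f) := by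
  rw [isPL_iff] at hg
  have hg' : ∀ u : Finset W, ∃ (n : ℕ) (Ψ : Fin n → Finset ((W →₀ ℝ) →ᵃ[ℝ] ℝ))
      (B : Fin n → ((W →₀ ℝ) →ᵃ[ℝ] (U →₀ ℝ))), u ∈ L →
      (∀ x ∈ simplex u, ∃ i, ∀ φ ∈ Ψ i, φ x ≤ 0) ∧
      ∀ i, ∀ x ∈ simplex u, (∀ φ ∈ Ψ i, φ x ≤ 0) → g x = B i x := by
    intro u
    by_cases hu : u ∈ L
    · obtain ⟨n, Ψ, B, h⟩ := hg u hu
      exact ⟨n, Ψ, B, fun _ => h⟩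
    · exact ⟨0, fun i => i.elim0, fun i => i.elim0, fun h => (hu h).elim⟩
  choose N Ψ B hB using hg'
  obtain ⟨n, Φ, A, u, j, hc, huL, h⟩ := hf.refine hm N Ψ fun u hu => (hB u hu).1
  refine ⟨n, Φ, fun i => (B (u i) (j i)).comp (A i), hc, fun i x hx hi => ?_⟩
  obtain ⟨h1, h2, h3⟩ := h i x hx hi
  rw [Function.comp_apply, (hB (u i) (huL i)).2 (j i) (f x) h2 h3, h1]
  rfl

theorem IsPL.comp {K : PreAbstractSimplicialComplex V} {L : PreAbstractSimplicialComplex W}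
    {f : (V →₀ ℝ) → (W →₀ ℝ)} {g : (W →₀ ℝ) → (U →₀ ℝ)} (hg : IsPL L g) (hf : IsPL K f)
    (hm : Set.MapsTo f (realization K) (realization L)) : IsPL K (g ∘ f) :=
  isPL_iff.2 fun s hs =>
    (isPL_iff.1 hf s hs).comp (fun _ hx => hm (simplex_subset_realization hs hx)) hg

/-- `f` and `g` are mutually inverse piecewise linear maps between `|K|` and `|L|`. -/
structure IsPLHomeo (K : PreAbstractSimplicialComplex V) (L : PreAbstractSimplicialComplex W)
    (f : (V →₀ ℝ) → (W →₀ ℝ)) (g : (W →₀ ℝ) → (V →₀ ℝ)) : Prop where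
  mapsTo : Set.MapsTo f (realization K) (realization L)
  mapsTo_inv : Set.MapsTo g (realization L) (realization K)
  invOn : Set.InvOn g f (realization K) (realization L)
  isPL : IsPL K f
  isPL_inv : IsPL L g

theorem IsPLHomeo.plHomeomorphic {K : PreAbstractSimplicialComplex V}
    {L : PreAbstractSimplicialComplex W} {f g} (h : IsPLHomeo K L f g) : PLHomeomorphic K L :=
  ⟨f, g, h.1, h.2, h.3, h.4, h.5⟩

theorem PLHomeomorphic.exists_isPLHomeo {K : PreAbstractSimplicialComplex V}
    {L : PreAbstractSimplicialComplex W} (h : PLHomeomorphic K L) : ∃ f g, IsPLHomeo K L f g := by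
  obtain ⟨f, g, h1, h2, h3, h4, h5⟩ := h
  exact ⟨f, g, h1, h2, h3, h4, h5⟩

theorem IsPLHomeo.symm {K : PreAbstractSimplicialComplex V} {L : PreAbstractSimplicialComplex W}
    {f g} (h : IsPLHomeo K L f g) : IsPLHomeo L K g f :=
  ⟨h.2, h.1, h.3.symm, h.5, h.4⟩

theorem IsPLHomeo.trans {K : PreAbstractSimplicialComplex V} {L : PreAbstractSimplicialComplex W}
    {N : PreAbstractSimplicialComplex U} {f g f' g'} (h : IsPLHomeo K L f g)
    (h' : IsPLHomeo L N f' g') : IsPLHomeo K N (f' ∘ f) (g ∘ g') :=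
  ⟨h'.1.comp h.1, h.2.comp h'.2, h.3.comp h'.3 h.1 h'.2, h'.4.comp h.4 h.1, h.5.comp h'.5 h'.2⟩

theorem IsPLHomeo.refl (K : PreAbstractSimplicialComplex V) : IsPLHomeo K K id id :=
  ⟨Set.mapsTo_id _, Set.mapsTo_id _, ⟨fun _ _ => rfl, fun _ _ => rfl⟩,
    isPL_linear K LinearMap.id, isPL_linear K LinearMap.id⟩

theorem PLHomeomorphic.refl (K : PreAbstractSimplicialComplex V) : PLHomeomorphic K K :=
  (IsPLHomeo.refl K).plHomeomorphic

theorem PLHomeomorphic.trans {K : PreAbstractSimplicialComplex V}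
    {L : PreAbstractSimplicialComplex W} {N : PreAbstractSimplicialComplex U}
    (h : PLHomeomorphic K L) (h' : PLHomeomorphic L N) : PLHomeomorphic K N := by
  obtain ⟨f, g, h⟩ := h.exists_isPLHomeo
  obtain ⟨f', g', h'⟩ := h'.exists_isPLHomeo
  exact (h.trans h').plHomeomorphic

theorem realization_bot : realization (⊥ : PreAbstractSimplicialComplex V) = ∅ := by
  ext x
  rw [mem_realization]
  simp only [Set.mem_empty_iff_false, iff_false]
  rintro ⟨_, _, h⟩
  exact h

theorem realization_nonempty {K : PreAbstractSimplicialComplex V} {s : Finset V} (hs : s ∈ K) :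
    (realization K).Nonempty := by
  obtain ⟨v, hv⟩ := face_nonempty hs
  exact ⟨_, simplex_subset_realization hs (single_mem_simplex hv)⟩

theorem mapsTo_lmapDomain [DecidableEq W] {K : PreAbstractSimplicialComplex V}
    {L : PreAbstractSimplicialComplex W} (φ : V → W) (hφ : ∀ s ∈ K, s.image φ ∈ L) :
    Set.MapsTo (Finsupp.lmapDomain ℝ ℝ φ) (realization K) (realization L) := by
  intro x hx
  rw [mem_realization] at hx
  refine simplex_subset_realization (hφ _ hx.2.2)
    (linear_mapsTo_simplex _ (fun v hv => ?_) (mem_simplex.2 ⟨hx.1, hx.2.1, subset_rfl⟩))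
  rw [Finsupp.lmapDomain_apply, Finsupp.mapDomain_single]
  exact single_mem_simplex (Finset.mem_image_of_mem _ hv)

theorem leftInvOn_lmapDomain {K : PreAbstractSimplicialComplex V} (φ : V → W) (ψ : W → V)
    (h : ∀ v, {v} ∈ K → ψ (φ v) = v) :
    Set.LeftInvOn (Finsupp.lmapDomain ℝ ℝ ψ) (Finsupp.lmapDomain ℝ ℝ φ) (realization K) := by
  intro x hx
  rw [mem_realization] at hx
  rw [← LinearMap.comp_apply, linear_apply_eq_sum _ (subset_refl x.support)]
  conv_rhs => rw [eq_sum_single (subset_refl x.support)]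
  refine Finset.sum_congr rfl fun v hv => ?_
  rw [LinearMap.comp_apply, Finsupp.lmapDomain_apply, Finsupp.lmapDomain_apply,
    Finsupp.mapDomain_single, Finsupp.mapDomain_single,
    h v (face_of_subset hx.2.2 (by simpa using hv) (by simp))]

/-- A simplicial isomorphism, given by vertex maps that are mutually inverse on vertices, induces a
piecewise linear homeomorphism. -/
theorem isPLHomeo_of_iso [DecidableEq V] [DecidableEq W] {K : PreAbstractSimplicialComplex V}
    {L : PreAbstractSimplicialComplex W} (φ : V → W) (ψ : W → V)
    (hφ : ∀ s ∈ K, s.image φ ∈ L) (hψ : ∀ t ∈ L, t.image ψ ∈ K)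
    (hψφ : ∀ v, {v} ∈ K → ψ (φ v) = v) (hφψ : ∀ w, {w} ∈ L → φ (ψ w) = w) :
    IsPLHomeo K L (Finsupp.lmapDomain ℝ ℝ φ) (Finsupp.lmapDomain ℝ ℝ ψ) :=
  ⟨mapsTo_lmapDomain φ hφ, mapsTo_lmapDomain ψ hψ,
    ⟨leftInvOn_lmapDomain φ ψ hψφ, leftInvOn_lmapDomain ψ φ hφψ⟩, isPL_linear _ _,
    isPL_linear _ _⟩

/-- A linear map that is injective on a closed simplex, with images of mass one, has a linear left
inverse on the vectors supported in that simplex. -/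
theorem exists_linear_leftInverse (F : (V →₀ ℝ) →ₗ[ℝ] (W →₀ ℝ)) {S : Finset V}
    (hSne : S.Nonempty) (hF : Set.InjOn F (simplex S))
    (hmass : ∀ v ∈ S, mass (F (Finsupp.single v 1)) = 1) :
    ∃ B : (W →₀ ℝ) →ₗ[ℝ] (V →₀ ℝ), (∀ y, (B y).support ⊆ S) ∧
      ∀ x : V →₀ ℝ, x.support ⊆ S → B (F x) = x := by
  classical
  let P := Finsupp.supported ℝ ℝ (S : Set V)
  have hP : ∀ x : V →₀ ℝ, x ∈ P ↔ x.support ⊆ S := fun x => by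
    rw [Finsupp.mem_supported]; exact Finset.coe_subset
  let G : P →ₗ[ℝ] (W →₀ ℝ) := F.comp P.subtype
  have hker : LinearMap.ker G = ⊥ := by
    rw [LinearMap.ker_eq_bot']
    rintro ⟨x, hx⟩ h0
    have hx0 : F x = 0 := h0
    rw [hP] at hx
    have hmx : mass x = 0 := by
      rw [← mass_map_of_vertices F hmass hx, hx0, map_zero]
    -- Move the barycenter of `S` by a small multiple of `x`.
    let b : V →₀ ℝ := ∑ v ∈ S, (S.card : ℝ)⁻¹ • Finsupp.single v 1
    have hcard : (0 : ℝ) < S.card := by exact_mod_cast hSne.card_pos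
    have hbv : ∀ v, b v = if v ∈ S then (S.card : ℝ)⁻¹ else 0 := by
      intro v
      simp only [b, Finsupp.coe_finsetSum, Finset.sum_apply, Finsupp.smul_apply,
        Finsupp.single_apply, smul_eq_mul, mul_ite, mul_one, mul_zero]
      rw [Finset.sum_ite_eq' S v]
    have hb : b ∈ simplex S := by
      refine (convex_simplex S).sum_mem (fun _ _ => by positivity) ?_
        fun v hv => single_mem_simplex hv
      rw [Finset.sum_const, nsmul_eq_mul, mul_inv_cancel₀ hcard.ne']
    obtain ⟨ε, hε, hεb⟩ : ∃ ε : ℝ, 0 < ε ∧ ∀ v ∈ S, 0 ≤ b v + ε * x v := by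
      have : ∀ᶠ ε : ℝ in 𝓝[>] 0, ∀ v ∈ S, 0 ≤ b v + ε * x v := by
        refine (Finset.eventually_all S).2 fun v hv => ?_
        have hc : Tendsto (fun ε : ℝ => b v + ε * x v) (𝓝[>] 0) (𝓝 (b v + 0 * x v)) :=
          tendsto_nhdsWithin_of_tendsto_nhds (Continuous.tendsto (by fun_prop) 0)
        have hpos : 0 < b v + 0 * x v := by
          rw [hbv, if_pos hv]; simpa using hcard
        exact (hc.eventually_const_lt hpos).mono fun _ h => h.le
      obtain ⟨ε, h1, h2⟩ := (this.and self_mem_nhdsWithin).exists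
      exact ⟨ε, h2, h1⟩
    have hb' : b + ε • x ∈ simplex S := by
      rw [mem_simplex] at hb ⊢
      have hsupp : (b + ε • x).support ⊆ S :=
        Finsupp.support_add.trans (Finset.union_subset hb.2.2 (Finsupp.support_smul.trans hx))
      refine ⟨fun v => ?_, by simp [hb.2.1, hmx], hsupp⟩
      by_cases hv : v ∈ S
      · simpa using hεb v hv
      · rw [Finsupp.notMem_support_iff.1 fun h => hv (hsupp h)]
    have := hF hb' hb (by simp [hx0])
    have hx0' : ε • x = 0 := by simpa using this
    exact Subtype.ext ((smul_eq_zero.1 hx0').resolve_left hε.ne')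
  obtain ⟨B, hB⟩ :=
    LinearMap.exists_leftInverse_of_injective (K := ℝ) (V := P) (V' := W →₀ ℝ) G hker
  refine ⟨P.subtype.comp B, fun y => (hP _).1 (B y).2, fun x hx => ?_⟩
  have := LinearMap.congr_fun hB ⟨x, (hP x).2 hx⟩
  exact congrArg Subtype.val this

/-- A linear map that restricts to a bijection `|K| → |L|` has a piecewise linear inverse, provided
that only finitely many vertices of `K` are needed over every simplex of `L`. -/
theorem exists_isPLHomeo_of_linear {K : PreAbstractSimplicialComplex V}
    {L : PreAbstractSimplicialComplex W} (F : (V →₀ ℝ) →ₗ[ℝ] (W →₀ ℝ))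
    (hF : Set.BijOn F (realization K) (realization L))
    (hfin : ∀ t ∈ L, ∃ E : Finset V, ∀ x ∈ realization K, F x ∈ simplex t → x.support ⊆ E) :
    ∃ g, IsPLHomeo K L F g := by
  classical
  have hinv := hF.invOn_invFunOn
  set g := Function.invFunOn F (realization K) with hg
  have hgm : Set.MapsTo g (realization L) (realization K) := hF.surjOn.mapsTo_invFunOn
  refine ⟨g, hF.mapsTo, hgm, hinv, isPL_linear _ _, isPL_iff.2 fun t ht => ?_⟩
  obtain ⟨E, hE⟩ := hfin t ht
  have hmass : ∀ S ∈ K, ∀ v ∈ S, mass (F (Finsupp.single v 1)) = 1 := fun S hS v hv =>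
    (mem_realization.1 (hF.mapsTo (simplex_subset_realization hS (single_mem_simplex hv)))).2.1
  have hleft : ∀ S ∈ K, ∃ B : (W →₀ ℝ) →ₗ[ℝ] (V →₀ ℝ), (∀ y, (B y).support ⊆ S) ∧
      ∀ x : V →₀ ℝ, x.support ⊆ S → B (F x) = x := fun S hS =>
    exists_linear_leftInverse F (face_nonempty hS)
      (hF.injOn.mono (simplex_subset_realization hS)) (hmass S hS)
  choose B hB1 hB2 using hleft
  -- The piece of `|t|` belonging to a face `S` of `K` is `F |S| ∩ |t|`, which is cut out by the
  -- conditions that the left inverse `B` has nonnegative coordinates and that `F (B y) = y`.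
  let ι := {S : E.powerset // (S : Finset V) ∈ K}
  let R : ι → Finset W := fun S => t ∪ S.1.1.biUnion fun v => (F (Finsupp.single v 1)).support
  let D : ι → ((W →₀ ℝ) →ᵃ[ℝ] (W →₀ ℝ)) := fun S =>
    (F.comp (B S.1.1 S.2) - LinearMap.id).toAffineMap
  let Φ : ι → Finset ((W →₀ ℝ) →ᵃ[ℝ] ℝ) := fun S =>
    (S.1.1.image fun v => - coordAffine (B S.1.1 S.2).toAffineMap v) ∪
      ((R S).image fun w => coordAffine (D S) w) ∪ ((R S).image fun w => - coordAffine (D S) w)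
  refine IsPLOn.of_finite Φ (fun S => (B S.1.1 S.2).toAffineMap) (fun y hy => ?_)
    fun S y hy hS => ?_
  · have hgy := hgm (simplex_subset_realization ht hy)
    have hFg : F (g y) = y := hinv.2 (simplex_subset_realization ht hy)
    have hgy' := mem_realization.1 hgy
    let S : ι := ⟨⟨(g y).support, Finset.mem_powerset.2 (hE _ hgy (hFg.symm ▸ hy))⟩, hgy'.2.2⟩
    have hBy : B S.1.1 S.2 y = g y := by
      conv_lhs => rw [← hFg]
      exact hB2 _ _ _ subset_rfl
    have hD : D S y = 0 := by
      change F (B S.1.1 S.2 y) - y = 0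
      rw [hBy, hFg, sub_self]
    refine ⟨S, fun φ hφ => ?_⟩
    simp only [Φ, Finset.mem_union, Finset.mem_image] at hφ
    rcases hφ with (⟨v, _, rfl⟩ | ⟨w, _, rfl⟩) | ⟨w, _, rfl⟩
    · change - (B S.1.1 S.2 y) v ≤ 0
      rw [hBy]
      linarith [hgy'.1 v]
    · rw [coordAffine_apply, hD]; simp
    · change - (D S y w) ≤ 0
      rw [hD]; simp
  · simp only [Φ, Finset.mem_union, Finset.mem_image] at hS
    have hy' := mem_simplex.1 hy
    have hsupp := hB1 S.1.1 S.2 y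
    have hFB : F (B S.1.1 S.2 y) = y := by
      ext w
      by_cases hw : w ∈ R S
      · have h1 := hS _ (Or.inl (Or.inr ⟨w, hw, rfl⟩))
        have h2 := hS _ (Or.inr ⟨w, hw, rfl⟩)
        change F (B S.1.1 S.2 y) w - y w ≤ 0 at h1
        change - (F (B S.1.1 S.2 y) w - y w) ≤ 0 at h2
        linarith
      · simp only [R, Finset.mem_union, Finset.mem_biUnion, not_or, not_exists, not_and] at hw
        rw [Finsupp.notMem_support_iff.1 fun h => hw.1 (hy'.2.2 h), linear_apply_eq_sum F hsupp,
          Finsupp.finsetSum_apply]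
        refine Finset.sum_eq_zero fun v hv => ?_
        rw [Finsupp.smul_apply, Finsupp.notMem_support_iff.1 (hw.2 v hv), smul_zero]
    have hmem : B S.1.1 S.2 y ∈ realization K := by
      refine simplex_subset_realization S.2 (mem_simplex.2 ⟨fun v => ?_, ?_, hsupp⟩)
      · by_cases hv : v ∈ S.1.1
        · have := hS _ (Or.inl (Or.inl ⟨v, hv, rfl⟩))
          change - (B S.1.1 S.2 y) v ≤ 0 at this
          linarith
        · rw [Finsupp.notMem_support_iff.1 fun h => hv (hsupp h)]
      · rw [← mass_map_of_vertices F (hmass S.1.1 S.2) hsupp, hFB, hy'.2.1]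
    have := hinv.1 hmem
    rw [hFB] at this
    exact this

end PL

/-! ### Joins -/

section Join

variable {V W V' W' : Type*}

/-- The simplicial join, on the disjoint union of the two vertex types. -/
def join (K : PreAbstractSimplicialComplex V) (L : PreAbstractSimplicialComplex W) :
    PreAbstractSimplicialComplex (V ⊕ W) where
  faces := {u | u.Nonempty ∧ (u.toLeft = ∅ ∨ u.toLeft ∈ K) ∧ (u.toRight = ∅ ∨ u.toRight ∈ L)}
  isRelLowerSet_faces := fun u hu => ⟨hu.1, fun t htu ht => by
    refine ⟨ht, ?_, ?_⟩
    · rcases t.toLeft.eq_empty_or_nonempty with h | h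
      · exact Or.inl h
      · have hsub := Finset.toLeft_subset_toLeft htu
        exact Or.inr (face_of_subset (hu.2.1.resolve_left (h.mono hsub).ne_empty) hsub h)
    · rcases t.toRight.eq_empty_or_nonempty with h | h
      · exact Or.inl h
      · have hsub := Finset.toRight_subset_toRight htu
        exact Or.inr (face_of_subset (hu.2.2.resolve_left (h.mono hsub).ne_empty) hsub h)⟩

theorem mem_join {K : PreAbstractSimplicialComplex V} {L : PreAbstractSimplicialComplex W}
    {u : Finset (V ⊕ W)} : u ∈ join K L ↔
      u.Nonempty ∧ (u.toLeft = ∅ ∨ u.toLeft ∈ K) ∧ (u.toRight = ∅ ∨ u.toRight ∈ L) :=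
  Iff.rfl

/-- The coordinates on the left summand. -/
noncomputable def fstL : (V ⊕ W →₀ ℝ) →ₗ[ℝ] (V →₀ ℝ) :=
  Finsupp.lcomapDomain Sum.inl Sum.inl_injective

/-- The coordinates on the right summand. -/
noncomputable def sndL : (V ⊕ W →₀ ℝ) →ₗ[ℝ] (W →₀ ℝ) :=
  Finsupp.lcomapDomain Sum.inr Sum.inr_injective

/-- Extension by zero from the left summand. -/
noncomputable def inL : (V →₀ ℝ) →ₗ[ℝ] (V ⊕ W →₀ ℝ) := Finsupp.lmapDomain ℝ ℝ Sum.inl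

/-- Extension by zero from the right summand. -/
noncomputable def inR : (W →₀ ℝ) →ₗ[ℝ] (V ⊕ W →₀ ℝ) := Finsupp.lmapDomain ℝ ℝ Sum.inr

@[simp] theorem fstL_apply (x : V ⊕ W →₀ ℝ) (v : V) : fstL x v = x (Sum.inl v) := rfl

@[simp] theorem sndL_apply (x : V ⊕ W →₀ ℝ) (w : W) : sndL x w = x (Sum.inr w) := rfl

@[simp] theorem inL_apply_inl (x : V →₀ ℝ) (v : V) : (inL x : V ⊕ W →₀ ℝ) (Sum.inl v) = x v :=
  Finsupp.mapDomain_apply Sum.inl_injective x v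

@[simp] theorem inL_apply_inr (x : V →₀ ℝ) (w : W) : (inL x : V ⊕ W →₀ ℝ) (Sum.inr w) = 0 :=
  Finsupp.mapDomain_of_notMem_range x _ (by simp)

@[simp] theorem inR_apply_inr (x : W →₀ ℝ) (w : W) : (inR x : V ⊕ W →₀ ℝ) (Sum.inr w) = x w :=
  Finsupp.mapDomain_apply Sum.inr_injective x w

@[simp] theorem inR_apply_inl (x : W →₀ ℝ) (v : V) : (inR x : V ⊕ W →₀ ℝ) (Sum.inl v) = 0 :=
  Finsupp.mapDomain_of_notMem_range x _ (by simp)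

@[simp] theorem fstL_inL_add_inR (x : V →₀ ℝ) (y : W →₀ ℝ) : fstL (inL x + inR y) = x := by
  ext; simp

@[simp] theorem sndL_inL_add_inR (x : V →₀ ℝ) (y : W →₀ ℝ) : sndL (inL x + inR y) = y := by
  ext; simp

theorem inL_fstL_add_inR_sndL (x : V ⊕ W →₀ ℝ) : inL (fstL x) + inR (sndL x) = x := by
  ext (v | w) <;> simp

theorem support_fstL (x : V ⊕ W →₀ ℝ) : (fstL x).support = x.support.toLeft := by
  ext v; simp

theorem support_sndL (x : V ⊕ W →₀ ℝ) : (sndL x).support = x.support.toRight := by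
  ext v; simp

theorem mass_inL (x : V →₀ ℝ) : mass (inL x : V ⊕ W →₀ ℝ) = mass x :=
  mass_map_of_vertices (s := x.support) inL
    (fun v _ => by simp [inL, Finsupp.mapDomain_single, mass_single]) subset_rfl

theorem mass_inR (x : W →₀ ℝ) : mass (inR x : V ⊕ W →₀ ℝ) = mass x :=
  mass_map_of_vertices (s := x.support) inR
    (fun v _ => by simp [inR, Finsupp.mapDomain_single, mass_single]) subset_rfl

theorem mass_eq_fstL_add_sndL (x : V ⊕ W →₀ ℝ) : mass x = mass (fstL x) + mass (sndL x) := by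
  conv_lhs => rw [← inL_fstL_add_inR_sndL x, map_add, mass_inL, mass_inR]

/-- The cone over `|K|` with apex the origin: all nonnegative multiples of points of `|K|`. -/
def coneOver (K : PreAbstractSimplicialComplex V) : Set (V →₀ ℝ) :=
  {x | (∀ v, 0 ≤ x v) ∧ (x.support = ∅ ∨ x.support ∈ K)}

theorem mem_realization_iff_coneOver {K : PreAbstractSimplicialComplex V} {x : V →₀ ℝ} :
    x ∈ realization K ↔ x ∈ coneOver K ∧ mass x = 1 := by
  rw [mem_realization]
  constructor
  · rintro ⟨h0, h1, h2⟩
    exact ⟨⟨h0, Or.inr h2⟩, h1⟩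
  · rintro ⟨⟨h0, h2⟩, h1⟩
    exact ⟨h0, h1, h2.resolve_left (support_nonempty_of_mass h1).ne_empty⟩

theorem smul_mem_coneOver {K : PreAbstractSimplicialComplex V} {x : V →₀ ℝ} {r : ℝ} (hr : 0 ≤ r)
    (hx : x ∈ coneOver K) : r • x ∈ coneOver K := by
  rcases hr.eq_or_lt with rfl | hr
  · rw [zero_smul]; exact ⟨fun _ => le_rfl, Or.inl rfl⟩
  · refine ⟨fun v => mul_nonneg hr.le (hx.1 v), ?_⟩
    rw [Finsupp.support_smul_eq hr.ne']
    exact hx.2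

theorem normalize_mem_realization {K : PreAbstractSimplicialComplex V} {x : V →₀ ℝ}
    (hx : x ∈ coneOver K) (hm : mass x ≠ 0) : (mass x)⁻¹ • x ∈ realization K := by
  rw [mem_realization_iff_coneOver]
  refine ⟨smul_mem_coneOver (inv_nonneg.2 (mass_nonneg hx.1)) hx, ?_⟩
  rw [map_smul, smul_eq_mul, inv_mul_cancel₀ hm]

theorem mem_realization_join {K : PreAbstractSimplicialComplex V}
    {L : PreAbstractSimplicialComplex W} {x : V ⊕ W →₀ ℝ} :
    x ∈ realization (join K L) ↔ fstL x ∈ coneOver K ∧ sndL x ∈ coneOver L ∧ mass x = 1 := by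
  rw [mem_realization, mem_join, ← support_fstL, ← support_sndL]
  constructor
  · rintro ⟨h0, h1, _, h2, h3⟩
    exact ⟨⟨fun v => h0 _, h2⟩, ⟨fun v => h0 _, h3⟩, h1⟩
  · rintro ⟨⟨h0, h2⟩, ⟨h0', h3⟩, h1⟩
    refine ⟨?_, h1, support_nonempty_of_mass h1, h2, h3⟩
    rintro (v | w)
    · exact h0 v
    · exact h0' w

/-- The extension of a map on points of mass one to the cone over them, by homogeneity. -/
noncomputable def homog (f : (V →₀ ℝ) → (W →₀ ℝ)) (x : V →₀ ℝ) : W →₀ ℝ :=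
  mass x • f ((mass x)⁻¹ • x)

/-- The homogeneous linear map that agrees with an affine map on the vectors of mass one. -/
noncomputable def homogAffine {E : Type*} [AddCommGroup E] [Module ℝ E]
    (A : (V →₀ ℝ) →ᵃ[ℝ] E) : (V →₀ ℝ) →ₗ[ℝ] E :=
  A.linear + mass.smulRight (A 0)

theorem homogAffine_apply {E : Type*} [AddCommGroup E] [Module ℝ E] (A : (V →₀ ℝ) →ᵃ[ℝ] E)
    {x : V →₀ ℝ} (hx : mass x ≠ 0) : homogAffine A x = mass x • A ((mass x)⁻¹ • x) := by
  have hA : ∀ y, A y = A.linear y + A 0 := fun y => congrFun A.decomp y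
  rw [hA ((mass x)⁻¹ • x), smul_add, map_smul, smul_smul, mul_inv_cancel₀ hx, one_smul]
  rfl

theorem homog_zero (f : (V →₀ ℝ) → (W →₀ ℝ)) : homog f 0 = 0 := by simp [homog]

theorem homog_mem_coneOver {K : PreAbstractSimplicialComplex V}
    {L : PreAbstractSimplicialComplex W} {f : (V →₀ ℝ) → (W →₀ ℝ)}
    (hf : Set.MapsTo f (realization K) (realization L)) {x : V →₀ ℝ} (hx : x ∈ coneOver K) :
    homog f x ∈ coneOver L ∧ mass (homog f x) = mass x := by
  by_cases hm : mass x = 0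
  · rw [eq_zero_of_mass_eq_zero hx.1 hm, homog_zero]
    exact ⟨⟨fun _ => le_rfl, Or.inl rfl⟩, by simp⟩
  · have := mem_realization_iff_coneOver.1 (hf (normalize_mem_realization hx hm))
    refine ⟨smul_mem_coneOver (mass_nonneg hx.1) this.1, ?_⟩
    rw [homog, map_smul, this.2, smul_eq_mul, mul_one]

theorem homog_leftInverse {K : PreAbstractSimplicialComplex V}
    {L : PreAbstractSimplicialComplex W} {f : (V →₀ ℝ) → (W →₀ ℝ)} {g : (W →₀ ℝ) → (V →₀ ℝ)}
    (hf : Set.MapsTo f (realization K) (realization L)) (h : Set.LeftInvOn g f (realization K))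
    {x : V →₀ ℝ} (hx : x ∈ coneOver K) : homog g (homog f x) = x := by
  by_cases hm : mass x = 0
  · rw [eq_zero_of_mass_eq_zero hx.1 hm, homog_zero, homog_zero]
  · rw [homog, (homog_mem_coneOver hf hx).2, homog, smul_smul, inv_mul_cancel₀ hm, one_smul,
      h (normalize_mem_realization hx hm), smul_smul, mul_inv_cancel₀ hm, one_smul]

theorem homog_id {x : V →₀ ℝ} (hx : ∀ v, 0 ≤ x v) : homog id x = x := by
  by_cases hm : mass x = 0
  · rw [eq_zero_of_mass_eq_zero hx hm, homog_zero]
  · rw [homog, id, smul_smul, mul_inv_cancel₀ hm, one_smul]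

/-- A map that is piecewise affine on a simplex extends to a map that is piecewise linear on the
cone over it. The empty simplex is allowed; its cone is the origin. -/
theorem exists_linear_pieces {K : PreAbstractSimplicialComplex V} {f : (V →₀ ℝ) → (W →₀ ℝ)}
    (hf : IsPL K f) {s : Finset V} (hs : s = ∅ ∨ s ∈ K) :
    ∃ (n : ℕ) (Φ : Fin n → Finset ((V →₀ ℝ) →ₗ[ℝ] ℝ)) (A : Fin n → ((V →₀ ℝ) →ₗ[ℝ] (W →₀ ℝ))),
      ∀ x : V →₀ ℝ, (∀ v, 0 ≤ x v) → x.support ⊆ s →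
        (∃ i, ∀ φ ∈ Φ i, φ x ≤ 0) ∧ ∀ i, (∀ φ ∈ Φ i, φ x ≤ 0) → homog f x = A i x := by
  classical
  rcases hs with rfl | hs
  · refine ⟨1, fun _ => ∅, fun _ => 0, fun x _ hx => ?_⟩
    rw [Finsupp.support_eq_empty.1 (Finset.subset_empty.1 hx)]
    simp [homog_zero]
  · obtain ⟨n, Φ, A, hc, h⟩ := isPL_iff.1 hf s hs
    refine ⟨n, fun i => (Φ i).image homogAffine, fun i => homogAffine (A i), fun x hx0 hxs => ?_⟩
    by_cases hm : mass x = 0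
    · rw [eq_zero_of_mass_eq_zero hx0 hm]
      obtain ⟨v, hv⟩ := face_nonempty hs
      obtain ⟨i, _⟩ := hc _ (single_mem_simplex hv)
      refine ⟨⟨i, fun φ _ => by simp⟩, fun i _ => by simp [homog_zero]⟩
    · have hpos : 0 < mass x := lt_of_le_of_ne (mass_nonneg hx0) (Ne.symm hm)
      have hy : (mass x)⁻¹ • x ∈ simplex s := by
        refine mem_simplex.2 ⟨fun v => mul_nonneg (inv_nonneg.2 hpos.le) (hx0 v), ?_,
          Finsupp.support_smul.trans hxs⟩
        rw [map_smul, smul_eq_mul, inv_mul_cancel₀ hm]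
      have hiff : ∀ i, (∀ φ ∈ (Φ i).image homogAffine, φ x ≤ 0) ↔
          ∀ φ ∈ Φ i, φ ((mass x)⁻¹ • x) ≤ 0 := by
        intro i
        simp only [Finset.forall_mem_image]
        refine forall₂_congr fun φ _ => ?_
        rw [homogAffine_apply φ hm, smul_eq_mul]
        exact ⟨fun h => le_of_mul_le_mul_left (by simpa using h) hpos,
          fun h => mul_nonpos_of_nonneg_of_nonpos hpos.le h⟩
      simp only [hiff]
      refine ⟨hc _ hy, fun i hi => ?_⟩
      rw [homogAffine_apply _ hm, homog, h i _ hy hi]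

/-- The join of two maps, given on the two summands by homogeneous extension. -/
noncomputable def joinMap (f : (V →₀ ℝ) → (V' →₀ ℝ)) (g : (W →₀ ℝ) → (W' →₀ ℝ))
    (x : V ⊕ W →₀ ℝ) : V' ⊕ W' →₀ ℝ :=
  inL (homog f (fstL x)) + inR (homog g (sndL x))

theorem joinMap_mapsTo {K : PreAbstractSimplicialComplex V} {L : PreAbstractSimplicialComplex W}
    {K' : PreAbstractSimplicialComplex V'} {L' : PreAbstractSimplicialComplex W'}
    {f : (V →₀ ℝ) → (V' →₀ ℝ)} {g : (W →₀ ℝ) → (W' →₀ ℝ)}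
    (hf : Set.MapsTo f (realization K) (realization K'))
    (hg : Set.MapsTo g (realization L) (realization L')) :
    Set.MapsTo (joinMap f g) (realization (join K L)) (realization (join K' L')) := by
  intro x hx
  rw [mem_realization_join] at hx ⊢
  rw [mass_eq_fstL_add_sndL] at hx ⊢
  have h1 := homog_mem_coneOver hf hx.1
  have h2 := homog_mem_coneOver hg hx.2.1
  rw [joinMap, fstL_inL_add_inR, sndL_inL_add_inR, h1.2, h2.2]
  exact ⟨h1.1, h2.1, hx.2.2⟩

theorem joinMap_leftInvOn {K : PreAbstractSimplicialComplex V}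
    {L : PreAbstractSimplicialComplex W} {K' : PreAbstractSimplicialComplex V'}
    {L' : PreAbstractSimplicialComplex W'}
    {f : (V →₀ ℝ) → (V' →₀ ℝ)} {g : (W →₀ ℝ) → (W' →₀ ℝ)}
    {f' : (V' →₀ ℝ) → (V →₀ ℝ)} {g' : (W' →₀ ℝ) → (W →₀ ℝ)}
    (hf : Set.MapsTo f (realization K) (realization K'))
    (hg : Set.MapsTo g (realization L) (realization L'))
    (hf' : Set.LeftInvOn f' f (realization K)) (hg' : Set.LeftInvOn g' g (realization L)) :
    Set.LeftInvOn (joinMap f' g') (joinMap f g) (realization (join K L)) := by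
  intro x hx
  rw [mem_realization_join] at hx
  rw [joinMap, joinMap, fstL_inL_add_inR, sndL_inL_add_inR, homog_leftInverse hf hf' hx.1,
    homog_leftInverse hg hg' hx.2.1, inL_fstL_add_inR_sndL]

theorem joinMap_isPL {K : PreAbstractSimplicialComplex V} {L : PreAbstractSimplicialComplex W}
    {f : (V →₀ ℝ) → (V' →₀ ℝ)} {g : (W →₀ ℝ) → (W' →₀ ℝ)} (hf : IsPL K f) (hg : IsPL L g) :
    IsPL (join K L) (joinMap f g) := by
  classical
  refine isPL_iff.2 fun u hu => ?_
  obtain ⟨n, Φ, A, hA⟩ := exists_linear_pieces hf hu.2.1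
  obtain ⟨m, Ψ, B, hB⟩ := exists_linear_pieces hg hu.2.2
  refine IsPLOn.of_finite (ι := Fin n × Fin m)
    (fun p => ((Φ p.1).image fun φ => (φ.comp fstL).toAffineMap) ∪
      (Ψ p.2).image fun ψ => (ψ.comp sndL).toAffineMap)
    (fun p => (inL.comp ((A p.1).comp fstL) + inR.comp ((B p.2).comp sndL)).toAffineMap)
    (fun x hx => ?_) fun p x hx hp => ?_
  all_goals
    rw [mem_simplex] at hx
    have h1 := hA (fstL x) (fun v => hx.1 _)
      (support_fstL x ▸ Finset.toLeft_subset_toLeft hx.2.2)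
    have h2 := hB (sndL x) (fun v => hx.1 _)
      (support_sndL x ▸ Finset.toRight_subset_toRight hx.2.2)
  · obtain ⟨i, hi⟩ := h1.1
    obtain ⟨j, hj⟩ := h2.1
    refine ⟨(i, j), fun φ hφ => ?_⟩
    rcases Finset.mem_union.1 hφ with hφ | hφ <;> obtain ⟨φ, h, rfl⟩ := Finset.mem_image.1 hφ
    · exact hi φ h
    · exact hj φ h
  · rw [joinMap, h1.2 p.1 fun φ hφ => hp _ (Finset.mem_union_left _ (Finset.mem_image_of_mem _ hφ)),
      h2.2 p.2 fun φ hφ => hp _ (Finset.mem_union_right _ (Finset.mem_image_of_mem _ hφ))]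
    rfl

theorem IsPLHomeo.join {K : PreAbstractSimplicialComplex V} {L : PreAbstractSimplicialComplex W}
    {K' : PreAbstractSimplicialComplex V'} {L' : PreAbstractSimplicialComplex W'} {f f' g g'}
    (hf : IsPLHomeo K K' f f') (hg : IsPLHomeo L L' g g') :
    IsPLHomeo (join K L) (join K' L') (joinMap f g) (joinMap f' g') :=
  ⟨joinMap_mapsTo hf.1 hg.1, joinMap_mapsTo hf.2 hg.2,
    ⟨joinMap_leftInvOn hf.1 hg.1 hf.3.1 hg.3.1, joinMap_leftInvOn hf.2 hg.2 hf.3.2 hg.3.2⟩,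
    joinMap_isPL hf.4 hg.4, joinMap_isPL hf.5 hg.5⟩

theorem PLHomeomorphic.join {K : PreAbstractSimplicialComplex V}
    {L : PreAbstractSimplicialComplex W} {K' : PreAbstractSimplicialComplex V'}
    {L' : PreAbstractSimplicialComplex W'} (hf : PLHomeomorphic K K') (hg : PLHomeomorphic L L') :
    PLHomeomorphic (join K L) (join K' L') := by
  obtain ⟨f, f', hf⟩ := hf.exists_isPLHomeo
  obtain ⟨g, g', hg⟩ := hg.exists_isPLHomeo
  exact (hf.join hg).plHomeomorphic

end Join

/-! ### Joins of simplices and boundaries of simplices -/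

section Stellar

variable {U : Type*}

/-- The complex of all faces of the simplex on the vertex set `T`. -/
def fullOn (T : Finset U) : PreAbstractSimplicialComplex U where
  faces := {s | s.Nonempty ∧ s ⊆ T}
  isRelLowerSet_faces := fun _ hs => ⟨hs.1, fun _ hts ht => ⟨ht, hts.trans hs.2⟩⟩

/-- The complex of all proper faces of the simplex on the vertex set `T`. -/
def bdryOn (T : Finset U) : PreAbstractSimplicialComplex U where
  faces := {s | s.Nonempty ∧ s ⊆ T ∧ ¬ T ⊆ s}
  isRelLowerSet_faces := fun _ hs => ⟨hs.1, fun _ hts ht =>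
    ⟨ht, hts.trans hs.2.1, fun h => hs.2.2 (h.trans hts)⟩⟩

theorem mem_fullOn {T s : Finset U} : s ∈ fullOn T ↔ s.Nonempty ∧ s ⊆ T := Iff.rfl

theorem mem_bdryOn {T s : Finset U} : s ∈ bdryOn T ↔ s.Nonempty ∧ s ⊆ T ∧ ¬ T ⊆ s := Iff.rfl

theorem mem_simplexBoundary {n : ℕ} {s : Finset (Fin (n + 1))} :
    s ∈ simplexBoundary n ↔ s.Nonempty ∧ s ≠ Finset.univ := Iff.rfl

theorem mem_fullSimplex {n : ℕ} {s : Finset (Fin (n + 1))} : s ∈ fullSimplex n ↔ s.Nonempty :=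
  Iff.rfl

theorem realization_fullOn (T : Finset U) : realization (fullOn T) = simplex T := by
  ext x
  rw [mem_realization, mem_simplex, mem_fullOn]
  exact ⟨fun h => ⟨h.1, h.2.1, h.2.2.2⟩,
    fun h => ⟨h.1, h.2.1, support_nonempty_of_mass h.2.1, h.2.2⟩⟩

/-- A simplex with `n + 1` vertices is isomorphic to the standard `n`-simplex, by an isomorphism
that respects the boundaries. -/
theorem plHomeomorphic_of_card {T : Finset U} {n : ℕ} (h : T.card = n + 1) :
    PLHomeomorphic (fullOn T) (fullSimplex n) ∧ PLHomeomorphic (bdryOn T) (simplexBoundary n) := by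
  classical
  let e : T ≃ Fin (n + 1) := T.equivFinOfCardEq h
  let φ : U → Fin (n + 1) := fun v => if h : v ∈ T then e ⟨v, h⟩ else 0
  let ψ : Fin (n + 1) → U := fun i => (e.symm i : U)
  have hψφ : ∀ v ∈ T, ψ (φ v) = v := fun v hv => by simp [ψ, φ, hv]
  have hφψ : ∀ i, φ (ψ i) = i := fun i => by simp [ψ, φ]
  have hψ : ∀ t : Finset (Fin (n + 1)), t.image ψ ⊆ T := fun t =>
    Finset.image_subset_iff.2 fun i _ => (e.symm i).2
  constructor
  · refine (isPLHomeo_of_iso (K := fullOn T) (L := fullSimplex n) φ ψ (fun s hs => hs.1.image _)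
      (fun t ht => ⟨ht.image _, hψ t⟩)
      (fun v hv => hψφ v (hv.2 (Finset.mem_singleton_self v))) fun i _ => hφψ i).plHomeomorphic
  · refine (isPLHomeo_of_iso (K := bdryOn T) (L := simplexBoundary n) φ ψ
      (fun s hs => ⟨hs.1.image _, fun hu => hs.2.2 fun v hv => ?_⟩)
      (fun t ht => ⟨ht.1.image _, hψ t, fun hT => ht.2 (Finset.eq_univ_of_forall fun i => ?_)⟩)
      (fun v hv => hψφ v (hv.2.1 (Finset.mem_singleton_self v)))
      fun i _ => hφψ i).plHomeomorphic
    · have : φ v ∈ s.image φ := hu ▸ Finset.mem_univ _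
      obtain ⟨w, hw, hwv⟩ := Finset.mem_image.1 this
      have := congrArg ψ hwv
      rw [hψφ w (hs.2.1 hw), hψφ v hv] at this
      exact this ▸ hw
    · obtain ⟨j, hj, hji⟩ := Finset.mem_image.1 (hT (e.symm i).2)
      have := congrArg φ hji
      rw [hφψ] at this
      rw [this, show φ ((e.symm i : T) : U) = i from hφψ i] at hj
      exact hj

theorem barycenter_apply [DecidableEq U] (s : Finset U) (v : U) :
    barycenter s v = if v ∈ s then 1 / (s.card : ℝ) else 0 := by
  rw [barycenter, Finsupp.finsetSum_apply]
  simp only [Finsupp.single_apply]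
  rw [Finset.sum_ite_eq' s v]

theorem barycenter_mem_simplex {s : Finset U} (hs : s.Nonempty) : barycenter s ∈ simplex s := by
  have hcard : (0 : ℝ) < s.card := by exact_mod_cast hs.card_pos
  have : barycenter s = ∑ v ∈ s, (1 / (s.card : ℝ)) • Finsupp.single v (1 : ℝ) := by
    simp [barycenter]
  rw [this]
  refine (convex_simplex s).sum_mem (fun _ _ => by positivity) ?_ fun v hv => single_mem_simplex hv
  rw [Finset.sum_const, nsmul_eq_mul]
  field_simp

/-- A homeomorphism restricts to subcomplexes that correspond to each other. -/
theorem IsPLHomeo.restrict {V W : Type*} {K K₀ : PreAbstractSimplicialComplex V}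
    {L L₀ : PreAbstractSimplicialComplex W} {f g} (h : IsPLHomeo K L f g) (hK : K₀ ≤ K)
    (hL : L₀ ≤ L) (hf : ∀ x ∈ realization K, x ∈ realization K₀ ↔ f x ∈ realization L₀) :
    IsPLHomeo K₀ L₀ f g := by
  refine ⟨fun x hx => (hf x (realization_mono hK hx)).1 hx, fun y hy => ?_,
    h.3.mono (realization_mono hK) (realization_mono hL), isPL_mono hK h.4, isPL_mono hL h.5⟩
  have hy' := realization_mono hL hy
  rw [hf _ (h.2 hy'), h.3.2 hy']
  exact hy

variable [DecidableEq U]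

/-- The join `∂A * B` of the boundary of a simplex with a simplex, for disjoint vertex sets. -/
def bdryJoinFull (A B : Finset U) : PreAbstractSimplicialComplex U where
  faces := {s | s.Nonempty ∧ s ⊆ A ∪ B ∧ ¬ A ⊆ s}
  isRelLowerSet_faces := fun _ hs => ⟨hs.1, fun _ hts ht =>
    ⟨ht, hts.trans hs.2.1, fun h => hs.2.2 (h.trans hts)⟩⟩

/-- The join `∂A * ∂B` of the boundaries of two simplices, for disjoint vertex sets. -/
def bdryJoinBdry (A B : Finset U) : PreAbstractSimplicialComplex U where
  faces := {s | s.Nonempty ∧ s ⊆ A ∪ B ∧ ¬ A ⊆ s ∧ ¬ B ⊆ s}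
  isRelLowerSet_faces := fun _ hs => ⟨hs.1, fun _ hts ht =>
    ⟨ht, hts.trans hs.2.1, fun h => hs.2.2.1 (h.trans hts), fun h => hs.2.2.2 (h.trans hts)⟩⟩

/-- The linear map that moves the vertex `b` to the barycenter of `A` and fixes the others. -/
noncomputable def stellarMap (A : Finset U) (b : U) : (U →₀ ℝ) →ₗ[ℝ] (U →₀ ℝ) :=
  Finsupp.linearCombination ℝ fun v => if v = b then barycenter A else Finsupp.single v 1

theorem stellarMap_single (A : Finset U) (b v : U) :
    stellarMap A b (Finsupp.single v 1) =
      if v = b then barycenter A else Finsupp.single v 1 := by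
  simp [stellarMap]

theorem stellarMap_apply (A : Finset U) (b : U) (x : U →₀ ℝ) (v : U) :
    stellarMap A b x v =
      (if v = b then 0 else x v) + x b * (if v ∈ A then 1 / (A.card : ℝ) else 0) := by
  induction x using Finsupp.induction_linear with
  | zero => simp
  | add x y hx hy =>
    rw [map_add, Finsupp.add_apply, hx, hy, Finsupp.add_apply, Finsupp.add_apply]
    split_ifs <;> ring
  | single w r =>
    have : Finsupp.single w r = r • Finsupp.single w (1 : ℝ) := by simp
    rw [this, map_smul, stellarMap_single]
    by_cases hw : w = b
    · subst hw
      by_cases hv : v = w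
      · simp [barycenter_apply, hv]
      · simp [barycenter_apply, hv]
    · by_cases hv : v = b
      · subst hv; simp [hw]
      · simp [hv, hw, Finsupp.single_apply]

/-- Starring the face `A` at its barycenter: for `b ∈ B`, the join `∂A * B` is piecewise linearly
homeomorphic to the simplex on `A ∪ (B \ {b})`. The inverse subtracts from the coordinates in `A`
their minimum and collects what was removed in the coordinate `b`. -/
theorem isPLHomeo_stellarMap {A B : Finset U} {b : U} (hb : b ∈ B) (hA : A.Nonempty)
    (hAB : Disjoint A B) :
    ∃ g, IsPLHomeo (bdryJoinFull A B) (fullOn (A ∪ B.erase b)) (stellarMap A b) g := by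
  have hbA : b ∉ A := fun h => Finset.disjoint_left.1 hAB h hb
  have hcard : (0 : ℝ) < A.card := by exact_mod_cast hA.card_pos
  have happA : ∀ (x : U →₀ ℝ), ∀ a ∈ A, stellarMap A b x a = x a + x b / A.card := by
    intro x a ha
    rw [stellarMap_apply, if_neg (fun h : a = b => hbA (h ▸ ha)), if_pos ha]
    ring
  have happ : ∀ (x : U →₀ ℝ) (v), v ∉ A → v ≠ b → stellarMap A b x v = x v := by
    intro x v hv hvb
    rw [stellarMap_apply, if_neg hvb, if_neg hv, mul_zero, add_zero]
  refine exists_isPLHomeo_of_linear _ ⟨?_, ?_, ?_⟩ fun t _ => ⟨A ∪ B, fun x hx _ =>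
    (mem_realization.1 hx).2.2.2.1⟩
  · intro x hx
    rw [mem_realization] at hx
    rw [realization_fullOn]
    refine linear_mapsTo_simplex _ (fun v hv => ?_)
      (mem_simplex.2 ⟨hx.1, hx.2.1, hx.2.2.2.1⟩)
    rw [stellarMap_single]
    split_ifs with h
    · exact simplex_mono Finset.subset_union_left (barycenter_mem_simplex hA)
    · refine single_mem_simplex ?_
      rcases Finset.mem_union.1 hv with hv | hv
      · exact Finset.mem_union_left _ hv
      · exact Finset.mem_union_right _ (Finset.mem_erase.2 ⟨h, hv⟩)
  · intro x hx y hy hxy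
    rw [mem_realization] at hx hy
    have key : ∀ x y : U →₀ ℝ, (∀ v, 0 ≤ x v) → (∀ v, 0 ≤ y v) → ¬ A ⊆ x.support →
        stellarMap A b x = stellarMap A b y → y b ≤ x b := by
      intro x y _ hy0 hxA h
      obtain ⟨a, ha, hxa⟩ := Finset.not_subset.1 hxA
      have := DFunLike.congr_fun h a
      rw [happA x a ha, happA y a ha, Finsupp.notMem_support_iff.1 hxa, zero_add] at this
      have h2 : y b / A.card ≤ x b / A.card := by linarith [hy0 a]
      exact (div_le_div_iff_of_pos_right hcard).1 h2
    have hxyb : x b = y b := le_antisymm (key y x hy.1 hx.1 hy.2.2.2.2 hxy.symm)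
      (key x y hx.1 hy.1 hx.2.2.2.2 hxy)
    ext v
    have hv := DFunLike.congr_fun hxy v
    by_cases hvb : v = b
    · rw [hvb, hxyb]
    by_cases hvA : v ∈ A
    · rw [happA x v hvA, happA y v hvA, hxyb] at hv
      linarith
    · rwa [happ x v hvA hvb, happ y v hvA hvb] at hv
  · intro y hy
    rw [realization_fullOn, mem_simplex] at hy
    obtain ⟨a, ha, hmin⟩ := Finset.exists_min_image A y hA
    have hyb : y b = 0 := Finsupp.notMem_support_iff.1 fun h => by
      rcases Finset.mem_union.1 (hy.2.2 h) with h | h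
      · exact hbA h
      · exact Finset.notMem_erase b B h
    let x : U →₀ ℝ := y - y a • (A.card : ℝ) • barycenter A + (A.card * y a) • Finsupp.single b 1
    have hxA : ∀ v ∈ A, x v = y v - y a := by
      intro v hv
      have : b ≠ v := fun h => hbA (h ▸ hv)
      simp [x, barycenter_apply, hv, this, hcard.ne']
    have hxb : x b = A.card * y a := by
      simp [x, barycenter_apply, hbA, hyb]
    have hx : ∀ v, v ∉ A → v ≠ b → x v = y v := by
      intro v hv hvb
      simp [x, barycenter_apply, hv, Ne.symm hvb]
    refine ⟨x, mem_realization.2 ⟨fun v => ?_, ?_, ?_⟩, ?_⟩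
    · by_cases hvb : v = b
      · rw [hvb, hxb]
        exact mul_nonneg hcard.le (hy.1 a)
      by_cases hvA : v ∈ A
      · rw [hxA v hvA]
        linarith [hmin v hvA]
      · rw [hx v hvA hvb]
        exact hy.1 v
    · have := (mem_simplex.1 (barycenter_mem_simplex hA)).2.1
      simp only [x, map_add, map_sub, map_smul, this, hy.2.1, mass_single, smul_eq_mul]
      ring
    · have hsub : x.support ⊆ A ∪ B := by
        intro v hv
        by_contra hvAB
        rw [Finset.mem_union, not_or] at hvAB
        have hvb : v ≠ b := fun h => hvAB.2 (h ▸ hb)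
        rw [Finsupp.mem_support_iff, hx v hvAB.1 hvb] at hv
        rcases Finset.mem_union.1 (hy.2.2 (Finsupp.mem_support_iff.2 hv)) with h | h
        · exact hvAB.1 h
        · exact hvAB.2 (Finset.mem_of_mem_erase h)
      refine ⟨?_, hsub, fun h => ?_⟩
      · rw [Finset.nonempty_iff_ne_empty]
        intro h0
        rw [Finsupp.support_eq_empty] at h0
        have hy0 : y = 0 := by
          ext v
          have hya : y a = 0 := by
            have : (A.card : ℝ) * y a = 0 := by rw [← hxb, h0]; rfl
            exact (mul_eq_zero.1 this).resolve_left hcard.ne'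
          by_cases hvb : v = b
          · rw [hvb, hyb]; rfl
          by_cases hvA : v ∈ A
          · have := hxA v hvA
            rw [h0, hya] at this
            simpa using this.symm
          · rw [← hx v hvA hvb, h0]
        have := hy.2.1
        rw [hy0, map_zero] at this
        exact zero_ne_one this
      · have := Finsupp.mem_support_iff.1 (h ha)
        rw [hxA a ha, sub_self] at this
        exact this rfl
    · ext v
      by_cases hvb : v = b
      · rw [stellarMap_apply, if_pos hvb, if_neg (fun h => hbA (hvb ▸ h)), hvb, hyb]
        ring
      by_cases hvA : v ∈ A
      · rw [happA x v hvA, hxA v hvA, hxb]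
        field_simp
        ring
      · rw [happ x v hvA hvb, hx v hvA hvb]

/-- The same map identifies `∂A * ∂B` with the boundary of the simplex on `A ∪ (B \ {b})`. -/
theorem isPLHomeo_stellarMap_bdry {A B : Finset U} {b : U} (hb : b ∈ B) (hA : A.Nonempty)
    (hAB : Disjoint A B) :
    ∃ g, IsPLHomeo (bdryJoinBdry A B) (bdryOn (A ∪ B.erase b)) (stellarMap A b) g := by
  obtain ⟨g, hg⟩ := isPLHomeo_stellarMap hb hA hAB
  have hbA : b ∉ A := fun h => Finset.disjoint_left.1 hAB h hb
  have hcard : (0 : ℝ) < A.card := by exact_mod_cast hA.card_pos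
  refine ⟨g, hg.restrict (fun s hs => ⟨hs.1, hs.2.1, hs.2.2.1⟩) (fun s hs => ⟨hs.1, hs.2.1⟩)
    fun x hx => ?_⟩
  have hFx := hg.1 hx
  rw [mem_realization] at hx hFx
  rw [mem_realization, mem_realization]
  have h1 : x.support ∈ bdryJoinBdry A B ↔ ¬ B ⊆ x.support :=
    ⟨fun h => h.2.2.2, fun h => ⟨hx.2.2.1, hx.2.2.2.1, hx.2.2.2.2, h⟩⟩
  have h2 : (stellarMap A b x).support ∈ bdryOn (A ∪ B.erase b) ↔
      ¬ A ∪ B.erase b ⊆ (stellarMap A b x).support :=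
    ⟨fun h => h.2.2, fun h => ⟨hFx.2.2.1, hFx.2.2.2, h⟩⟩
  simp only [hx.1, hx.2.1, hFx.1, hFx.2.1, h1, h2, implies_true, true_and]
  refine not_congr ⟨fun h v hv => ?_, fun h v hv => ?_⟩
  · rw [Finsupp.mem_support_iff, stellarMap_apply]
    have hxb : 0 < x b := lt_of_le_of_ne (hx.1 b) (Ne.symm (Finsupp.mem_support_iff.1 (h hb)))
    rcases Finset.mem_union.1 hv with hv | hv
    · rw [if_pos hv, if_neg fun h : v = b => hbA (h ▸ hv)]
      have := hx.1 v
      positivity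
    · rw [if_neg (Finset.ne_of_mem_erase hv),
        if_neg fun h => Finset.disjoint_left.1 hAB h (Finset.mem_of_mem_erase hv), mul_zero,
        add_zero]
      exact Finsupp.mem_support_iff.1 (h (Finset.mem_of_mem_erase hv))
  · obtain ⟨a, ha, hxa⟩ := Finset.not_subset.1 hx.2.2.2.2
    by_cases hvb : v = b
    · have := Finsupp.mem_support_iff.1 (h (Finset.mem_union_left _ ha))
      rw [stellarMap_apply, if_neg (fun h : a = b => hbA (h ▸ ha)),
        Finsupp.notMem_support_iff.1 hxa,
        zero_add] at this
      rw [hvb, Finsupp.mem_support_iff]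
      exact left_ne_zero_of_mul this
    · have := Finsupp.mem_support_iff.1
        (h (Finset.mem_union_right _ (Finset.mem_erase.2 ⟨hvb, hv⟩)))
      rw [stellarMap_apply, if_neg hvb, if_neg fun h => Finset.disjoint_left.1 hAB h hv, mul_zero,
        add_zero] at this
      exact Finsupp.mem_support_iff.2 this

theorem eq_empty_or_mem_simplexBoundary {n : ℕ} {s : Finset (Fin (n + 1))} :
    s = ∅ ∨ s ∈ simplexBoundary n ↔ ¬ Finset.univ ⊆ s := by
  rw [mem_simplexBoundary, Finset.univ_subset_iff]
  rcases s.eq_empty_or_nonempty with rfl | h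
  · simp [Finset.univ_nonempty.ne_empty.symm]
  · simp [h, h.ne_empty]

theorem join_fullOn_simplexBoundary_eq (T : Finset U) (a : ℕ) :
    join (fullOn T) (simplexBoundary a) =
      bdryJoinFull (Finset.disjSum ∅ Finset.univ) (T.disjSum ∅) := complex_ext fun s => by
  have h : s.toLeft = ∅ ∨ s.toLeft ∈ fullOn T ↔ s.toLeft ⊆ T := by
    rw [mem_fullOn]
    rcases s.toLeft.eq_empty_or_nonempty with h | h
    · simp [h]
    · simp [h, h.ne_empty]
  have h' : Finset.disjSum ∅ Finset.univ ∪ T.disjSum ∅ =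
      T.disjSum (Finset.univ : Finset (Fin (a + 1))) := by ext (v | v) <;> simp
  rw [mem_join, h, eq_empty_or_mem_simplexBoundary]
  change _ ↔ s.Nonempty ∧ _ ∧ _
  rw [h', Finset.subset_disjSum, Finset.disjSum_subset]
  simp

/-- The join of a sphere with a disk is a disk. -/
theorem join_simplexBoundary_fullSimplex (a b : ℕ) :
    PLHomeomorphic (join (simplexBoundary a) (fullSimplex b)) (fullSimplex (a + b)) := by
  let A : Finset (Fin (a + 1) ⊕ Fin (b + 1)) := Finset.univ.disjSum ∅
  let B : Finset (Fin (a + 1) ⊕ Fin (b + 1)) := Finset.disjSum ∅ Finset.univ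
  have hAB : Disjoint A B := Finset.disjoint_left.2 (by rintro (x | x) <;> simp [A, B])
  have hb : Sum.inr 0 ∈ B := by simp [B]
  have hA : A.Nonempty := ⟨Sum.inl 0, by simp [A]⟩
  obtain ⟨g, hg⟩ := isPLHomeo_stellarMap hb hA hAB
  have heq : join (simplexBoundary a) (fullSimplex b) = bdryJoinFull A B := complex_ext fun s => by
    rw [mem_join, eq_empty_or_mem_simplexBoundary, mem_fullSimplex]
    change _ ↔ s.Nonempty ∧ s ⊆ A ∪ B ∧ ¬ A ⊆ s
    have h : s ⊆ A ∪ B := by rintro (x | x) _ <;> simp [A, B]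
    rw [Finset.disjSum_subset]
    simp [h, s.toRight.eq_empty_or_nonempty]
  rw [heq]
  refine hg.plHomeomorphic.trans (plHomeomorphic_of_card ?_).1
  rw [Finset.card_union_of_disjoint (hAB.mono_right (Finset.erase_subset _ _)),
    Finset.card_erase_of_mem hb]
  simp [A, B]; omega

/-- The join of two spheres is a sphere. -/
theorem join_simplexBoundary_simplexBoundary (a b : ℕ) :
    PLHomeomorphic (join (simplexBoundary a) (simplexBoundary b)) (simplexBoundary (a + b)) := by
  let A : Finset (Fin (a + 1) ⊕ Fin (b + 1)) := Finset.univ.disjSum ∅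
  let B : Finset (Fin (a + 1) ⊕ Fin (b + 1)) := Finset.disjSum ∅ Finset.univ
  have hAB : Disjoint A B := Finset.disjoint_left.2 (by rintro (x | x) <;> simp [A, B])
  have hb : Sum.inr 0 ∈ B := by simp [B]
  have hA : A.Nonempty := ⟨Sum.inl 0, by simp [A]⟩
  obtain ⟨g, hg⟩ := isPLHomeo_stellarMap_bdry hb hA hAB
  have heq : join (simplexBoundary a) (simplexBoundary b) = bdryJoinBdry A B :=
    complex_ext fun s => by
      rw [mem_join, eq_empty_or_mem_simplexBoundary, eq_empty_or_mem_simplexBoundary]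
      change _ ↔ s.Nonempty ∧ s ⊆ A ∪ B ∧ ¬ A ⊆ s ∧ ¬ B ⊆ s
      have h : s ⊆ A ∪ B := by rintro (x | x) _ <;> simp [A, B]
      rw [Finset.disjSum_subset, Finset.disjSum_subset]
      simp [h]
  rw [heq]
  refine hg.plHomeomorphic.trans (plHomeomorphic_of_card ?_).2
  rw [Finset.card_union_of_disjoint (hAB.mono_right (Finset.erase_subset _ _)),
    Finset.card_erase_of_mem hb]
  simp [A, B]; omega

end Stellar

/-! ### Piecewise linear maps along short segments -/

section Germs

theorem eventually_add_mul_pos {a : ℝ} (ha : 0 < a) (b : ℝ) :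
    ∀ᶠ ε : ℝ in 𝓝[>] 0, 0 < a + ε * b := by
  have hc : Tendsto (fun ε : ℝ => a + ε * b) (𝓝[>] 0) (𝓝 (a + 0 * b)) :=
    tendsto_nhdsWithin_of_tendsto_nhds (Continuous.tendsto (by fun_prop) 0)
  exact hc.eventually_const_lt (by simpa using ha)

theorem eventually_add_mul_neg {a : ℝ} (ha : a < 0) (b : ℝ) :
    ∀ᶠ ε : ℝ in 𝓝[>] 0, a + ε * b < 0 := by
  filter_upwards [eventually_add_mul_pos (neg_pos.2 ha) (-b)] with ε hε
  linarith

/-- An affine function of `ε` has a constant sign for small `ε > 0`; if it is nonpositive there, it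
is nonpositive at `0` as well. -/
theorem eventually_nonpos_or_pos (a b : ℝ) :
    (a ≤ 0 ∧ ∀ᶠ ε : ℝ in 𝓝[>] 0, a + ε * b ≤ 0) ∨ ∀ᶠ ε : ℝ in 𝓝[>] 0, 0 < a + ε * b := by
  rcases lt_trichotomy a 0 with ha | rfl | ha
  · exact Or.inl ⟨ha.le, (eventually_add_mul_neg ha b).mono fun _ h => h.le⟩
  · rcases le_or_gt b 0 with hb | hb
    · refine Or.inl ⟨le_rfl, ?_⟩
      filter_upwards [self_mem_nhdsWithin] with ε (hε : 0 < ε)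
      nlinarith
    · refine Or.inr ?_
      filter_upwards [self_mem_nhdsWithin] with ε (hε : 0 < ε)
      positivity
  · exact Or.inr (eventually_add_mul_pos ha b)

theorem nonpos_of_frequently {a b : ℝ} (h : ∃ᶠ ε : ℝ in 𝓝[>] 0, a + ε * b ≤ 0) :
    a ≤ 0 ∧ ∀ᶠ ε : ℝ in 𝓝[>] 0, a + ε * b ≤ 0 := by
  refine (eventually_nonpos_or_pos a b).resolve_right fun h' => ?_
  obtain ⟨ε, h1, h2⟩ := (h.and_eventually h').exists
  exact absurd h1 (not_le.2 h2)

theorem eventually_add_mul_ne_zero {a b : ℝ} (h : a ≠ 0 ∨ b ≠ 0) :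
    ∀ᶠ ε : ℝ in 𝓝[>] 0, a + ε * b ≠ 0 := by
  rcases lt_trichotomy a 0 with ha | rfl | ha
  · exact (eventually_add_mul_neg ha b).mono fun _ h => h.ne
  · filter_upwards [self_mem_nhdsWithin] with ε (hε : 0 < ε)
    simpa [hε.ne'] using h
  · exact (eventually_add_mul_pos ha b).mono fun _ h => h.ne'

theorem eventually_le_one : ∀ᶠ ε : ℝ in 𝓝[>] 0, 0 < ε ∧ ε ≤ 1 :=
  (show ∀ᶠ ε : ℝ in 𝓝[>] 0, ε ∈ Set.Ioc (0 : ℝ) 1 from Ioc_mem_nhdsGT one_pos)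

theorem affine_add_smul {E F : Type*} [AddCommGroup E] [Module ℝ E] [AddCommGroup F] [Module ℝ F]
    (A : E →ᵃ[ℝ] F) (x v : E) (ε : ℝ) : A (x + ε • v) = A x + ε • A.linear v := by
  have := A.map_vadd x (ε • v)
  rw [vadd_eq_add, vadd_eq_add, map_smul] at this
  rw [add_comm, this, add_comm]

theorem linear_sub {E F : Type*} [AddCommGroup E] [Module ℝ E] [AddCommGroup F] [Module ℝ F]
    (A : E →ᵃ[ℝ] F) (x y : E) : A.linear (x - y) = A x - A y := by
  simpa using A.linearMap_vsub x y

variable {V W U : Type*}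

theorem eventually_support_eq [DecidableEq V] (x v : V →₀ ℝ) :
    ∀ᶠ ε : ℝ in 𝓝[>] 0, (x + ε • v).support = x.support ∪ v.support := by
  have h : ∀ᶠ ε : ℝ in 𝓝[>] 0, ∀ w ∈ x.support ∪ v.support, x w + ε * v w ≠ 0 := by
    refine (Finset.eventually_all _).2 fun w hw => eventually_add_mul_ne_zero ?_
    simpa using hw
  filter_upwards [h] with ε hε
  refine Finset.Subset.antisymm (Finsupp.support_add.trans
    (Finset.union_subset_union_right Finsupp.support_smul)) fun w hw => ?_
  simpa using hε w hw

/-- Piecewise linear maps are affine along short segments. -/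
theorem IsPL.germ {K : PreAbstractSimplicialComplex V} {f : (V →₀ ℝ) → (W →₀ ℝ)} (hf : IsPL K f)
    {x v : V →₀ ℝ} (hx : x ∈ realization K)
    (hv : ∀ᶠ ε : ℝ in 𝓝[>] 0, x + ε • v ∈ realization K) :
    ∃ u, ∀ᶠ ε : ℝ in 𝓝[>] 0, f (x + ε • v) = f x + ε • u := by
  classical
  rw [mem_realization] at hx
  have hs : x.support ∪ v.support ∈ K := by
    obtain ⟨ε, h1, h2⟩ := (hv.and (eventually_support_eq x v)).exists
    exact h2 ▸ (mem_realization.1 h1).2.2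
  have hv' : ∀ᶠ ε : ℝ in 𝓝[>] 0, x + ε • v ∈ simplex (x.support ∪ v.support) := by
    filter_upwards [hv, eventually_support_eq x v] with ε h1 h2
    exact mem_simplex.2 ⟨(mem_realization.1 h1).1, (mem_realization.1 h1).2.1, h2.subset⟩
  obtain ⟨n, Φ, A, hc, h⟩ := isPL_iff.1 hf _ hs
  obtain ⟨i, hi⟩ : ∃ i, ∃ᶠ ε : ℝ in 𝓝[>] 0, ∀ φ ∈ Φ i, φ (x + ε • v) ≤ 0 := by
    by_contra hcon
    rw [not_exists] at hcon
    have hcon' : ∀ᶠ ε : ℝ in 𝓝[>] 0, ∀ i, ¬ ∀ φ ∈ Φ i, φ (x + ε • v) ≤ 0 :=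
      eventually_all.2 fun i => not_frequently.1 (hcon i)
    obtain ⟨ε, h1, h2⟩ := (hcon'.and hv').exists
    obtain ⟨i, hi⟩ := hc _ h2
    exact h1 i hi
  have hφ : ∀ φ ∈ Φ i, φ x ≤ 0 ∧ ∀ᶠ ε : ℝ in 𝓝[>] 0, φ (x + ε • v) ≤ 0 := by
    intro φ hφ
    have := hi.mono fun ε h => h φ hφ
    simp only [affine_add_smul, smul_eq_mul] at this ⊢
    exact nonpos_of_frequently this
  refine ⟨(A i).linear v, ?_⟩
  filter_upwards [hv', (Finset.eventually_all _).2 fun φ h => (hφ φ h).2] with ε h1 h2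
  rw [h i _ h1 h2, h i x (mem_simplex.2 ⟨hx.1, hx.2.1, Finset.subset_union_left⟩)
    fun φ h => (hφ φ h).1, affine_add_smul]

/-- Finitely many affine functionals do not vanish at a suitable point of a simplex, unless they
vanish on the whole simplex. -/
theorem exists_generic_point {T : Finset V} (hT : T.Nonempty)
    (Φ : Finset ((V →₀ ℝ) →ᵃ[ℝ] ℝ)) :
    ∃ q ∈ simplex T, ∀ φ ∈ Φ, (∃ z ∈ simplex T, φ z ≠ 0) → φ q ≠ 0 := by
  classical
  induction Φ using Finset.induction_on with
  | empty =>
    exact ⟨barycenter T, barycenter_mem_simplex hT, by simp⟩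
  | insert φ Φ _ ih =>
    obtain ⟨q, hq, hqΦ⟩ := ih
    by_cases hφ : ∃ z ∈ simplex T, φ z ≠ 0
    · obtain ⟨z, hz, hφz⟩ := hφ
      have h1 : ∀ᶠ ε : ℝ in 𝓝[>] 0, φ (q + ε • (z - q)) ≠ 0 := by
        simp only [affine_add_smul, smul_eq_mul, linear_sub]
        refine eventually_add_mul_ne_zero ?_
        by_contra! h
        rw [h.1, sub_zero] at h
        exact hφz h.2
      have h2 : ∀ᶠ ε : ℝ in 𝓝[>] 0, ∀ ψ ∈ Φ, (∃ z ∈ simplex T, ψ z ≠ 0) →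
          ψ (q + ε • (z - q)) ≠ 0 := by
        refine (Finset.eventually_all _).2 fun ψ hψ => ?_
        by_cases hne : ∃ z ∈ simplex T, ψ z ≠ 0
        · simp only [affine_add_smul, smul_eq_mul]
          exact (eventually_add_mul_ne_zero (Or.inl (hqΦ ψ hψ hne))).mono fun _ h _ => h
        · exact Eventually.of_forall fun _ h => (hne h).elim
      obtain ⟨ε, ⟨h1, h2⟩, h3⟩ := ((h1.and h2).and eventually_le_one).exists
      refine ⟨q + ε • (z - q), (convex_simplex T).add_smul_sub_mem hq hz ⟨h3.1.le, h3.2⟩,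
        fun ψ hψ hne => ?_⟩
      rcases Finset.mem_insert.1 hψ with rfl | hψ
      · exact h1
      · exact h2 ψ hψ hne
    · refine ⟨q, hq, fun ψ hψ hne => ?_⟩
      rcases Finset.mem_insert.1 hψ with rfl | hψ
      · exact (hφ hne).elim
      · exact hqΦ ψ hψ hne

end Germs

/-! ### Invariance of the boundary -/

section Local

/-- The closed star of `r` in `K`: all faces that span a face together with `r`. -/
def closedStar {V : Type*} [DecidableEq V] (K : PreAbstractSimplicialComplex V) (r : Finset V) :
    PreAbstractSimplicialComplex V where
  faces := {s | s ∈ K ∧ s ∪ r ∈ K}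
  isRelLowerSet_faces := fun _ hs => ⟨face_nonempty hs.1, fun _ hts ht =>
    ⟨face_of_subset hs.1 hts ht, face_of_subset hs.2 (Finset.union_subset_union_left hts)
      (ht.mono Finset.subset_union_left)⟩⟩

theorem closedStar_le {V : Type*} [DecidableEq V] (K : PreAbstractSimplicialComplex V)
    (r : Finset V) : closedStar K r ≤ K := fun _ hs => hs.1

theorem mem_closedStar_of_subset {V : Type*} [DecidableEq V] {K : PreAbstractSimplicialComplex V}
    {r s : Finset V} (hs : s ∈ K) (h : r ⊆ s) : s ∈ closedStar K r :=
  ⟨hs, by rwa [Finset.union_eq_left.2 h]⟩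

theorem mem_realization_closedStar {V : Type*} [DecidableEq V]
    {K : PreAbstractSimplicialComplex V} {r : Finset V} {x : V →₀ ℝ} (hx : x ∈ realization K)
    (h : r ⊆ x.support) : x ∈ realization (closedStar K r) := by
  rw [mem_realization] at hx ⊢
  exact ⟨hx.1, hx.2.1, mem_closedStar_of_subset hx.2.2 h⟩

variable {V₁ V₂ U₁ U₂ : Type*} [DecidableEq V₁] [DecidableEq V₂]

/-- Local invariance of the boundary: a piecewise linear homeomorphism cannot map a point `x` whose
star is a simplex with `x` in its interior to a point whose star is a simplex with that point on its
boundary. Near the boundary point there is a point `q` in the interior of a facet such that the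
coordinate change `α ∘ G` between the two stars is affine near `q`. Its image is interior, so that
the segment that enters the simplex at `q` can be prolonged beyond the image of `q`. Pulled back,
the prolongation has to leave the simplex at `q`. -/
theorem not_interior_to_boundary {K₁ : PreAbstractSimplicialComplex V₁}
    {K₂ : PreAbstractSimplicialComplex V₂} {h h'} (hh : IsPLHomeo K₁ K₂ h h')
    {x : V₁ →₀ ℝ} (hx : x ∈ realization K₁)
    {T₁ : Finset U₁} {α α'} (hα : IsPLHomeo (closedStar K₁ x.support) (fullOn T₁) α α')
    (hαx : T₁ ⊆ (α x).support)
    {T₂ : Finset U₂} {β β'} (hβ : IsPLHomeo (closedStar K₂ (h x).support) (fullOn T₂) β β')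
    (hβx : ¬ T₂ ⊆ (β (h x)).support) : False := by
  classical
  have hT₁ := realization_fullOn T₁
  have hT₂ := realization_fullOn T₂
  have hle₁ := realization_mono (closedStar_le K₁ x.support)
  have hle₂ := realization_mono (closedStar_le K₂ (h x).support)
  have hxs : x ∈ realization (closedStar K₁ x.support) := mem_realization_closedStar hx subset_rfl
  have hys : h x ∈ realization (closedStar K₂ (h x).support) :=
    mem_realization_closedStar (hh.1 hx) subset_rfl
  obtain ⟨j, hjT, hj⟩ := Finset.not_subset.1 hβx
  set q₀ := β (h x) with hq₀
  have hq₀s : q₀ ∈ simplex T₂ := hT₂ ▸ hβ.1 hys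
  set G := h' ∘ β' with hG
  have hβ'm : Set.MapsTo β' (realization (fullOn T₂)) (realization K₂) :=
    fun z hz => hle₂ (hβ.2 hz)
  have hGm : Set.MapsTo G (realization (fullOn T₂)) (realization K₁) := hh.2.comp hβ'm
  have hGPL : IsPL (fullOn T₂) G := hh.5.comp hβ.5 hβ'm
  have hGq₀ : G q₀ = x := by
    rw [hG, Function.comp_apply, hq₀, hβ.3.1 hys, hh.3.1 hx]
  have hT₂mem : T₂ ∈ fullOn T₂ := ⟨⟨j, hjT⟩, subset_rfl⟩
  -- Pieces of the star of `x` on which `α` is affine; the remaining simplices are left whole.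
  have hpieces : ∀ u : Finset V₁, ∃ (n : ℕ) (Ψ : Fin n → Finset ((V₁ →₀ ℝ) →ᵃ[ℝ] ℝ))
      (B : Fin n → ((V₁ →₀ ℝ) →ᵃ[ℝ] (U₁ →₀ ℝ))),
      (∀ y ∈ simplex u, ∃ i, ∀ φ ∈ Ψ i, φ y ≤ 0) ∧ (u ∈ closedStar K₁ x.support →
      ∀ i, ∀ y ∈ simplex u, (∀ φ ∈ Ψ i, φ y ≤ 0) → α y = B i y) := by
    intro u
    by_cases hu : u ∈ closedStar K₁ x.support
    · obtain ⟨n, Ψ, B, h1, h2⟩ := isPL_iff.1 hα.4 u hu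
      exact ⟨n, Ψ, B, h1, fun _ => h2⟩
    · exact ⟨1, fun _ => ∅, fun _ => 0, fun _ _ => ⟨0, by simp⟩, fun h => (hu h).elim⟩
  choose N Ψ B hΨ hB using hpieces
  obtain ⟨n, Φ, A, u, k, hc, huK, hΦ⟩ := (isPL_iff.1 hGPL T₂ hT₂mem).refine
    (fun z hz => hGm (hT₂ ▸ hz)) N Ψ fun u _ => hΨ u
  -- The facet opposite to the vertex `j` contains `q₀`.
  set T₀ := T₂.erase j with hT₀
  have hq₀T₀ : q₀ ∈ simplex T₀ := by
    rw [mem_simplex] at hq₀s ⊢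
    refine ⟨hq₀s.1, hq₀s.2.1, fun v hv => Finset.mem_erase.2 ⟨?_, hq₀s.2.2 hv⟩⟩
    rintro rfl
    exact hj hv
  have hT₀ne : T₀.Nonempty :=
    (support_nonempty_of_mass (mem_simplex.1 hq₀T₀).2.1).mono (mem_simplex.1 hq₀T₀).2.2
  obtain ⟨q₁, hq₁, hq₁Φ⟩ := exists_generic_point hT₀ne (Finset.univ.biUnion Φ)
  have hseg : ∀ᶠ δ : ℝ in 𝓝[>] 0, q₀ + δ • (q₁ - q₀) ∈ simplex T₀ :=
    eventually_le_one.mono fun δ hδ =>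
      (convex_simplex T₀).add_smul_sub_mem hq₀T₀ hq₁ ⟨hδ.1.le, hδ.2⟩
  have hseg' : ∀ᶠ δ : ℝ in 𝓝[>] 0, q₀ + δ • (q₁ - q₀) ∈ realization (fullOn T₂) :=
    hseg.mono fun δ hδ => hT₂ ▸ simplex_mono (Finset.erase_subset _ _) hδ
  have hq₀r : q₀ ∈ realization (fullOn T₂) := hT₂ ▸ hq₀s
  obtain ⟨v₁, hv₁⟩ := hGPL.germ hq₀r hseg'
  rw [hGq₀] at hv₁
  have hv₁s : ∀ᶠ δ : ℝ in 𝓝[>] 0, x + δ • v₁ ∈ realization (closedStar K₁ x.support) := by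
    filter_upwards [hv₁, hseg', eventually_support_eq x v₁] with δ h1 h2 h3
    exact mem_realization_closedStar (h1 ▸ hGm h2) (h3 ▸ Finset.subset_union_left)
  obtain ⟨v₂, hv₂⟩ := hα.4.germ hxs hv₁s
  obtain ⟨v₃, hv₃⟩ := hβ.5.germ hq₀r hseg'
  rw [hq₀, hβ.3.1 hys, ← hq₀] at hv₃
  have hgen : ∀ᶠ δ : ℝ in 𝓝[>] 0, ∀ φ ∈ Finset.univ.biUnion Φ, (∃ z ∈ simplex T₀, φ z ≠ 0) →
      φ (q₀ + δ • (q₁ - q₀)) ≠ 0 := by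
    refine (Finset.eventually_all _).2 fun φ hφ => ?_
    by_cases hne : ∃ z ∈ simplex T₀, φ z ≠ 0
    · simp only [affine_add_smul, smul_eq_mul, linear_sub]
      refine (eventually_add_mul_ne_zero ?_).mono fun _ h _ => h
      by_contra! h0
      rw [h0.1, sub_zero] at h0
      exact hq₁Φ φ hφ hne h0.2
    · exact Eventually.of_forall fun _ h => (hne h).elim
  obtain ⟨q, hq, hqΦ, x', hx', hx'supp, hαsupp, hβsupp⟩ :
      ∃ q ∈ simplex T₀, (∀ φ ∈ Finset.univ.biUnion Φ, (∃ z ∈ simplex T₀, φ z ≠ 0) → φ q ≠ 0) ∧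
      ∃ x', G q = x' ∧ x.support ⊆ x'.support ∧ T₁ ⊆ (α x').support ∧
        (h x).support ⊆ (β' q).support := by
    obtain ⟨δ, ⟨⟨⟨⟨⟨h1, h2⟩, h3⟩, h4⟩, h5⟩, h6⟩, h7⟩ := ((((((hseg.and hgen).and hv₁).and
      hv₂).and hv₃).and (eventually_support_eq x v₁)).and
      ((eventually_support_eq (α x) v₂).and (eventually_support_eq (h x) v₃))).exists
    refine ⟨_, h1, h2, _, h3, ?_, ?_, ?_⟩
    · rw [h6]; exact Finset.subset_union_left
    · rw [h4, h7.1]; exact hαx.trans Finset.subset_union_left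
    · rw [h5, h7.2]; exact Finset.subset_union_left
  clear hgen hv₁ hv₂ hv₃ hv₁s hseg hseg'
  have hqs : q ∈ simplex T₂ := simplex_mono (Finset.erase_subset _ _) hq
  have hqr : q ∈ realization (fullOn T₂) := hT₂ ▸ hqs
  have hqj : q j = 0 := Finsupp.notMem_support_iff.1 fun hjs =>
    Finset.notMem_erase j T₂ ((mem_simplex.1 hq).2.2 hjs)
  have hx'K : x' ∈ realization K₁ := hx' ▸ hGm hqr
  have hx's : x' ∈ realization (closedStar K₁ x.support) :=
    mem_realization_closedStar hx'K hx'supp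
  set y' := β' q with hy'
  have hy's : y' ∈ realization (closedStar K₂ (h x).support) := hβ.2 hqr
  have hhx' : h x' = y' := by
    rw [← hx', hG, Function.comp_apply, hh.3.2 (hβ'm hqr)]
  -- The direction `w` points from `q` into the simplex.
  set w := Finsupp.single j 1 - q with hw
  have hws : ∀ᶠ ε : ℝ in 𝓝[>] 0, q + ε • w ∈ simplex T₂ :=
    eventually_le_one.mono fun ε hε =>
      (convex_simplex T₂).add_smul_sub_mem hqs (single_mem_simplex hjT) ⟨hε.1.le, hε.2⟩
  obtain ⟨i, hi⟩ : ∃ i, ∃ᶠ ε : ℝ in 𝓝[>] 0, ∀ φ ∈ Φ i, φ (q + ε • w) ≤ 0 := by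
    by_contra hcon
    rw [not_exists] at hcon
    have hcon' : ∀ᶠ ε : ℝ in 𝓝[>] 0, ∀ i, ¬ ∀ φ ∈ Φ i, φ (q + ε • w) ≤ 0 :=
      eventually_all.2 fun i => not_frequently.1 (hcon i)
    obtain ⟨ε, h1, h2⟩ := (hcon'.and hws).exists
    obtain ⟨i, hi⟩ := hc _ h2
    exact h1 i hi
  have hφq : ∀ φ ∈ Φ i, φ q ≤ 0 ∧ ∀ᶠ ε : ℝ in 𝓝[>] 0, φ (q + ε • w) ≤ 0 := by
    intro φ hφ
    have := hi.mono fun ε h => h φ hφ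
    simp only [affine_add_smul, smul_eq_mul] at this ⊢
    exact nonpos_of_frequently this
  -- The piece containing `q` and the short segments in direction `w` is a neighborhood of `q`.
  have hnhd : ∀ v : U₂ →₀ ℝ, (∀ᶠ ε : ℝ in 𝓝[>] 0, q + ε • v ∈ simplex T₂) →
      ∀ᶠ ε : ℝ in 𝓝[>] 0, ∀ φ ∈ Φ i, φ (q + ε • v) ≤ 0 := by
    intro v hv
    refine (Finset.eventually_all _).2 fun φ hφ => ?_
    by_cases hne : ∃ z ∈ simplex T₀, φ z ≠ 0
    · have hlt : φ q < 0 := lt_of_le_of_ne (hφq φ hφ).1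
        (hqΦ φ (Finset.mem_biUnion.2 ⟨i, Finset.mem_univ _, hφ⟩) hne)
      simp only [affine_add_smul, smul_eq_mul]
      exact (eventually_add_mul_neg hlt _).mono fun _ h => h.le
    · push Not at hne
      have hφz : ∀ z ∈ simplex T₂, φ z = z j * φ (Finsupp.single j 1) := by
        intro z hz
        rw [affine_apply_eq_sum φ hz, Finset.sum_eq_single_of_mem j hjT, smul_eq_mul]
        intro b hb hbj
        rw [hne _ (single_mem_simplex (Finset.mem_erase.2 ⟨hbj, hb⟩)), smul_zero]
      have hφj : φ (Finsupp.single j 1) ≤ 0 := by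
        obtain ⟨ε, ⟨h1, h2⟩, h3⟩ := (((hφq φ hφ).2.and hws).and eventually_le_one).exists
        rw [hφz _ h2] at h1
        have : (q + ε • w) j = ε := by simp [hw, hqj]
        rw [this] at h1
        exact nonpos_of_mul_nonpos_right h1 h3.1
      filter_upwards [hv] with ε hε
      rw [hφz _ hε]
      exact mul_nonpos_of_nonneg_of_nonpos ((mem_simplex.1 hε).1 j) hφj
  have hui : u i ∈ closedStar K₁ x.support := by
    have h1 := (hΦ i q hqs fun φ hφ => (hφq φ hφ).1).2.1
    rw [hx'] at h1
    exact mem_closedStar_of_subset (huK i) (hx'supp.trans (mem_simplex.1 h1).2.2)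
  set C := (B (u i) (k i)).comp (A i) with hC
  have hαG : ∀ z ∈ simplex T₂, (∀ φ ∈ Φ i, φ z ≤ 0) →
      α (G z) = C z ∧ G z ∈ realization (closedStar K₁ x.support) := by
    intro z hz hzΦ
    obtain ⟨h1, h2, h3⟩ := hΦ i z hz hzΦ
    refine ⟨?_, simplex_subset_realization hui h2⟩
    rw [hB (u i) hui (k i) _ h2 h3, h1]
    rfl
  have hCq : α x' = C q := by
    rw [← hx']; exact (hαG q hqs fun φ hφ => (hφq φ hφ).1).1
  set p := α x' with hp
  have hpr : p ∈ realization (fullOn T₁) := hα.1 hx's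
  set v := C.linear w with hv
  have hpv : ∀ᶠ ε : ℝ in 𝓝[>] 0, p + ε • v ∈ simplex T₁ := by
    filter_upwards [hws, hnhd w hws] with ε h1 h2
    obtain ⟨h3, h4⟩ := hαG _ h1 h2
    rw [affine_add_smul, ← hCq] at h3
    rw [← h3, ← hT₁]
    exact hα.1 h4
  -- The segment in direction `v` can be prolonged backwards since `p` is interior.
  have hpv' : ∀ᶠ ε : ℝ in 𝓝[>] 0, p + ε • (-v) ∈ realization (fullOn T₁) := by
    have hps := mem_simplex.1 (hT₁ ▸ hpr : p ∈ simplex T₁)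
    obtain ⟨ε, ⟨h1, h2⟩, h3⟩ :=
      ((hpv.and (eventually_support_eq p v)).and eventually_le_one).exists
    rw [mem_simplex] at h1
    have hvm : mass v = 0 := by
      have := h1.2.1
      rw [map_add, hps.2.1, map_smul, smul_eq_mul] at this
      exact (mul_eq_zero.1 (by linarith : ε * mass v = 0)).resolve_left h3.1.ne'
    have hvs : v.support ⊆ T₁ := Finset.subset_union_right.trans (h2 ▸ h1.2.2)
    have hpos : ∀ᶠ ε : ℝ in 𝓝[>] 0, ∀ a ∈ T₁, 0 < p a + ε * (-v) a :=
      (Finset.eventually_all _).2 fun a ha => eventually_add_mul_pos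
        (lt_of_le_of_ne (hps.1 a) (Ne.symm (Finsupp.mem_support_iff.1 (hαsupp ha)))) _
    filter_upwards [hpos] with ε hε
    rw [hT₁, mem_simplex]
    have hsub : (p + ε • (-v)).support ⊆ T₁ := Finsupp.support_add.trans
      (Finset.union_subset hps.2.2 (Finsupp.support_smul.trans (by rwa [Finsupp.support_neg])))
    refine ⟨fun a => ?_, by simp [hps.2.1, hvm], hsub⟩
    by_cases ha : a ∈ T₁
    · exact (hε a ha).le
    · rw [Finsupp.notMem_support_iff.1 fun h => ha (hsub h)]
  -- The prolongation is pulled back to a segment at `q` in a direction `w'`.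
  obtain ⟨v₃, hv₃⟩ := hα.5.germ hpr hpv'
  rw [hp, hα.3.1 hx's, ← hp] at hv₃
  have hv₃s : ∀ᶠ ε : ℝ in 𝓝[>] 0, x' + ε • v₃ ∈ realization (closedStar K₁ x.support) := by
    filter_upwards [hv₃, hpv'] with ε h1 h2
    exact h1 ▸ hα.2 h2
  obtain ⟨v₄, hv₄⟩ := hh.4.germ hx'K (hv₃s.mono fun _ h => hle₁ h)
  rw [hhx'] at hv₄
  have hv₄s : ∀ᶠ ε : ℝ in 𝓝[>] 0, y' + ε • v₄ ∈ realization (closedStar K₂ (h x).support) := by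
    filter_upwards [hv₃s, hv₄, eventually_support_eq y' v₄] with ε h1 h2 h3
    exact mem_realization_closedStar (h2 ▸ hh.1 (hle₁ h1))
      (h3 ▸ hβsupp.trans Finset.subset_union_left)
  obtain ⟨w', hw'⟩ := hβ.4.germ hy's hv₄s
  rw [hy', hβ.3.2 hqr, ← hy'] at hw'
  have hw's : ∀ᶠ ε : ℝ in 𝓝[>] 0, q + ε • w' ∈ simplex T₂ := by
    filter_upwards [hw', hv₄s] with ε h1 h2
    rw [← h1, ← hT₂]
    exact hβ.1 h2
  have hlin : C.linear w' = -v := by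
    obtain ⟨ε, ⟨⟨⟨⟨⟨⟨⟨h1, h2⟩, h3⟩, h4⟩, h5⟩, h6⟩, h7⟩, h8⟩, h9⟩ :=
      ((((((((hw's.and (hnhd w' hw's)).and hw').and hv₄).and hv₃).and hv₄s).and hv₃s).and
        hpv').and eventually_le_one).exists
    have hGz : G (q + ε • w') = x' + ε • v₃ := by
      rw [← h3, hG, Function.comp_apply, hβ.3.1 h6, ← h4, hh.3.1 (hle₁ h7)]
    have h10 := (hαG _ h1 h2).1
    rw [hGz, ← h5, hα.3.2 h8, affine_add_smul, ← hCq] at h10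
    exact (smul_right_injective _ h9.1.ne' (add_left_cancel h10)).symm
  -- Since `C` is constant along `w + w'`, injectivity forces `w' = -w`. But `w` leads away from the
  -- facet opposite to `j`, on which `q` lies, so that `-w` leads out of the simplex.
  have hmid : ∀ᶠ ε : ℝ in 𝓝[>] 0, q + ε • ((1 / 2 : ℝ) • (w + w')) ∈ simplex T₂ := by
    filter_upwards [hws, hw's] with ε h1 h2
    have := convex_simplex T₂ h1 h2 (by norm_num : (0 : ℝ) ≤ 1 / 2)
      (by norm_num : (0 : ℝ) ≤ 1 / 2) (by norm_num)
    convert this using 1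
    module
  obtain ⟨ε, ⟨⟨h1, h2⟩, h3⟩, h4⟩ :=
    (((hmid.and (hnhd _ hmid)).and hw's).and eventually_le_one).exists
  obtain ⟨h5, h6⟩ := hαG _ h1 h2
  rw [affine_add_smul, map_smul, map_add, hlin, ← hv, add_neg_cancel, smul_zero, smul_zero,
    add_zero, ← hCq] at h5
  have h7 : G (q + ε • ((1 / 2 : ℝ) • (w + w'))) = G q := by
    rw [hx']
    exact hα.3.1.injOn h6 hx's h5
  have h8 : q + ε • ((1 / 2 : ℝ) • (w + w')) = q := by
    have hinj : Set.InjOn G (realization (fullOn T₂)) :=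
      hh.3.2.injOn.comp hβ.3.2.injOn hβ'm
    exact hinj (hT₂ ▸ h1) hqr h7
  have h9 : w + w' = 0 := by
    have h8' : ε • ((1 / 2 : ℝ) • (w + w')) = 0 := by simpa using h8
    exact (smul_eq_zero.1 ((smul_eq_zero.1 h8').resolve_left h4.1.ne')).resolve_left (by norm_num)
  have h10 := (mem_simplex.1 h3).1 j
  have h11 := DFunLike.congr_fun h9 j
  simp only [Finsupp.add_apply, Finsupp.smul_apply, hw, Finsupp.sub_apply, Finsupp.single_eq_same,
    hqj, Finsupp.coe_zero, Pi.zero_apply, smul_eq_mul] at h10 h11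
  nlinarith [h4.1]

end Local

/-! ### Charts at points whose carrier has a sphere or a disk as its link -/

section Charts

variable {V : Type*} [DecidableEq V]

theorem mem_link {K : PreAbstractSimplicialComplex V} {s t : Finset V} :
    t ∈ link K s ↔ t.Nonempty ∧ t ∪ s ∈ K ∧ Disjoint t s := Iff.rfl

/-- The closed star of a face is the join of the face with its link. -/
theorem isPLHomeo_closedStar {K : PreAbstractSimplicialComplex V} {r : Finset V} (hr : r ∈ K) :
    ∃ g, IsPLHomeo (closedStar K r) (join (fullOn r) (link K r))
      (Finsupp.lmapDomain ℝ ℝ fun v => if v ∈ r then Sum.inl v else Sum.inr v) g := by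
  refine ⟨_, isPLHomeo_of_iso _ (Sum.elim id id) (fun s hs => ?_) (fun t ht => ?_) (fun v _ => ?_)
    fun w hw => ?_⟩
  · have hl : (s.image fun v => if v ∈ r then (Sum.inl v : V ⊕ V) else Sum.inr v).toLeft =
        s ∩ r := by
      ext v
      simp only [Finset.mem_toLeft, Finset.mem_image, Finset.mem_inter]
      constructor
      · rintro ⟨w, hw, h⟩
        split_ifs at h with hwr
        cases h
        exact ⟨hw, hwr⟩
      · rintro ⟨h1, h2⟩
        exact ⟨v, h1, if_pos h2⟩
    have hr' : (s.image fun v => if v ∈ r then (Sum.inl v : V ⊕ V) else Sum.inr v).toRight =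
        s \ r := by
      ext v
      simp only [Finset.mem_toRight, Finset.mem_image, Finset.mem_sdiff]
      constructor
      · rintro ⟨w, hw, h⟩
        split_ifs at h with hwr
        cases h
        exact ⟨hw, hwr⟩
      · rintro ⟨h1, h2⟩
        exact ⟨v, h1, if_neg h2⟩
    rw [mem_join, hl, hr']
    refine ⟨(face_nonempty hs.1).image _, ?_, ?_⟩
    · exact (s ∩ r).eq_empty_or_nonempty.imp id fun h => ⟨h, Finset.inter_subset_right⟩
    · refine (s \ r).eq_empty_or_nonempty.imp id fun h => ⟨h, ?_, Finset.sdiff_disjoint⟩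
      rw [Finset.sdiff_union_self_eq_union]
      exact hs.2
  · rw [mem_join] at ht
    have himg : t.image (Sum.elim id id) = t.toLeft ∪ t.toRight := by
      ext v; simp
    have hL : t.toLeft ⊆ r := by
      rcases ht.2.1 with h | h
      · rw [h]; exact Finset.empty_subset _
      · exact h.2
    have hu : t.image (Sum.elim id id) ∪ r ∈ K := by
      rw [himg]
      rcases ht.2.2 with h | h
      · rw [h, Finset.union_empty, Finset.union_eq_right.2 hL]
        exact hr
      · rw [Finset.union_assoc, Finset.union_eq_right.2
          (hL.trans Finset.subset_union_right)]
        exact h.2.1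
    exact ⟨face_of_subset hu Finset.subset_union_left (ht.1.image _), hu⟩
  · split_ifs <;> rfl
  · rcases w with w | w
    · have : w ∈ r := by
        rcases hw.2.1 with h | h
        · exact absurd (show w ∈ ({Sum.inl w} : Finset (V ⊕ V)).toLeft by simp) (by simp [h])
        · exact h.2 (by simp)
      simp [this]
    · have : w ∉ r := by
        rcases hw.2.2 with h | h
        · exact absurd (show w ∈ ({Sum.inr w} : Finset (V ⊕ V)).toRight by simp) (by simp [h])
        · exact Finset.disjoint_left.1 h.2.2 (by simp)
      simp [this]

theorem lmapDomain_inl_inr {r : Finset V} {x : V →₀ ℝ} (hx : x.support ⊆ r) :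
    Finsupp.lmapDomain ℝ ℝ (fun v => if v ∈ r then (Sum.inl v : V ⊕ V) else Sum.inr v) x =
      inL x :=
  Finsupp.mapDomain_congr fun _ hv => if_pos (hx hv)

theorem joinMap_id_inL {X W W' : Type*} (f : (W →₀ ℝ) → (W' →₀ ℝ)) {x : X →₀ ℝ}
    (hx : ∀ v, 0 ≤ x v) : joinMap id f (inL x) = inL x := by
  have h1 : fstL (inL x : X ⊕ W →₀ ℝ) = x := by ext; simp
  have h2 : sndL (inL x : X ⊕ W →₀ ℝ) = 0 := by ext; simp
  rw [joinMap, h1, h2, homog_zero, homog_id hx, map_zero, add_zero]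

/-- If the link of the carrier of `x` is a sphere, then the star of `x` is a simplex with `x` in its
interior. -/
theorem exists_interior_chart {K : PreAbstractSimplicialComplex V} {x : V →₀ ℝ}
    (hx : x ∈ realization K) {a : ℕ}
    (h : PLHomeomorphic (link K x.support) (simplexBoundary a)) :
    ∃ (T : Finset (V ⊕ Fin (a + 1))) (α : _) (α' : _),
      IsPLHomeo (closedStar K x.support) (fullOn T) α α' ∧ T ⊆ (α x).support := by
  rw [mem_realization] at hx
  obtain ⟨g, hg⟩ := isPLHomeo_closedStar hx.2.2
  obtain ⟨f, f', hf⟩ := h.exists_isPLHomeo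
  have h2 := hg.trans ((IsPLHomeo.refl (fullOn x.support)).join hf)
  rw [join_fullOn_simplexBoundary_eq] at h2
  obtain ⟨b, hb⟩ := support_nonempty_of_mass hx.2.1
  obtain ⟨g', hg'⟩ := isPLHomeo_stellarMap
    (A := Finset.disjSum ∅ (Finset.univ : Finset (Fin (a + 1)))) (B := x.support.disjSum ∅)
    (b := Sum.inl b) (by simpa using hb) ⟨Sum.inr 0, by simp⟩
    (Finset.disjoint_left.2 (by rintro (v | v) <;> simp))
  refine ⟨_, _, _, h2.trans hg', fun v hv => ?_⟩
  rw [Function.comp_apply, Function.comp_apply, lmapDomain_inl_inr subset_rfl,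
    joinMap_id_inL _ hx.1, Finsupp.mem_support_iff, stellarMap_apply]
  have hxb := Finsupp.mem_support_iff.1 hb
  rcases v with v | v
  · simp only [Finset.mem_union, Finset.mem_erase, Finset.inl_mem_disjSum, Finset.notMem_empty,
      false_or] at hv
    have hvb : v ≠ b := fun h => hv.1 (h ▸ rfl)
    simpa [hvb] using hv.2
  · have : ((a : ℝ) + 1) ≠ 0 := by positivity
    simp [hxb, this]

/-- If the link of the carrier of `x` is a disk, then the star of `x` is a simplex with `x` on its
boundary. -/
theorem exists_boundary_chart {K : PreAbstractSimplicialComplex V} {x : V →₀ ℝ}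
    (hx : x ∈ realization K) {b : ℕ}
    (h : PLHomeomorphic (link K x.support) (fullSimplex b)) :
    ∃ (T : Finset (V ⊕ Fin (b + 1))) (β : _) (β' : _),
      IsPLHomeo (closedStar K x.support) (fullOn T) β β' ∧ ¬ T ⊆ (β x).support := by
  rw [mem_realization] at hx
  obtain ⟨g, hg⟩ := isPLHomeo_closedStar hx.2.2
  obtain ⟨f, f', hf⟩ := h.exists_isPLHomeo
  have h2 := hg.trans ((IsPLHomeo.refl (fullOn x.support)).join hf)
  have heq : join (fullOn x.support) (fullSimplex b) =
      fullOn (x.support.disjSum Finset.univ) := complex_ext fun s => by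
    have h : s.toLeft = ∅ ∨ s.toLeft ∈ fullOn x.support ↔ s.toLeft ⊆ x.support := by
      rw [mem_fullOn]
      rcases s.toLeft.eq_empty_or_nonempty with h | h
      · simp [h]
      · simp [h, h.ne_empty]
    rw [mem_join, h, mem_fullSimplex, mem_fullOn, Finset.subset_disjSum]
    simp [s.toRight.eq_empty_or_nonempty]
  rw [heq] at h2
  refine ⟨_, _, _, h2, fun hsub => ?_⟩
  have : (Sum.inr 0 : V ⊕ Fin (b + 1)) ∈ x.support.disjSum Finset.univ := by simp
  have := hsub this
  rw [Function.comp_apply, lmapDomain_inl_inr subset_rfl, joinMap_id_inL _ hx.1] at this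
  simp at this

theorem support_barycenter (t : Finset V) : (barycenter t).support = t := by
  ext v
  rw [Finsupp.mem_support_iff, barycenter_apply]
  constructor
  · intro h
    by_contra hv
    exact h (if_neg hv)
  · intro hv
    have : (0 : ℝ) < t.card := by exact_mod_cast Finset.card_pos.2 ⟨v, hv⟩
    rw [if_pos hv]
    positivity

theorem barycenter_mem_realization {X : Type*} {K : PreAbstractSimplicialComplex X} {t : Finset X}
    (ht : t ∈ K) : barycenter t ∈ realization K :=
  simplex_subset_realization ht (barycenter_mem_simplex (face_nonempty ht))

/-- The link of a face is not both a sphere and a disk. -/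
theorem not_sphere_and_disk {K : PreAbstractSimplicialComplex V} {t : Finset V} (ht : t ∈ K)
    {a b : ℕ} (ha : PLHomeomorphic (link K t) (simplexBoundary a))
    (hb : PLHomeomorphic (link K t) (fullSimplex b)) : False := by
  have hx := barycenter_mem_realization ht
  rw [← support_barycenter t] at ha hb
  obtain ⟨T₁, α, α', hα, hαx⟩ := exists_interior_chart hx ha
  obtain ⟨T₂, β, β', hβ, hβx⟩ := exists_boundary_chart hx hb
  exact not_interior_to_boundary (IsPLHomeo.refl K) hx hα hαx hβ hβx

theorem isPLHomeo_closedStar_fullSimplex (m : ℕ) (r : Finset (Fin (m + 1))) :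
    IsPLHomeo (closedStar (fullSimplex m) r) (fullOn Finset.univ) id id := by
  have : closedStar (fullSimplex m) r = fullOn Finset.univ := complex_ext fun s =>
    ⟨fun hs => ⟨hs.1, Finset.subset_univ _⟩, fun hs => ⟨hs.1, hs.1.mono Finset.subset_union_left⟩⟩
  rw [this]
  exact IsPLHomeo.refl _

/-- Under a homeomorphism with a simplex, points whose carrier has a sphere as its link are interior
points. -/
theorem support_eq_univ_of_sphere {L : PreAbstractSimplicialComplex V} {m : ℕ} {h h'}
    (hh : IsPLHomeo L (fullSimplex m) h h') {x : V →₀ ℝ} (hx : x ∈ realization L) {a : ℕ}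
    (ha : PLHomeomorphic (link L x.support) (simplexBoundary a)) :
    Finset.univ ⊆ (h x).support := by
  by_contra hcon
  obtain ⟨T₁, α, α', hα, hαx⟩ := exists_interior_chart hx ha
  exact not_interior_to_boundary hh hx hα hαx (isPLHomeo_closedStar_fullSimplex m _) hcon

/-- Under a homeomorphism with a simplex, points whose carrier has a disk as its link are boundary
points. -/
theorem support_ne_univ_of_disk {L : PreAbstractSimplicialComplex V} {m : ℕ} {h h'}
    (hh : IsPLHomeo L (fullSimplex m) h h') {x : V →₀ ℝ} (hx : x ∈ realization L) {b : ℕ}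
    (hb : PLHomeomorphic (link L x.support) (fullSimplex b)) :
    ¬ Finset.univ ⊆ (h x).support := by
  intro hcon
  obtain ⟨T₂, β, β', hβ, hβx⟩ := exists_boundary_chart hx hb
  have hback : h' (h x) = x := hh.3.1 hx
  refine not_interior_to_boundary hh.symm (hh.1 hx) (isPLHomeo_closedStar_fullSimplex m _) hcon
    (β := β) (β' := β') (T₂ := T₂) ?_ ?_
  · rwa [hback]
  · rwa [hback]

end Charts

/-! ### Combinatorial manifolds through the links of all faces -/

section Manifolds

variable {V : Type*} [DecidableEq V]

/-- The link of the face `t` is a sphere of the dimension `d - |t|` that is complementary to `t` in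
dimension `d`. -/
def LinkSphere (K : PreAbstractSimplicialComplex V) (d : ℕ) (t : Finset V) : Prop :=
  PLHomeomorphic (link K t) (simplexBoundary (d + 1 - t.card))

/-- The link of the face `t` is a disk of the dimension `d - |t|` that is complementary to `t` in
dimension `d`. -/
def LinkDisk (K : PreAbstractSimplicialComplex V) (d : ℕ) (t : Finset V) : Prop :=
  t.card ≤ d ∧ PLHomeomorphic (link K t) (fullSimplex (d - t.card))

theorem not_linkDisk_of_linkSphere {K : PreAbstractSimplicialComplex V} {d : ℕ} {t : Finset V}
    (ht : t ∈ K) (h : LinkSphere K d t) : ¬ LinkDisk K d t :=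
  fun h' => not_sphere_and_disk ht h h'.2

theorem link_link {K : PreAbstractSimplicialComplex V} {s t : Finset V} (ht : t ∈ link K s) :
    link (link K s) t = link K (t ∪ s) := complex_ext fun u => by
  have hts : Disjoint t s := ht.2.2
  simp only [mem_link, Finset.disjoint_union_left, Finset.disjoint_union_right,
    Finset.union_assoc]
  constructor
  · rintro ⟨h1, ⟨_, h2, h3, _⟩, h4⟩
    exact ⟨h1, h2, h4, h3⟩
  · rintro ⟨h1, h2, h4, h3⟩
    exact ⟨h1, ⟨h1.mono Finset.subset_union_left, h2, h3, hts⟩, h4⟩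

theorem card_union_of_mem_link {K : PreAbstractSimplicialComplex V} {s t : Finset V}
    (ht : t ∈ link K s) : (t ∪ s).card = t.card + s.card :=
  Finset.card_union_of_disjoint ht.2.2

theorem linkSphere_link {K : PreAbstractSimplicialComplex V} {d e : ℕ} {s t : Finset V}
    (ht : t ∈ link K s) (hd : d = e + s.card) :
    LinkSphere (link K s) e t ↔ LinkSphere K d (t ∪ s) := by
  rw [LinkSphere, LinkSphere, link_link ht, card_union_of_mem_link ht,
    show e + 1 - t.card = d + 1 - (t.card + s.card) by omega]

theorem linkDisk_link {K : PreAbstractSimplicialComplex V} {d e : ℕ} {s t : Finset V}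
    (ht : t ∈ link K s) (hd : d = e + s.card) :
    LinkDisk (link K s) e t ↔ LinkDisk K d (t ∪ s) := by
  rw [LinkDisk, LinkDisk, link_link ht, card_union_of_mem_link ht,
    show e - t.card = d - (t.card + s.card) by omega,
    show t.card ≤ e ↔ t.card + s.card ≤ d by omega]

/-- A face containing `v` is `{v}` or the join of `v` with a face of the link of `v`. -/
theorem eq_singleton_or_mem_link {K : PreAbstractSimplicialComplex V} {t : Finset V} (ht : t ∈ K)
    {v : V} (hv : v ∈ t) : t = {v} ∨ t.erase v ∈ link K {v} ∧ t.erase v ∪ {v} = t := by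
  have h : t.erase v ∪ {v} = t := by
    rw [Finset.union_comm, ← Finset.insert_eq, Finset.insert_erase hv]
  rcases (t.erase v).eq_empty_or_nonempty with h0 | h0
  · left
    rw [h0, Finset.empty_union] at h
    exact h.symm
  · right
    refine ⟨⟨h0, by rwa [h], ?_⟩, h⟩
    rw [Finset.disjoint_singleton_right]
    exact Finset.notMem_erase v t

theorem simplexBoundary_zero : simplexBoundary 0 = ⊥ := complex_ext fun s => by
  constructor
  · rintro ⟨⟨i, hi⟩, h2⟩
    exact h2 (Finset.eq_univ_of_forall fun j => by rwa [show j = i from Fin.ext (by omega)])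
  · exact fun h => False.elim h

theorem plHomeomorphic_simplexBoundary_zero {X : Type*} {K : PreAbstractSimplicialComplex X} :
    PLHomeomorphic K (simplexBoundary 0) ↔ K = ⊥ := by
  rw [simplexBoundary_zero]
  constructor
  · rintro ⟨f, _, hf, _⟩
    rw [realization_bot] at hf
    refine complex_ext fun s => ⟨fun hs => ?_, fun hs => False.elim hs⟩
    obtain ⟨x, hx⟩ := realization_nonempty hs
    exact (hf hx).elim
  · rintro rfl
    refine ⟨fun _ => 0, fun _ => 0, ?_, ?_, ⟨?_, ?_⟩, fun s hs => False.elim hs,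
      fun s hs => False.elim hs⟩ <;>
    · rw [realization_bot]
      intro x hx
      exact hx.elim

/-- A complex is a closed combinatorial `d`-manifold if and only if the link of every face, of any
dimension, is a sphere of the complementary dimension. -/
theorem isClosedCombinatorialManifold_iff {d : ℕ} {K : PreAbstractSimplicialComplex V} :
    IsClosedCombinatorialManifold d K ↔ ∀ t ∈ K, t.card ≤ d + 1 ∧ LinkSphere K d t := by
  induction d generalizing K with
  | zero =>
    constructor
    · intro h t ht
      obtain ⟨v, hv⟩ := face_nonempty ht
      have hvK : {v} ∈ K := face_of_subset ht (by simpa using hv) (by simp)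
      rcases eq_singleton_or_mem_link ht hv with rfl | ⟨h1, _⟩
      · exact ⟨by simp, plHomeomorphic_simplexBoundary_zero.2 (h v hvK)⟩
      · rw [h v hvK] at h1
        exact False.elim h1
    · intro h v hv
      exact plHomeomorphic_simplexBoundary_zero.1 (h _ hv).2
  | succ d ih =>
    constructor
    · intro h t ht
      obtain ⟨v, hv⟩ := face_nonempty ht
      obtain ⟨h1, h2⟩ := h v (face_of_subset ht (by simpa using hv) (by simp))
      rcases eq_singleton_or_mem_link ht hv with rfl | ⟨h3, h4⟩
      · exact ⟨by simp, h2⟩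
      · obtain ⟨h5, h6⟩ := ih.1 h1 _ h3
        rw [linkSphere_link h3 (d := d + 1) (by simp), h4] at h6
        have := card_union_of_mem_link h3
        rw [h4, Finset.card_singleton] at this
        exact ⟨by omega, h6⟩
    · intro h v hv
      refine ⟨ih.2 fun t ht => ?_, (h _ hv).2⟩
      obtain ⟨h1, h2⟩ := h _ ht.2.1
      rw [card_union_of_mem_link ht, Finset.card_singleton] at h1
      exact ⟨by omega, (linkSphere_link ht (by simp)).2 h2⟩

/-- A complex is a combinatorial `d`-manifold if and only if the link of every face is a sphere or a
disk of the complementary dimension, and the faces whose link is a sphere are closed under passing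
to larger faces. The second condition holds since the link of a vertex whose link is a sphere is
required to be a manifold without boundary. -/
theorem isCombinatorialManifold_iff {d : ℕ} {K : PreAbstractSimplicialComplex V} :
    IsCombinatorialManifold d K ↔
      (∀ t ∈ K, t.card ≤ d + 1 ∧ (LinkSphere K d t ∨ LinkDisk K d t)) ∧
      ∀ s ∈ K, ∀ t ∈ K, s ⊆ t → LinkSphere K d s → LinkSphere K d t := by
  induction d generalizing K with
  | zero =>
    have h0 : IsCombinatorialManifold 0 K ↔ IsClosedCombinatorialManifold 0 K := Iff.rfl
    rw [h0, isClosedCombinatorialManifold_iff]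
    constructor
    · intro h
      exact ⟨fun t ht => ⟨(h t ht).1, Or.inl (h t ht).2⟩, fun _ _ t ht _ _ => (h t ht).2⟩
    · rintro ⟨h, _⟩ t ht
      refine ⟨(h t ht).1, (h t ht).2.resolve_right fun h' => ?_⟩
      have := (face_nonempty ht).card_pos
      exact absurd h'.1 (by omega)
  | succ d ih =>
    constructor
    · intro h
      -- If the link of `v` is a closed manifold, all faces containing `v` have spherical links.
      have hclosed : ∀ v, IsClosedCombinatorialManifold d (link K {v}) →
          PLHomeomorphic (link K {v}) (simplexBoundary (d + 1)) →
          ∀ t ∈ K, v ∈ t → t.card ≤ d + 1 + 1 ∧ LinkSphere K (d + 1) t := by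
        intro v h1 h2 t ht hv
        rcases eq_singleton_or_mem_link ht hv with rfl | ⟨h3, h4⟩
        · exact ⟨by simp, h2⟩
        · obtain ⟨h5, h6⟩ := isClosedCombinatorialManifold_iff.1 h1 _ h3
          rw [linkSphere_link h3 (d := d + 1) (by simp), h4] at h6
          have := card_union_of_mem_link h3
          rw [h4, Finset.card_singleton] at this
          exact ⟨by omega, h6⟩
      refine ⟨fun t ht => ?_, fun s hs t ht hst hsph => ?_⟩
      · obtain ⟨v, hv⟩ := face_nonempty ht
        rcases h v (face_of_subset ht (by simpa using hv) (by simp)) with ⟨h1, h2⟩ | ⟨h1, h2⟩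
        · exact ⟨(hclosed v h1 h2 t ht hv).1, Or.inl (hclosed v h1 h2 t ht hv).2⟩
        · rcases eq_singleton_or_mem_link ht hv with rfl | ⟨h3, h4⟩
          · exact ⟨by simp, Or.inr ⟨by simp, h2⟩⟩
          · obtain ⟨h5, h6⟩ := (ih.1 h1).1 _ h3
            rw [linkSphere_link h3 (d := d + 1) (by simp),
              linkDisk_link h3 (d := d + 1) (by simp), h4] at h6
            have := card_union_of_mem_link h3
            rw [h4, Finset.card_singleton] at this
            exact ⟨by omega, h6⟩
      · obtain ⟨v, hv⟩ := face_nonempty hs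
        rcases h v (face_of_subset hs (by simpa using hv) (by simp)) with ⟨h1, h2⟩ | ⟨h1, h2⟩
        · exact (hclosed v h1 h2 t ht (hst hv)).2
        · rcases eq_singleton_or_mem_link hs hv with rfl | ⟨h3, h4⟩
          · exact (not_sphere_and_disk hs hsph h2).elim
          · rcases eq_singleton_or_mem_link ht (hst hv) with rfl | ⟨h5, h6⟩
            · rwa [(Finset.Nonempty.subset_singleton_iff (face_nonempty hs)).1 hst] at hsph
            · rw [← h6, ← linkSphere_link h5 (e := d) (by simp)]
              refine (ih.1 h1).2 _ h3 _ h5 (Finset.erase_subset_erase v hst) ?_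
              rw [linkSphere_link h3 (d := d + 1) (by simp), h4]
              exact hsph
    · rintro ⟨h, hup⟩ v hv
      have hcard : ∀ t ∈ link K {v}, t.card ≤ d + 1 := fun t ht => by
        have := (h _ ht.2.1).1
        rw [card_union_of_mem_link ht, Finset.card_singleton] at this
        omega
      rcases (h _ hv).2 with hs | hd
      · refine Or.inl ⟨isClosedCombinatorialManifold_iff.2 fun t ht => ⟨hcard t ht, ?_⟩, hs⟩
        rw [linkSphere_link ht (d := d + 1) (by simp)]
        exact hup _ hv _ ht.2.1 Finset.subset_union_right hs
      · refine Or.inr ⟨ih.2 ⟨fun t ht => ⟨hcard t ht, ?_⟩, fun s hs t ht hst => ?_⟩, hd.2⟩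
        · rw [linkSphere_link ht (d := d + 1) (by simp), linkDisk_link ht (d := d + 1) (by simp)]
          exact (h _ ht.2.1).2
        · rw [linkSphere_link ht (d := d + 1) (by simp), linkSphere_link hs (d := d + 1) (by simp)]
          exact hup _ hs.2.1 _ ht.2.1 (Finset.union_subset_union_left hst)

theorem isCombinatorialManifold_link {d : ℕ} {K : PreAbstractSimplicialComplex V}
    (hK : IsCombinatorialManifold d K) {s : Finset V} (hs : s.card ≤ d) :
    IsCombinatorialManifold (d - s.card) (link K s) := by
  rw [isCombinatorialManifold_iff] at hK ⊢
  refine ⟨fun t ht => ⟨?_, ?_⟩, fun t ht u hu htu => ?_⟩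
  · have := (hK.1 _ ht.2.1).1
    rw [card_union_of_mem_link ht] at this
    omega
  · rw [linkSphere_link ht (d := d) (by omega), linkDisk_link ht (d := d) (by omega)]
    exact (hK.1 _ ht.2.1).2
  · rw [linkSphere_link ht (d := d) (by omega), linkSphere_link hu (d := d) (by omega)]
    exact hK.2 _ ht.2.1 _ hu.2.1 (Finset.union_subset_union_left htu)

/-- The boundary of a combinatorial manifold consists of the faces whose link is a disk. -/
theorem mem_boundary_iff {d : ℕ} {K : PreAbstractSimplicialComplex V}
    (hK : IsCombinatorialManifold d K) {s : Finset V} :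
    s ∈ boundary K ↔ s ∈ K ∧ LinkDisk K d s := by
  have hK' := isCombinatorialManifold_iff.1 hK
  constructor
  · rintro ⟨hs, t, ht, hst, n, hn⟩
    have hsK := face_of_subset ht hst hs
    refine ⟨hsK, (hK'.1 s hsK).2.resolve_left fun h => ?_⟩
    exact not_sphere_and_disk ht (hK'.2 s hsK t ht hst h) hn.2
  · rintro ⟨hs, hd⟩
    exact ⟨face_nonempty hs, s, hs, subset_rfl, _, isCombinatorialManifold_link hK hd.1, hd.2⟩

/-- The boundary of a combinatorial manifold is a combinatorial manifold without boundary: a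
homeomorphism between the disk `link K t` and a simplex identifies `link (boundary K) t` with the
boundary of the simplex. -/
theorem isClosedCombinatorialManifold_boundary {n : ℕ} {K : PreAbstractSimplicialComplex V}
    (hK : IsCombinatorialManifold (n + 1) K) : IsClosedCombinatorialManifold n (boundary K) := by
  have hK' := isCombinatorialManifold_iff.1 hK
  rw [isClosedCombinatorialManifold_iff]
  intro t ht
  obtain ⟨htK, htc, htd⟩ := (mem_boundary_iff hK).1 ht
  refine ⟨htc, ?_⟩
  obtain ⟨h, h', hh⟩ := htd.exists_isPLHomeo
  refine (hh.restrict (K₀ := link (boundary K) t) (L₀ := simplexBoundary (n + 1 - t.card))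
    (fun u hu => ⟨hu.1, ((mem_boundary_iff hK).1 hu.2.1).1, hu.2.2⟩) (fun u hu => hu.1)
    fun x hx => ?_).plHomeomorphic
  have hhx := hh.1 hx
  have hx' := mem_realization.1 hx
  rw [mem_realization] at hhx
  rw [mem_realization, mem_realization, mem_simplexBoundary]
  simp only [hx'.1, hx'.2.1, hhx.1, hhx.2.1, implies_true, true_and]
  have hlink := link_link hx'.2.2
  have h1 : x.support ∈ link (boundary K) t ↔ LinkDisk K (n + 1) (x.support ∪ t) := by
    rw [mem_link, mem_boundary_iff hK]
    exact ⟨fun h => h.2.1.2, fun h => ⟨hx'.2.2.1, ⟨hx'.2.2.2.1, h⟩, hx'.2.2.2.2⟩⟩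
  rw [h1, Ne, ← Finset.univ_subset_iff]
  constructor
  · intro hd
    refine ⟨hhx.2.2, support_ne_univ_of_disk hh hx ?_ (b := n + 1 - (x.support ∪ t).card)⟩
    rw [hlink]
    exact hd.2
  · rintro ⟨_, hne⟩
    refine (hK'.1 _ hx'.2.2.2.1).2.resolve_left fun hs => hne ?_
    refine support_eq_univ_of_sphere hh hx ?_ (a := n + 1 + 1 - (x.support ∪ t).card)
    rw [hlink]
    exact hs

end Manifolds

/-! ### Sums of indicator functions of chains -/

section Levels

variable {V : Type*}

/-- The members of `S` are pairwise comparable. -/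
def IsFinsetChain (S : Finset (Finset V)) : Prop := ∀ s ∈ S, ∀ t ∈ S, s ⊆ t ∨ t ⊆ s

theorem IsFinsetChain.mono {S T : Finset (Finset V)} (hT : IsFinsetChain T) (h : S ⊆ T) :
    IsFinsetChain S :=
  fun s hs t ht => hT s (h hs) t (h ht)

theorem IsFinsetChain.exists_top {S : Finset (Finset V)} (hS : IsFinsetChain S)
    (hne : S.Nonempty) : ∃ t ∈ S, ∀ s ∈ S, s ⊆ t := by
  obtain ⟨t, ht, hmax⟩ := Finset.exists_max_image S Finset.card hne
  refine ⟨t, ht, fun s hs => (hS s hs t ht).elim id fun h => ?_⟩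
  exact (Finset.eq_of_subset_of_card_le h (hmax s hs)).superset

theorem IsFinsetChain.exists_bot {S : Finset (Finset V)} (hS : IsFinsetChain S)
    (hne : S.Nonempty) : ∃ t ∈ S, ∀ s ∈ S, t ⊆ s := by
  obtain ⟨t, ht, hmin⟩ := Finset.exists_min_image S Finset.card hne
  refine ⟨t, ht, fun s hs => (hS t ht s hs).elim id fun h => ?_⟩
  exact (Finset.eq_of_subset_of_card_le h (hmin s hs)).superset

/-- If no member of a chain contains `B`, then neither does their union. -/
theorem IsFinsetChain.exists_notMem {S : Finset (Finset V)} (hS : IsFinsetChain S) {B : Finset V}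
    (hB : B.Nonempty) (h : ∀ s ∈ S, ¬ B ⊆ s) : ∃ v ∈ B, ∀ s ∈ S, v ∉ s := by
  rcases S.eq_empty_or_nonempty with rfl | hne
  · obtain ⟨v, hv⟩ := hB
    exact ⟨v, hv, by simp⟩
  · obtain ⟨t, ht, hmax⟩ := hS.exists_top hne
    obtain ⟨v, hv, hvt⟩ := Finset.not_subset.1 (h t ht)
    exact ⟨v, hv, fun s hs hvs => hvt (hmax s hs hvs)⟩

/-- The total weight of the sets with the property `P`. -/
noncomputable def weight (μ : Finset V →₀ ℝ) (P : Finset V → Prop) [DecidablePred P] : ℝ :=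
  ∑ s ∈ μ.support with P s, μ s

theorem weight_nonneg {μ : Finset V →₀ ℝ} (hμ : ∀ s, 0 ≤ μ s) (P : Finset V → Prop)
    [DecidablePred P] : 0 ≤ weight μ P :=
  Finset.sum_nonneg fun s _ => hμ s

theorem weight_mono {μ : Finset V →₀ ℝ} (hμ : ∀ s, 0 ≤ μ s) {P Q : Finset V → Prop}
    [DecidablePred P] [DecidablePred Q] (h : ∀ s ∈ μ.support, P s → Q s) :
    weight μ P ≤ weight μ Q := by
  refine Finset.sum_le_sum_of_subset_of_nonneg (fun s hs => ?_) fun s _ _ => hμ s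
  rw [Finset.mem_filter] at hs ⊢
  exact ⟨hs.1, h s hs.1 hs.2⟩

theorem weight_congr {μ : Finset V →₀ ℝ} {P Q : Finset V → Prop}
    [DecidablePred P] [DecidablePred Q] (h : ∀ s ∈ μ.support, P s ↔ Q s) :
    weight μ P = weight μ Q := by
  rw [weight, weight, Finset.filter_congr h]

theorem le_weight {μ : Finset V →₀ ℝ} (hμ : ∀ s, 0 ≤ μ s) {P : Finset V → Prop}
    [DecidablePred P] {s : Finset V} (hP : P s) : μ s ≤ weight μ P := by
  by_cases hs : s ∈ μ.support
  · exact Finset.single_le_sum (f := fun s => μ s) (fun s _ => hμ s)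
      (Finset.mem_filter.2 ⟨hs, hP⟩)
  · rw [Finsupp.notMem_support_iff.1 hs]
    exact weight_nonneg hμ P

theorem weight_eq_mass {μ : Finset V →₀ ℝ} {P : Finset V → Prop} [DecidablePred P]
    (h : ∀ s ∈ μ.support, P s) : weight μ P = mass μ := by
  rw [weight, Finset.filter_true_of_mem h, mass_eq_sum_of_support_subset subset_rfl]

theorem weight_le_mass {μ : Finset V →₀ ℝ} (hμ : ∀ s, 0 ≤ μ s) (P : Finset V → Prop)
    [DecidablePred P] : weight μ P ≤ mass μ := by
  rw [← weight_eq_mass (P := fun _ => True) fun _ _ => trivial]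
  exact weight_mono hμ fun _ _ _ => trivial

theorem weight_eq_sum_of_support_subset {μ : Finset V →₀ ℝ} {S : Finset (Finset V)}
    (h : μ.support ⊆ S) (P : Finset V → Prop) [DecidablePred P] :
    weight μ P = ∑ s ∈ S, if P s then μ s else 0 := by
  rw [weight, Finset.sum_filter]
  refine Finset.sum_subset h fun s _ hs => ?_
  rw [Finsupp.notMem_support_iff.1 hs, ite_self]

variable [DecidableEq V]

/-- The sum of the indicator functions of finite sets, with multiplicities. -/
noncomputable def levelSum : (Finset V →₀ ℝ) →ₗ[ℝ] (V →₀ ℝ) :=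
  Finsupp.linearCombination ℝ fun s => ∑ v ∈ s, Finsupp.single v 1

theorem sum_single_apply (s : Finset V) (v : V) :
    (∑ w ∈ s, Finsupp.single w (1 : ℝ)) v = if v ∈ s then 1 else 0 := by
  rw [Finsupp.finsetSum_apply]
  simp only [Finsupp.single_apply]
  rw [Finset.sum_ite_eq' s v]

theorem levelSum_apply (μ : Finset V →₀ ℝ) (v : V) : levelSum μ v = weight μ (v ∈ ·) := by
  rw [levelSum, Finsupp.linearCombination_apply, Finsupp.sum, Finsupp.finsetSum_apply, weight,
    Finset.sum_filter]
  refine Finset.sum_congr rfl fun s _ => ?_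
  rw [Finsupp.smul_apply, sum_single_apply]
  split_ifs <;> simp

end Levels

section Levels

variable {V : Type*}

/-- A set of points that contains with every point all those at which `x` is at least as large. -/
def IsSuperlevel (x : V →₀ ℝ) (s : Finset V) : Prop := ∀ v ∈ s, ∀ w, x v ≤ x w → w ∈ s

theorem IsSuperlevel.subset_or_subset {x : V →₀ ℝ} {s t : Finset V} (hs : IsSuperlevel x s)
    (ht : IsSuperlevel x t) : s ⊆ t ∨ t ⊆ s := by
  by_contra! h
  obtain ⟨v, hv, hvt⟩ := Finset.not_subset.1 h.1
  obtain ⟨w, hw, hws⟩ := Finset.not_subset.1 h.2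
  rcases le_total (x v) (x w) with hvw | hvw
  · exact hws (hs v hv w hvw)
  · exact hvt (ht w hw v hvw)

variable [DecidableEq V]

/-- Every nonnegative function is a sum of indicator functions of its superlevel sets. -/
theorem exists_levelSum_eq (x : V →₀ ℝ) (hx : ∀ v, 0 ≤ x v) :
    ∃ μ : Finset V →₀ ℝ, (∀ s, 0 ≤ μ s) ∧
      (∀ s ∈ μ.support, s.Nonempty ∧ s ⊆ x.support ∧ IsSuperlevel x s) ∧ levelSum μ = x := by
  induction hn : x.support.card using Nat.strong_induction_on generalizing x with
  | _ n ih =>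
    subst hn
    rcases x.support.eq_empty_or_nonempty with h0 | hne
    · rw [Finsupp.support_eq_empty] at h0
      subst h0
      exact ⟨0, fun _ => le_rfl, by simp, by simp⟩
    · obtain ⟨a, ha, hmin⟩ := Finset.exists_min_image x.support x hne
      have hpos : ∀ v ∈ x.support, 0 < x v := fun v hv =>
        lt_of_le_of_ne (hx v) (Ne.symm (Finsupp.mem_support_iff.1 hv))
      set x' : V →₀ ℝ := x - x a • ∑ v ∈ x.support, Finsupp.single v 1 with hx'
      have hin : ∀ v ∈ x.support, x' v = x v - x a := fun v hv => by
        rw [hx', Finsupp.sub_apply, Finsupp.smul_apply, sum_single_apply, if_pos hv, smul_eq_mul,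
          mul_one]
      have hout : ∀ v, v ∉ x.support → x' v = 0 := fun v hv => by
        rw [hx', Finsupp.sub_apply, Finsupp.smul_apply, sum_single_apply, if_neg hv, smul_zero,
          sub_zero, Finsupp.notMem_support_iff.1 hv]
      have hsub : x'.support ⊆ x.support := fun v hv => by
        by_contra hvx
        exact Finsupp.mem_support_iff.1 hv (hout v hvx)
      have hlt : x'.support.card < x.support.card := by
        refine Finset.card_lt_card (Finset.ssubset_iff_subset_ne.2 ⟨hsub, fun h => ?_⟩)
        have := Finsupp.mem_support_iff.1 (h ▸ ha)
        rw [hin a ha, sub_self] at this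
        exact this rfl
      have hx'0 : ∀ v, 0 ≤ x' v := fun v => by
        by_cases hv : v ∈ x.support
        · rw [hin v hv]; linarith [hmin v hv]
        · rw [hout v hv]
      obtain ⟨μ, hμ0, hμ, hμx⟩ := ih _ hlt x' hx'0 rfl
      refine ⟨μ + Finsupp.single x.support (x a), fun s => ?_, fun s hs => ?_, ?_⟩
      · rw [Finsupp.add_apply, Finsupp.single_apply]
        have := hμ0 s
        have := hx a
        split_ifs <;> linarith
      · rcases Finset.mem_union.1 (Finsupp.support_add hs) with hs | hs
        · obtain ⟨h1, h2, h3⟩ := hμ s hs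
          refine ⟨h1, h2.trans hsub, fun v hv w hvw => h3 v hv w ?_⟩
          have hvx := hsub (h2 hv)
          have hwx : w ∈ x.support :=
            Finsupp.mem_support_iff.2 (lt_of_lt_of_le (hpos v hvx) hvw).ne'
          rw [hin v hvx, hin w hwx]
          linarith
        · rw [Finset.mem_singleton.1 (Finsupp.support_single_subset hs)]
          exact ⟨hne, subset_rfl, fun v hv w hvw =>
            Finsupp.mem_support_iff.2 (lt_of_lt_of_le (hpos v hv) hvw).ne'⟩
      · rw [map_add, hμx, levelSum, Finsupp.linearCombination_single, hx', sub_add_cancel]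

theorem isSuperlevel_levelSum {μ : Finset V →₀ ℝ} (hμ : ∀ s, 0 ≤ μ s)
    (hc : IsFinsetChain μ.support) {s : Finset V} (hs : s ∈ μ.support) :
    IsSuperlevel (levelSum μ) s := by
  intro v hv w hvw
  by_contra hw
  rw [levelSum_apply, levelSum_apply] at hvw
  have hle : weight μ (fun t => w ∈ t) + μ s ≤ weight μ (fun t => v ∈ t) := by
    rw [weight, weight, add_comm, ← Finset.sum_insert (s := {t ∈ μ.support | w ∈ t}) (a := s)
      (f := fun s => μ s) (by simp [hw])]
    refine Finset.sum_le_sum_of_subset_of_nonneg (fun t ht => ?_) fun t _ _ => hμ t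
    rcases Finset.mem_insert.1 ht with rfl | ht
    · exact Finset.mem_filter.2 ⟨hs, hv⟩
    · rw [Finset.mem_filter] at ht ⊢
      refine ⟨ht.1, (hc s hs t ht.1).elim (fun h => h hv) fun h => (hw (h ht.2)).elim⟩
  have := lt_of_le_of_ne (hμ s) (Ne.symm (Finsupp.mem_support_iff.1 hs))
  linarith

/-- The indicator functions of the members of a chain of nonempty sets are linearly independent. -/
theorem eq_zero_of_levelSum_eq_zero {μ : Finset V →₀ ℝ} (hc : IsFinsetChain μ.support)
    (hne : ∀ s ∈ μ.support, s.Nonempty) (h : levelSum μ = 0) : μ = 0 := by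
  by_contra h0
  obtain ⟨t, ht, hmax⟩ := hc.exists_top (Finsupp.support_nonempty_iff.2 h0)
  obtain ⟨v, hv, hvS⟩ := (hc.mono (Finset.erase_subset t _)).exists_notMem (hne t ht)
    fun s hs hts => Finset.ne_of_mem_erase hs ((hmax s (Finset.mem_of_mem_erase hs)).antisymm hts)
  have h1 : levelSum μ v = μ t := by
    rw [levelSum_apply, weight]
    have : {s ∈ μ.support | v ∈ s} = {t} := by
      ext s
      rw [Finset.mem_filter, Finset.mem_singleton]
      constructor
      · rintro ⟨h1, h2⟩
        by_contra hst
        exact hvS s (Finset.mem_erase.2 ⟨hst, h1⟩) h2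
      · rintro rfl
        exact ⟨ht, hv⟩
    rw [this, Finset.sum_singleton]
  rw [h] at h1
  exact Finsupp.mem_support_iff.1 ht h1.symm

/-- The representation of a function as a sum of indicator functions of a chain is unique. -/
theorem levelSum_injective {μ ν : Finset V →₀ ℝ} (hμ : ∀ s, 0 ≤ μ s) (hν : ∀ s, 0 ≤ ν s)
    (hμc : IsFinsetChain μ.support) (hνc : IsFinsetChain ν.support)
    (hμn : ∀ s ∈ μ.support, s.Nonempty) (hνn : ∀ s ∈ ν.support, s.Nonempty)
    (h : levelSum μ = levelSum ν) : μ = ν := by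
  have hlev : ∀ s ∈ μ.support ∪ ν.support, IsSuperlevel (levelSum μ) s := by
    intro s hs
    rcases Finset.mem_union.1 hs with hs | hs
    · exact isSuperlevel_levelSum hμ hμc hs
    · rw [h]; exact isSuperlevel_levelSum hν hνc hs
  have hsub : (μ - ν).support ⊆ μ.support ∪ ν.support := Finsupp.support_sub
  refine sub_eq_zero.1 (eq_zero_of_levelSum_eq_zero
    (fun s hs t ht => (hlev s (hsub hs)).subset_or_subset (hlev t (hsub ht)))
    (fun s hs => (Finset.mem_union.1 (hsub hs)).elim (hμn s) (hνn s)) ?_)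
  rw [map_sub, h, sub_self]

/-- For a chain, the minimum of the sum of indicator functions over `B` is the weight of the members
that contain `B`. -/
theorem exists_levelSum_eq_weight {μ : Finset V →₀ ℝ} (hc : IsFinsetChain μ.support)
    {B : Finset V} (hB : B.Nonempty) : ∃ v ∈ B, levelSum μ v = weight μ (B ⊆ ·) := by
  obtain ⟨v, hv, hvS⟩ := (hc.mono (Finset.filter_subset (fun s => ¬ B ⊆ s) _)).exists_notMem hB
    fun s hs => (Finset.mem_filter.1 hs).2
  refine ⟨v, hv, ?_⟩
  rw [levelSum_apply]
  refine weight_congr fun s hs => ⟨fun h => ?_, fun h => h hv⟩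
  by_contra hBs
  exact hvS s (Finset.mem_filter.2 ⟨hs, hBs⟩) h

end Levels

/-! ### The barycentric subdivision -/

section Subdivision

variable {V : Type*}

/-- Multiplication of the coordinates by the factors `w`. -/
noncomputable def rescale {X : Type*} (w : X → ℝ) : (X →₀ ℝ) →ₗ[ℝ] (X →₀ ℝ) :=
  Finsupp.linearCombination ℝ fun s => Finsupp.single s (w s)

theorem rescale_apply {X : Type*} (w : X → ℝ) (μ : X →₀ ℝ) (s : X) :
    rescale w μ s = w s * μ s := by
  classical
  rw [rescale, Finsupp.linearCombination_apply, Finsupp.sum, Finsupp.finsetSum_apply]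
  simp only [Finsupp.smul_apply, Finsupp.single_apply, smul_eq_mul, mul_ite, mul_zero]
  rw [Finset.sum_ite_eq']
  split_ifs with h
  · ring
  · rw [Finsupp.notMem_support_iff.1 h, mul_zero]

theorem support_rescale {X : Type*} {w : X → ℝ} {μ : X →₀ ℝ} (h : ∀ s ∈ μ.support, w s ≠ 0) :
    (rescale w μ).support = μ.support := by
  ext s
  rw [Finsupp.mem_support_iff, rescale_apply]
  constructor
  · exact fun h' => Finsupp.mem_support_iff.2 (right_ne_zero_of_mul h')
  · exact fun h' => mul_ne_zero (h s h') (Finsupp.mem_support_iff.1 h')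

theorem mem_barycentricSubdivision {K : PreAbstractSimplicialComplex V} {S : Finset (Finset V)} :
    S ∈ barycentricSubdivision K ↔ S.Nonempty ∧ (∀ s ∈ S, s ∈ K) ∧ IsFinsetChain S := Iff.rfl

/-- The linear map that sends the vertex `s` of the barycentric subdivision to the barycenter of
`s`. -/
noncomputable def baryMap : (Finset V →₀ ℝ) →ₗ[ℝ] (V →₀ ℝ) :=
  Finsupp.linearCombination ℝ barycenter

theorem barycenter_eq_smul (s : Finset V) :
    barycenter s = (1 / (s.card : ℝ)) • ∑ v ∈ s, Finsupp.single v (1 : ℝ) := by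
  rw [barycenter, Finset.smul_sum]
  simp

theorem baryMap_eq [DecidableEq V] (μ : Finset V →₀ ℝ) :
    baryMap μ = levelSum (rescale (fun s => 1 / (s.card : ℝ)) μ) := by
  have : (baryMap : (Finset V →₀ ℝ) →ₗ[ℝ] (V →₀ ℝ)) =
      levelSum.comp (rescale fun s => 1 / (s.card : ℝ)) := by
    ext s : 2
    simp [baryMap, levelSum, rescale, barycenter_eq_smul]
  rw [this]
  rfl

theorem baryMap_single (s : Finset V) : baryMap (Finsupp.single s 1) = barycenter s := by
  simp [baryMap]

theorem chainSimplex_eq_image (S : Finset (Finset V)) :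
    chainSimplex S = baryMap '' simplex S := by
  refine Set.Subset.antisymm (convexHull_min ?_ ((convex_simplex S).linear_image _)) ?_
  · rintro _ ⟨s, hs, rfl⟩
    exact ⟨_, single_mem_simplex hs, baryMap_single s⟩
  · rintro _ ⟨μ, hμ, rfl⟩
    rw [mem_simplex] at hμ
    rw [linear_apply_eq_sum baryMap hμ.2.2]
    refine (convex_convexHull ℝ _).sum_mem (fun s _ => hμ.1 s) ?_ fun s hs => ?_
    · rw [← mass_eq_sum_of_support_subset hμ.2.2, hμ.2.1]
    · rw [baryMap_single]
      exact subset_convexHull ℝ _ ⟨s, hs, rfl⟩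

theorem carrier_eq_image (X : PreAbstractSimplicialComplex (Finset V)) :
    carrier X = baryMap '' realization X := by
  simp only [carrier, realization, chainSimplex_eq_image, Set.image_iUnion]

theorem card_pos_real {s : Finset V} (hs : s.Nonempty) : (0 : ℝ) < s.card := by
  exact_mod_cast hs.card_pos

theorem rescale_inv_rescale {X : Type*} {w : X → ℝ} {μ : X →₀ ℝ}
    (h : ∀ s ∈ μ.support, w s ≠ 0) : rescale (fun s => 1 / w s) (rescale w μ) = μ := by
  ext s
  rw [rescale_apply, rescale_apply]
  by_cases hs : s ∈ μ.support
  · have := h s hs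
    field_simp
  · rw [Finsupp.notMem_support_iff.1 hs, mul_zero, mul_zero]

theorem baryMap_mapsTo (K : PreAbstractSimplicialComplex V) :
    Set.MapsTo baryMap (realization (barycentricSubdivision K)) (realization K) := by
  intro μ hμ
  rw [mem_realization, mem_barycentricSubdivision] at hμ
  obtain ⟨t, ht, hmax⟩ := hμ.2.2.2.2.exists_top hμ.2.2.1
  refine simplex_subset_realization (hμ.2.2.2.1 t ht) (linear_mapsTo_simplex baryMap
    (fun s hs => ?_) (mem_simplex.2 ⟨hμ.1, hμ.2.1, subset_rfl⟩))
  rw [baryMap_single]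
  exact simplex_mono (hmax s hs) (barycenter_mem_simplex (face_nonempty (hμ.2.2.2.1 s hs)))

variable [DecidableEq V]

/-- Every point of `|K|` lies in the simplex of the barycentric subdivision that is spanned by the
barycenters of its superlevel sets. -/
theorem exists_baryMap_eq {K : PreAbstractSimplicialComplex V} {x : V →₀ ℝ}
    (hx : x ∈ realization K) : ∃ μ ∈ realization (barycentricSubdivision K), baryMap μ = x ∧
      ∀ s ∈ μ.support, s ⊆ x.support ∧ IsSuperlevel x s := by
  rw [mem_realization] at hx
  obtain ⟨μ, hμ0, hμ, hμx⟩ := exists_levelSum_eq x hx.1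
  have hcard : ∀ s ∈ μ.support, (s.card : ℝ) ≠ 0 := fun s hs => (card_pos_real (hμ s hs).1).ne'
  obtain ⟨ν, hν⟩ : ∃ ν, ν = rescale (fun s : Finset V => (s.card : ℝ)) μ := ⟨_, rfl⟩
  have hsupp : ν.support = μ.support := by rw [hν, support_rescale hcard]
  have hbary : baryMap ν = x := by
    rw [baryMap_eq, hν, rescale_inv_rescale hcard, hμx]
  have hmass : mass ν = 1 := by
    rw [← hx.2.1, ← hbary]
    refine (mass_map_of_vertices baryMap (s := μ.support) (fun s hs => ?_) hsupp.subset).symm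
    rw [baryMap_single]
    exact (mem_simplex.1 (barycenter_mem_simplex (hμ s hs).1)).2.1
  have hν0 : ∀ s, 0 ≤ ν s := fun s => by
    rw [hν, rescale_apply]
    exact mul_nonneg (Nat.cast_nonneg _) (hμ0 s)
  rw [← hsupp] at hμ
  refine ⟨ν, mem_realization.2 ⟨hν0, hmass, ?_⟩, hbary, fun s hs => (hμ s hs).2⟩
  exact mem_barycentricSubdivision.2 ⟨support_nonempty_of_mass hmass,
    fun s hs => face_of_subset hx.2.2 (hμ s hs).2.1 (hμ s hs).1,
    fun s hs t ht => (hμ s hs).2.2.subset_or_subset (hμ t ht).2.2⟩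

/-- Points of the barycentric subdivision, rewritten as sums of indicator functions. -/
theorem rescale_of_mem_barycentricSubdivision {K : PreAbstractSimplicialComplex V}
    {μ : Finset V →₀ ℝ} (hμ : μ ∈ realization (barycentricSubdivision K)) :
    ∃ ν : Finset V →₀ ℝ, (∀ s, 0 ≤ ν s) ∧ ν.support = μ.support ∧ baryMap μ = levelSum ν ∧
      rescale (fun s : Finset V => (s.card : ℝ)) ν = μ := by
  rw [mem_realization, mem_barycentricSubdivision] at hμ
  have hcard : ∀ s ∈ μ.support, (s.card : ℝ) ≠ 0 := fun s hs =>
    (card_pos_real (face_nonempty (hμ.2.2.2.1 s hs))).ne'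
  refine ⟨rescale (fun s : Finset V => 1 / (s.card : ℝ)) μ, fun s => ?_,
    support_rescale fun s hs => one_div_ne_zero (hcard s hs), baryMap_eq μ, ?_⟩
  · rw [rescale_apply]
    exact mul_nonneg (by positivity) (hμ.1 s)
  · have := rescale_inv_rescale (w := fun s : Finset V => 1 / (s.card : ℝ)) (μ := μ)
      fun s hs => one_div_ne_zero (hcard s hs)
    simpa only [one_div_one_div] using this

theorem levelSum_pos {μ : Finset V →₀ ℝ} (hμ : ∀ s, 0 ≤ μ s) {s : Finset V} (hs : s ∈ μ.support)
    {v : V} (hv : v ∈ s) : 0 < levelSum μ v := by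
  rw [levelSum_apply]
  exact lt_of_lt_of_le (lt_of_le_of_ne (hμ s) (Ne.symm (Finsupp.mem_support_iff.1 hs)))
    (le_weight hμ (P := fun t => v ∈ t) hv)

/-- The barycentric subdivision of a complex is piecewise linearly homeomorphic to the complex. -/
theorem plHomeomorphic_barycentricSubdivision (K : PreAbstractSimplicialComplex V) :
    PLHomeomorphic (barycentricSubdivision K) K := by
  suffices h : ∃ g, IsPLHomeo (barycentricSubdivision K) K baryMap g from
    h.elim fun g hg => hg.plHomeomorphic
  refine exists_isPLHomeo_of_linear baryMap
    ⟨baryMap_mapsTo K, fun μ hμ μ' hμ' h => ?_, fun x hx => ?_⟩ fun t ht => ?_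
  · obtain ⟨ν, hν0, hνs, hν, hνμ⟩ := rescale_of_mem_barycentricSubdivision hμ
    obtain ⟨ν', hν0', hνs', hν', hνμ'⟩ := rescale_of_mem_barycentricSubdivision hμ'
    rw [mem_realization, mem_barycentricSubdivision] at hμ hμ'
    rw [← hνs] at hμ
    rw [← hνs'] at hμ'
    rw [← hνμ, ← hνμ', levelSum_injective hν0 hν0' hμ.2.2.2.2 hμ'.2.2.2.2
      (fun s hs => face_nonempty (hμ.2.2.2.1 s hs)) (fun s hs => face_nonempty (hμ'.2.2.2.1 s hs))
      (by rw [← hν, ← hν', h])]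
  · obtain ⟨μ, hμ, h, _⟩ := exists_baryMap_eq hx
    exact ⟨μ, hμ, h⟩
  · refine ⟨t.powerset, fun μ hμ hμt s hs => Finset.mem_powerset.2 fun v hv => ?_⟩
    obtain ⟨ν, hν0, hνs, hν, _⟩ := rescale_of_mem_barycentricSubdivision hμ
    refine (mem_simplex.1 hμt).2.2 (Finsupp.mem_support_iff.2 ?_)
    rw [hν]
    exact (levelSum_pos hν0 (hνs ▸ hs) hv).ne'

end Subdivision

/-! ### The color class as a complex of chains -/

section ColorClass

variable {V C : Type*}

/-- A set of vertices that has every color. -/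
def IsColorful (c : V → C) (s : Finset V) : Prop := ∀ i, ∃ v ∈ s, c v = i

theorem IsColorful.mono {c : V → C} {s t : Finset V} (hs : IsColorful c s) (h : s ⊆ t) :
    IsColorful c t :=
  fun i => (hs i).imp fun _ hv => ⟨h hv.1, hv.2⟩

/-- The full subcomplex of the barycentric subdivision on the colorful faces. -/
def colorfulChains (K : PreAbstractSimplicialComplex V) (c : V → C) :
    PreAbstractSimplicialComplex (Finset V) where
  faces := {S | S ∈ barycentricSubdivision K ∧ ∀ s ∈ S, IsColorful c s}
  isRelLowerSet_faces := fun _ hS => ⟨face_nonempty hS.1, fun _ hTS hT =>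
    ⟨face_of_subset hS.1 hTS hT, fun s hs => hS.2 s (hTS hs)⟩⟩

theorem mem_colorfulChains {K : PreAbstractSimplicialComplex V} {c : V → C}
    {S : Finset (Finset V)} : S ∈ colorfulChains K c ↔
      S.Nonempty ∧ (∀ s ∈ S, s ∈ K ∧ IsColorful c s) ∧ IsFinsetChain S :=
  ⟨fun h => ⟨h.1.1, fun s hs => ⟨h.1.2.1 s hs, h.2 s hs⟩, h.1.2.2⟩,
    fun h => ⟨⟨h.1, fun s hs => (h.2.1 s hs).1, h.2.2⟩, fun s hs => (h.2.1 s hs).2⟩⟩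

theorem mem_colorfulChains_bdryOn {c : V → C} {σ : Finset V} {S : Finset (Finset V)} :
    S ∈ colorfulChains (bdryOn σ) c ↔ S.Nonempty ∧
      (∀ s ∈ S, (s.Nonempty ∧ s ⊆ σ ∧ ¬ σ ⊆ s) ∧ IsColorful c s) ∧ IsFinsetChain S :=
  mem_colorfulChains

variable [DecidableEq V]

/-- At a point of the simplex spanned by the barycenters of a chain of colorful faces, the maximal
coordinates are those in the smallest face that occurs. -/
theorem baryMap_mem_colorClass {K : PreAbstractSimplicialComplex V} {c : V → C}
    {μ : Finset V →₀ ℝ} (hμ : μ ∈ realization (colorfulChains K c)) :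
    baryMap μ ∈ colorClass K c Set.univ := by
  have hμ' := realization_mono (K := colorfulChains K c) (L := barycentricSubdivision K)
    (fun _ h => h.1) hμ
  refine ⟨baryMap_mapsTo K hμ', fun i _ => ?_⟩
  obtain ⟨ν, hν0, hνs, hν, _⟩ := rescale_of_mem_barycentricSubdivision hμ'
  rw [mem_realization, mem_colorfulChains, ← hνs] at hμ
  obtain ⟨s, hs, hmin⟩ := hμ.2.2.2.2.exists_bot hμ.2.2.1
  obtain ⟨v, hv, hvi⟩ := (hμ.2.2.2.1 s hs).2 i
  rw [hν]
  refine ⟨v, Finsupp.mem_support_iff.2 (levelSum_pos hν0 hs hv).ne', hvi, fun w _ => ?_⟩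
  rw [levelSum_apply, levelSum_apply, weight_eq_mass (P := fun t => v ∈ t)
    fun t ht => hmin t ht hv]
  exact weight_le_mass hν0 _

theorem colorClassComplex_univ (K : PreAbstractSimplicialComplex V) (c : V → C) :
    colorClassComplex K c Set.univ = colorfulChains K c := complex_ext fun S => by
  constructor
  · rintro ⟨hS, h⟩
    refine ⟨hS, fun s hs i => ?_⟩
    obtain ⟨v, hv, hvi, _⟩ := (h (subset_convexHull ℝ _ ⟨s, hs, rfl⟩)).2 (Set.mem_univ i)
    rw [support_barycenter] at hv
    exact ⟨v, hv, hvi⟩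
  · rintro hS
    refine ⟨hS.1, ?_⟩
    rw [chainSimplex_eq_image]
    rintro _ ⟨μ, hμ, rfl⟩
    exact baryMap_mem_colorClass (simplex_subset_realization hS hμ)

/-- The superlevel sets of a point in the color class are colorful. -/
theorem exists_baryMap_eq_of_mem_colorClass {K : PreAbstractSimplicialComplex V} {c : V → C}
    {x : V →₀ ℝ} (hx : x ∈ colorClass K c Set.univ) :
    ∃ μ ∈ realization (colorfulChains K c), baryMap μ = x ∧ ∀ s ∈ μ.support, s ⊆ x.support := by
  obtain ⟨μ, hμ, hμx, hμs⟩ := exists_baryMap_eq hx.1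
  refine ⟨μ, ?_, hμx, fun s hs => (hμs s hs).1⟩
  rw [mem_realization] at hμ ⊢
  refine ⟨hμ.1, hμ.2.1, hμ.2.2, fun s hs i => ?_⟩
  obtain ⟨v, hv, hvi, hmax⟩ := hx.2 (Set.mem_univ i)
  obtain ⟨w, hw⟩ := face_nonempty (hμ.2.2.2.1 s hs)
  exact ⟨v, (hμs s hs).2 w hw v (hmax w ((hμs s hs).1 hw)), hvi⟩

theorem carrier_colorfulChains (K : PreAbstractSimplicialComplex V) (c : V → C) :
    carrier (colorfulChains K c) = colorClass K c Set.univ := by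
  rw [carrier_eq_image]
  refine Set.Subset.antisymm ?_ fun x hx => ?_
  · rintro _ ⟨μ, hμ, rfl⟩
    exact baryMap_mem_colorClass hμ
  · obtain ⟨μ, hμ, h, _⟩ := exists_baryMap_eq_of_mem_colorClass hx
    exact ⟨μ, hμ, h⟩

end ColorClass

/-! ### Joins of boundaries, one for each color -/

section Blocks

variable {V C : Type*} [DecidableEq C]

/-- The vertices of `σ` of color `i`. -/
def block (c : V → C) (σ : Finset V) (i : C) : Finset V := {v ∈ σ | c v = i}

theorem mem_block {c : V → C} {σ : Finset V} {i : C} {v : V} :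
    v ∈ block c σ i ↔ v ∈ σ ∧ c v = i := Finset.mem_filter

theorem IsColorful.block_nonempty {c : V → C} {σ : Finset V} (h : IsColorful c σ) (i : C) :
    (block c σ i).Nonempty :=
  (h i).imp fun _ hv => mem_block.2 hv

/-- The join of the boundaries of the simplices spanned by the vertices of `σ` of a given color,
over all colors in `I`. -/
def blockJoin (c : V → C) (σ : Finset V) (I : Finset C) : PreAbstractSimplicialComplex V where
  faces := {t | t.Nonempty ∧ (∀ v ∈ t, v ∈ σ ∧ c v ∈ I) ∧ ∀ i ∈ I, ¬ block c σ i ⊆ t}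
  isRelLowerSet_faces := fun _ hs => ⟨hs.1, fun _ hts ht =>
    ⟨ht, fun v hv => hs.2.1 v (hts hv), fun i hi h => hs.2.2 i hi (h.trans hts)⟩⟩

theorem mem_blockJoin {c : V → C} {σ : Finset V} {I : Finset C} {t : Finset V} :
    t ∈ blockJoin c σ I ↔
      t.Nonempty ∧ (∀ v ∈ t, v ∈ σ ∧ c v ∈ I) ∧ ∀ i ∈ I, ¬ block c σ i ⊆ t := Iff.rfl

variable [DecidableEq V]

theorem plHomeomorphic_blockJoin_insert {c : V → C} {σ : Finset V} (hσ : IsColorful c σ)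
    {I : Finset C} {i : C} (hi : i ∉ I) : PLHomeomorphic (blockJoin c σ (insert i I))
      (join (bdryOn (block c σ i)) (blockJoin c σ I)) := by
  let φ : V → V ⊕ V := fun v => if c v = i then Sum.inl v else Sum.inr v
  let ψ : V ⊕ V → V := Sum.elim id id
  have hψφ : ∀ v, ψ (φ v) = v := fun v => by
    by_cases h : c v = i <;> simp [φ, ψ, h]
  refine (isPLHomeo_of_iso (K := blockJoin c σ (insert i I))
    (L := join (bdryOn (block c σ i)) (blockJoin c σ I)) φ ψ (fun s hs => ?_) (fun t ht => ?_)
    (fun v _ => hψφ v) fun w hw => ?_).plHomeomorphic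
  · have hl : ∀ v, v ∈ (s.image φ).toLeft ↔ v ∈ s ∧ c v = i := fun v => by
      rw [Finset.mem_toLeft, Finset.mem_image]
      constructor
      · rintro ⟨w, hw, h⟩
        by_cases hc : c w = i
        · simp only [φ, if_pos hc, Sum.inl.injEq] at h
          exact h ▸ ⟨hw, hc⟩
        · simp [φ, if_neg hc] at h
      · rintro ⟨hv, hc⟩
        exact ⟨v, hv, if_pos hc⟩
    have hr : ∀ v, v ∈ (s.image φ).toRight ↔ v ∈ s ∧ c v ≠ i := fun v => by
      rw [Finset.mem_toRight, Finset.mem_image]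
      constructor
      · rintro ⟨w, hw, h⟩
        by_cases hc : c w = i
        · simp [φ, if_pos hc] at h
        · simp only [φ, if_neg hc, Sum.inr.injEq] at h
          exact h ▸ ⟨hw, hc⟩
      · rintro ⟨hv, hc⟩
        exact ⟨v, hv, if_neg hc⟩
    rw [mem_blockJoin] at hs
    rw [mem_join, mem_bdryOn, mem_blockJoin]
    refine ⟨hs.1.image φ, ?_, ?_⟩
    · refine (Finset.eq_empty_or_nonempty _).imp_right fun h => ⟨h, fun v hv => ?_, fun hle => ?_⟩
      · rw [hl] at hv
        exact mem_block.2 ⟨(hs.2.1 v hv.1).1, hv.2⟩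
      · exact hs.2.2 i (Finset.mem_insert_self i I) fun v hv => ((hl v).1 (hle hv)).1
    · refine (Finset.eq_empty_or_nonempty _).imp_right fun h => ⟨h, fun v hv => ?_,
        fun j hj hle => ?_⟩
      · rw [hr] at hv
        obtain ⟨h1, h2⟩ := hs.2.1 v hv.1
        exact ⟨h1, (Finset.mem_insert.1 h2).resolve_left hv.2⟩
      · exact hs.2.2 j (Finset.mem_insert_of_mem hj) fun v hv => ((hr v).1 (hle hv)).1
  · rw [mem_join, mem_bdryOn, mem_blockJoin] at ht
    have hm : ∀ v, v ∈ t.image ψ ↔ v ∈ t.toLeft ∨ v ∈ t.toRight := fun v => by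
      rw [Finset.mem_image, Finset.mem_toLeft, Finset.mem_toRight]
      constructor
      · rintro ⟨w | w, hw, rfl⟩
        exacts [Or.inl hw, Or.inr hw]
      · rintro (h | h)
        exacts [⟨_, h, rfl⟩, ⟨_, h, rfl⟩]
    have hl : ∀ v ∈ t.toLeft, v ∈ σ ∧ c v = i := fun v hv =>
      mem_block.1 ((ht.2.1.resolve_left (Finset.ne_empty_of_mem hv)).2.1 hv)
    have hr : ∀ v ∈ t.toRight, v ∈ σ ∧ c v ∈ I := fun v hv =>
      (ht.2.2.resolve_left (Finset.ne_empty_of_mem hv)).2.1 v hv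
    rw [mem_blockJoin]
    refine ⟨ht.1.image ψ, fun v hv => ?_, fun j hj hle => ?_⟩
    · rcases (hm v).1 hv with h | h
      · exact ⟨(hl v h).1, (hl v h).2 ▸ Finset.mem_insert_self i I⟩
      · exact ⟨(hr v h).1, Finset.mem_insert_of_mem (hr v h).2⟩
    · obtain ⟨v, hv⟩ := hσ.block_nonempty j
      rcases Finset.mem_insert.1 hj with rfl | hj
      · have hle' : block c σ j ⊆ t.toLeft := fun w hw => ((hm w).1 (hle hw)).resolve_right
          fun h => hi ((mem_block.1 hw).2 ▸ (hr w h).2)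
        exact (ht.2.1.resolve_left (Finset.ne_empty_of_mem (hle' hv))).2.2 hle'
      · have hle' : block c σ j ⊆ t.toRight := fun w hw => ((hm w).1 (hle hw)).resolve_left
          fun h => hi ((hl w h).2 ▸ (mem_block.1 hw).2 ▸ hj)
        exact (ht.2.2.resolve_left (Finset.ne_empty_of_mem (hle' hv))).2.2 j hj hle'
  · rw [mem_join, mem_bdryOn, mem_blockJoin] at hw
    rcases w with w | w
    · have hmem : w ∈ ({Sum.inl w} : Finset (V ⊕ V)).toLeft := by simp
      have := (mem_block.1 ((hw.2.1.resolve_left (Finset.ne_empty_of_mem hmem)).2.1 hmem)).2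
      exact if_pos this
    · have hmem : w ∈ ({Sum.inr w} : Finset (V ⊕ V)).toRight := by simp
      have := ((hw.2.2.resolve_left (Finset.ne_empty_of_mem hmem)).2.1 w hmem).2
      exact if_neg fun h : c w = i => hi (h ▸ this)

theorem plHomeomorphic_blockJoin {c : V → C} {σ : Finset V} (hσ : IsColorful c σ) (I : Finset C) :
    I.card ≤ ({v ∈ σ | c v ∈ I} : Finset V).card ∧ PLHomeomorphic (blockJoin c σ I)
      (simplexBoundary (({v ∈ σ | c v ∈ I} : Finset V).card - I.card)) := by
  induction I using Finset.induction_on with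
  | empty =>
    refine ⟨by simp, ?_⟩
    have : ({v ∈ σ | c v ∈ (∅ : Finset C)} : Finset V).card - (∅ : Finset C).card = 0 := by simp
    rw [this, plHomeomorphic_simplexBoundary_zero]
    refine complex_ext fun t => ⟨fun ht => ?_, fun ht => (face_nonempty ht).ne_empty.elim ?_⟩
    · obtain ⟨v, hv⟩ := ht.1
      exact absurd (ht.2.1 v hv).2 (Finset.notMem_empty _)
    · exact absurd ht id
  | insert i I hi ih =>
    obtain ⟨hle, ih⟩ := ih
    have hcard : ({v ∈ σ | c v ∈ insert i I} : Finset V).card =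
        (block c σ i).card + ({v ∈ σ | c v ∈ I} : Finset V).card := by
      rw [block, ← Finset.card_union_of_disjoint, ← Finset.filter_or]
      · simp only [Finset.mem_insert]
      · exact Finset.disjoint_filter.2 fun v _ h h' => hi (h ▸ h')
    obtain ⟨n, hn⟩ := Nat.exists_eq_succ_of_ne_zero (hσ.block_nonempty i).card_pos.ne'
    rw [hcard, Finset.card_insert_of_notMem hi]
    refine ⟨by omega, ?_⟩
    rw [show (block c σ i).card + ({v ∈ σ | c v ∈ I} : Finset V).card - (I.card + 1) =
      n + (({v ∈ σ | c v ∈ I} : Finset V).card - I.card) by omega]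
    exact ((plHomeomorphic_blockJoin_insert hσ hi).trans
      ((plHomeomorphic_of_card hn).2.join ih)).trans (join_simplexBoundary_simplexBoundary n _)

end Blocks

/-! ### Colorful chains in the boundary of a simplex -/

section Core

variable {V C : Type*}

/-- A chain of colorful proper subsets of `σ`, with positive multiplicities. -/
structure IsColorfulWeight (c : V → C) (σ : Finset V) (ν : Finset V →₀ ℝ) : Prop where
  nonneg : ∀ s, 0 ≤ ν s
  chain : IsFinsetChain ν.support
  support_nonempty : ν.support.Nonempty
  subset : ∀ s ∈ ν.support, s ⊆ σ
  not_subset : ∀ s ∈ ν.support, ¬ σ ⊆ s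
  colorful : ∀ s ∈ ν.support, IsColorful c s

theorem IsColorfulWeight.rescale {c : V → C} {σ : Finset V} {ν : Finset V →₀ ℝ}
    (h : IsColorfulWeight c σ ν) {w : Finset V → ℝ} (hw0 : ∀ s, 0 ≤ w s)
    (hw : ∀ s ∈ ν.support, w s ≠ 0) : IsColorfulWeight c σ (rescale w ν) := by
  have hs := support_rescale hw
  refine ⟨fun s => ?_, by rw [hs]; exact h.chain, by rw [hs]; exact h.support_nonempty,
    by rw [hs]; exact h.subset, by rw [hs]; exact h.not_subset, by rw [hs]; exact h.colorful⟩
  rw [rescale_apply]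
  exact mul_nonneg (hw0 s) (h.nonneg s)

theorem mem_realization_colorfulChains_bdryOn [Nonempty C] {c : V → C} {σ : Finset V}
    {μ : Finset V →₀ ℝ} :
    μ ∈ realization (colorfulChains (bdryOn σ) c) ↔ IsColorfulWeight c σ μ ∧ mass μ = 1 := by
  rw [mem_realization, mem_colorfulChains_bdryOn]
  constructor
  · rintro ⟨h0, h1, h2, h3, h4⟩
    exact ⟨⟨h0, h4, h2, fun s hs => (h3 s hs).1.2.1, fun s hs => (h3 s hs).1.2.2,
      fun s hs => (h3 s hs).2⟩, h1⟩
  · rintro ⟨h, h1⟩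
    refine ⟨h.nonneg, h1, h.support_nonempty, fun s hs => ⟨⟨?_, h.subset s hs, h.not_subset s hs⟩,
      h.colorful s hs⟩, h.chain⟩
    exact (h.colorful s hs (Classical.arbitrary C)).imp fun _ hv => hv.1

variable [DecidableEq C] [DecidableEq V]

/-- The set `s` without those vertices whose color `i` is exhausted by `s`, in the sense that `s`
contains all vertices of `σ` of color `i`. -/
def core (c : V → C) (σ s : Finset V) : Finset V := {v ∈ s | ¬ block c σ (c v) ⊆ s}

theorem mem_core {c : V → C} {σ s : Finset V} {v : V} :
    v ∈ core c σ s ↔ v ∈ s ∧ ¬ block c σ (c v) ⊆ s := Finset.mem_filter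

theorem IsColorful.core_nonempty {c : V → C} {σ s : Finset V} (hs : IsColorful c s)
    (h : ¬ σ ⊆ s) : (core c σ s).Nonempty := by
  obtain ⟨v, hv, hvs⟩ := Finset.not_subset.1 h
  obtain ⟨w, hw, hwv⟩ := hs (c v)
  exact ⟨w, mem_core.2 ⟨hw, fun hle => hvs (hle (mem_block.2 ⟨hv, hwv.symm⟩))⟩⟩

/-- The linear map that sends the vertex `s` of the barycentric subdivision to the barycenter of
its core. -/
noncomputable def coreMap (c : V → C) (σ : Finset V) : (Finset V →₀ ℝ) →ₗ[ℝ] (V →₀ ℝ) :=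
  Finsupp.linearCombination ℝ fun s => barycenter (core c σ s)

theorem coreMap_single (c : V → C) (σ s : Finset V) :
    coreMap c σ (Finsupp.single s 1) = barycenter (core c σ s) := by
  simp [coreMap]

theorem coreMap_apply (c : V → C) (σ : Finset V) (μ : Finset V →₀ ℝ) (v : V) :
    coreMap c σ μ v =
      weight (rescale (fun s => 1 / ((core c σ s).card : ℝ)) μ) (v ∈ core c σ ·) := by
  have hsub : (rescale (fun s => 1 / ((core c σ s).card : ℝ)) μ).support ⊆ μ.support :=
    fun s hs => by
      rw [Finsupp.mem_support_iff, rescale_apply] at hs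
      exact Finsupp.mem_support_iff.2 (right_ne_zero_of_mul hs)
  rw [weight_eq_sum_of_support_subset hsub, coreMap, Finsupp.linearCombination_apply, Finsupp.sum,
    Finsupp.finsetSum_apply]
  refine Finset.sum_congr rfl fun s _ => ?_
  rw [Finsupp.smul_apply, barycenter_apply, rescale_apply, smul_eq_mul, mul_ite, mul_zero,
    mul_comm]

/-- In terms of the function `x` with superlevel sets `s`, passing to cores means to subtract from
`x` its minimum over the vertices of each color. -/
theorem weight_core {c : V → C} {σ : Finset V} {v : V} (hv : v ∈ σ) (ν : Finset V →₀ ℝ) :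
    weight ν (v ∈ core c σ ·) = levelSum ν v - weight ν (block c σ (c v) ⊆ ·) := by
  rw [levelSum_apply, eq_sub_iff_add_eq, weight_eq_sum_of_support_subset subset_rfl,
    weight_eq_sum_of_support_subset subset_rfl, weight_eq_sum_of_support_subset subset_rfl,
    ← Finset.sum_add_distrib]
  refine Finset.sum_congr rfl fun s _ => ?_
  have : block c σ (c v) ⊆ s → v ∈ s := fun h => h (mem_block.2 ⟨hv, rfl⟩)
  by_cases h1 : block c σ (c v) ⊆ s
  · simp [mem_core, h1, this h1]
  · simp [mem_core, h1]

theorem IsColorfulWeight.exists_eq_mass {c : V → C} {σ : Finset V} {ν : Finset V →₀ ℝ}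
    (h : IsColorfulWeight c σ ν) (i : C) : ∃ v ∈ block c σ i, levelSum ν v = mass ν := by
  obtain ⟨s, hs, hmin⟩ := h.chain.exists_bot h.support_nonempty
  obtain ⟨v, hv, hvi⟩ := h.colorful s hs i
  refine ⟨v, mem_block.2 ⟨h.subset s hs hv, hvi⟩, ?_⟩
  rw [levelSum_apply]
  exact weight_eq_mass fun t ht => hmin t ht hv

theorem IsColorfulWeight.exists_eq_zero {c : V → C} {σ : Finset V} {ν : Finset V →₀ ℝ}
    (h : IsColorfulWeight c σ ν) : ∃ i, weight ν (block c σ i ⊆ ·) = 0 := by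
  obtain ⟨t, ht, hmax⟩ := h.chain.exists_top h.support_nonempty
  obtain ⟨v, hv, hvt⟩ := Finset.not_subset.1 (h.not_subset t ht)
  refine ⟨c v, ?_⟩
  rw [weight, Finset.filter_false_of_mem, Finset.sum_empty]
  exact fun s hs hle => hvt (hmax s hs (hle (mem_block.2 ⟨hv, rfl⟩)))

/-- The maximum of the core function over the vertices of color `i` is `mass ν` minus the weight of
the sets that contain all vertices of color `i`; so it is determined by the core function. -/
theorem IsColorfulWeight.mass_sub_le {c : V → C} {σ : Finset V} {ν ν' : Finset V →₀ ℝ}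
    (h : IsColorfulWeight c σ ν) (h' : IsColorfulWeight c σ ν')
    (heq : ∀ v, weight ν (v ∈ core c σ ·) = weight ν' (v ∈ core c σ ·)) (i : C) :
    mass ν - weight ν (block c σ i ⊆ ·) ≤ mass ν' - weight ν' (block c σ i ⊆ ·) := by
  obtain ⟨v, hv, hvm⟩ := h.exists_eq_mass i
  obtain ⟨hvσ, rfl⟩ := mem_block.1 hv
  have h1 := heq v
  rw [weight_core hvσ, weight_core hvσ, hvm] at h1
  have h2 : levelSum ν' v ≤ mass ν' := by
    rw [levelSum_apply]
    exact weight_le_mass h'.nonneg _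
  linarith

/-- A chain of colorful proper subsets is determined by the weights of the cores. -/
theorem IsColorfulWeight.eq_of_weight_core_eq {c : V → C} {σ : Finset V} {ν ν' : Finset V →₀ ℝ}
    (h : IsColorfulWeight c σ ν) (h' : IsColorfulWeight c σ ν') [Nonempty C]
    (heq : ∀ v, weight ν (v ∈ core c σ ·) = weight ν' (v ∈ core c σ ·)) : ν = ν' := by
  have hb : ∀ i, mass ν - weight ν (block c σ i ⊆ ·) = mass ν' - weight ν' (block c σ i ⊆ ·) :=
    fun i => (h.mass_sub_le h' heq i).antisymm (h'.mass_sub_le h (fun v => (heq v).symm) i)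
  -- Some color is not exhausted by any member of the chain, which gives the normalization.
  have hm : mass ν = mass ν' := by
    obtain ⟨i, hi⟩ := h.exists_eq_zero
    obtain ⟨j, hj⟩ := h'.exists_eq_zero
    have h1 := weight_nonneg h'.nonneg (block c σ i ⊆ ·)
    have h2 := weight_nonneg h.nonneg (block c σ j ⊆ ·)
    linarith [hb i, hb j]
  have hne : ∀ {ν : Finset V →₀ ℝ}, IsColorfulWeight c σ ν → ∀ s ∈ ν.support, s.Nonempty :=
    fun h s hs => (h.colorful s hs (Classical.arbitrary C)).imp fun _ hv => hv.1
  refine levelSum_injective h.nonneg h'.nonneg h.chain h'.chain (hne h) (hne h') ?_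
  ext v
  by_cases hv : v ∈ σ
  · have h1 := heq v
    rw [weight_core hv, weight_core hv] at h1
    linarith [hb (c v)]
  · have hz : ∀ {ν : Finset V →₀ ℝ}, IsColorfulWeight c σ ν → levelSum ν v = 0 := fun h => by
      rw [levelSum_apply, weight, Finset.filter_false_of_mem, Finset.sum_empty]
      exact fun s hs hvs => hv (h.subset s hs hvs)
    rw [hz h, hz h']

/-- Every function that vanishes at some vertex of each color arises from a chain of colorful sets:
raise it on the vertices of each color by a constant, so that all colors have the same maximum, and
take the superlevel sets. -/
theorem exists_isColorfulWeight {c : V → C} {σ : Finset V} (hσ : IsColorful c σ) {y : V →₀ ℝ}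
    (hy0 : ∀ v, 0 ≤ y v) (hy : y.support.Nonempty) (hyσ : y.support ⊆ σ)
    (hyb : ∀ i, ¬ block c σ i ⊆ y.support) :
    ∃ ν, IsColorfulWeight c σ ν ∧ ∀ v, weight ν (v ∈ core c σ ·) = y v := by
  obtain ⟨a, ha, hamax⟩ := Finset.exists_max_image σ y (hy.mono hyσ)
  have hmax : ∀ i, ∃ v ∈ block c σ i, ∀ w ∈ block c σ i, y w ≤ y v := fun i =>
    Finset.exists_max_image _ y (hσ.block_nonempty i)
  choose p hp hpmax using hmax
  let b : C → ℝ := fun i => y a - y (p i)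
  have hb : ∀ i, 0 ≤ b i := fun i => sub_nonneg.2 (hamax _ (mem_block.1 (hp i)).1)
  have hyout : ∀ v, v ∉ σ → y v = 0 := fun v hv =>
    Finsupp.notMem_support_iff.1 fun h => hv (hyσ h)
  let x : V →₀ ℝ := y + ∑ v ∈ σ, Finsupp.single v (b (c v))
  have hx : ∀ v, x v = y v + if v ∈ σ then b (c v) else 0 := fun v => by
    simp only [x, Finsupp.add_apply, Finsupp.finsetSum_apply, Finsupp.single_apply]
    rw [Finset.sum_ite_eq' σ v]
  have hxin : ∀ v ∈ σ, x v = y v + b (c v) := fun v hv => by rw [hx, if_pos hv]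
  have hxout : ∀ v, v ∉ σ → x v = 0 := fun v hv => by rw [hx, if_neg hv, hyout v hv, add_zero]
  have hx0 : ∀ v, 0 ≤ x v := fun v => by
    by_cases hv : v ∈ σ
    · rw [hxin v hv]; exact add_nonneg (hy0 v) (hb _)
    · rw [hxout v hv]
  have hxσ : x.support ⊆ σ := fun v hv => by
    by_contra h
    exact Finsupp.mem_support_iff.1 hv (hxout v h)
  have hxle : ∀ v ∈ σ, x v ≤ y a := fun v hv => by
    have := hpmax (c v) v (mem_block.2 ⟨hv, rfl⟩)
    rw [hxin v hv]
    simp only [b]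
    linarith
  have hxp : ∀ i, x (p i) = y a := fun i => by
    obtain ⟨h1, h2⟩ := mem_block.1 (hp i)
    rw [hxin _ h1, h2]
    simp only [b]
    ring
  have hxa : 0 < y a := by
    obtain ⟨v, hv⟩ := hy
    exact lt_of_lt_of_le (lt_of_le_of_ne (hy0 v) (Ne.symm (Finsupp.mem_support_iff.1 hv)))
      (hamax v (hyσ hv))
  obtain ⟨ν, hν0, hν, hνx⟩ := exists_levelSum_eq x hx0
  have hchain : IsFinsetChain ν.support := fun s hs t ht =>
    (hν s hs).2.2.subset_or_subset (hν t ht).2.2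
  have hweight : ∀ i, weight ν (block c σ i ⊆ ·) = b i := fun i => by
    obtain ⟨w, hw, hwy⟩ := Finset.not_subset.1 (hyb i)
    obtain ⟨v, hv, hvw⟩ := exists_levelSum_eq_weight hchain (hσ.block_nonempty i)
    obtain ⟨hwσ, hwi⟩ := mem_block.1 hw
    obtain ⟨hvσ, hvi⟩ := mem_block.1 hv
    refine le_antisymm ?_ ?_
    · have : weight ν (block c σ i ⊆ ·) ≤ x w := by
        rw [← hνx, levelSum_apply]
        exact weight_mono hν0 fun s _ h => h hw
      rwa [hxin w hwσ, Finsupp.notMem_support_iff.1 hwy, zero_add, hwi] at this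
    · rw [← hvw, hνx, hxin v hvσ, hvi]
      linarith [hy0 v]
  refine ⟨ν, ⟨hν0, hchain, ?_, fun s hs => (hν s hs).2.1.trans hxσ, fun s hs hle => ?_,
    fun s hs i => ?_⟩, fun v => ?_⟩
  · refine Finsupp.support_nonempty_iff.2 fun h => ?_
    rw [h, map_zero] at hνx
    have := hxp (c a)
    rw [← hνx, Finsupp.zero_apply] at this
    linarith
  · -- A vertex of the color of `a` at which `y` vanishes lies in no superlevel set.
    obtain ⟨w, hw, hwy⟩ := Finset.not_subset.1 (hyb (c a))
    obtain ⟨hwσ, hwi⟩ := mem_block.1 hw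
    refine Finsupp.mem_support_iff.1 ((hν s hs).2.1 (hle hwσ)) ?_
    have h1 := hpmax (c a) a (mem_block.2 ⟨ha, rfl⟩)
    have h2 := hamax _ (mem_block.1 (hp (c a))).1
    rw [hxin w hwσ, Finsupp.notMem_support_iff.1 hwy, hwi]
    simp only [b]
    linarith
  · obtain ⟨w, hw⟩ := (hν s hs).1
    refine ⟨p i, (hν s hs).2.2 w hw _ ?_, (mem_block.1 (hp i)).2⟩
    rw [hxp]
    exact hxle w (hxσ ((hν s hs).2.1 hw))
  · by_cases hv : v ∈ σ
    · rw [weight_core hv, hνx, hweight, hxin v hv]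
      ring
    · rw [hyout v hv, weight, Finset.filter_false_of_mem, Finset.sum_empty]
      exact fun s hs hvs => hv (hxσ ((hν s hs).2.1 (mem_core.1 hvs).1))

theorem IsColorfulWeight.card_core_ne_zero {c : V → C} {σ : Finset V} {ν : Finset V →₀ ℝ}
    (h : IsColorfulWeight c σ ν) : ∀ s ∈ ν.support, ((core c σ s).card : ℝ) ≠ 0 := fun s hs =>
  (card_pos_real ((h.colorful s hs).core_nonempty (h.not_subset s hs))).ne'

/-- Inside the boundary of a simplex, the complex of chains of colorful faces is a join of
boundaries of simplices, one for each color. -/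
theorem plHomeomorphic_colorfulChains_blockJoin [Fintype C] [Nonempty C] {c : V → C}
    {σ : Finset V} (hσ : IsColorful c σ) :
    PLHomeomorphic (colorfulChains (bdryOn σ) c) (blockJoin c σ Finset.univ) := by
  suffices h : ∃ g, IsPLHomeo (colorfulChains (bdryOn σ) c) (blockJoin c σ Finset.univ)
      (coreMap c σ) g from h.elim fun g hg => hg.plHomeomorphic
  refine exists_isPLHomeo_of_linear _ ⟨fun μ hμ => ?_, fun μ hμ μ' hμ' h => ?_, fun y hy => ?_⟩
    fun t _ => ⟨σ.powerset, fun μ hμ _ s hs => ?_⟩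
  · have hμ' := hμ
    rw [mem_realization_colorfulChains_bdryOn] at hμ'
    obtain ⟨h, h1⟩ := hμ'
    have hcore : ∀ s ∈ μ.support, (core c σ s).Nonempty := fun s hs =>
      (h.colorful s hs).core_nonempty (h.not_subset s hs)
    have ht : μ.support.biUnion (core c σ) ∈ blockJoin c σ Finset.univ := by
      refine ⟨?_, fun v hv => ?_, fun i _ hle => ?_⟩
      · obtain ⟨s, hs⟩ := h.support_nonempty
        obtain ⟨v, hv⟩ := hcore s hs
        exact ⟨v, Finset.mem_biUnion.2 ⟨s, hs, hv⟩⟩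
      · obtain ⟨s, hs, hvs⟩ := Finset.mem_biUnion.1 hv
        exact ⟨h.subset s hs (mem_core.1 hvs).1, Finset.mem_univ _⟩
      · obtain ⟨v, hv, hvS⟩ := (h.chain.mono
          (Finset.filter_subset (fun s => ¬ block c σ i ⊆ s) _)).exists_notMem
          (hσ.block_nonempty i) fun s hs => (Finset.mem_filter.1 hs).2
        obtain ⟨s, hs, hvs⟩ := Finset.mem_biUnion.1 (hle hv)
        rw [mem_core, (mem_block.1 hv).2] at hvs
        exact hvS s (Finset.mem_filter.2 ⟨hs, hvs.2⟩) hvs.1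
    refine simplex_subset_realization ht (linear_mapsTo_simplex _ (fun s hs => ?_)
      (mem_simplex.2 ⟨h.nonneg, h1, subset_rfl⟩))
    rw [coreMap_single]
    exact simplex_mono (Finset.subset_biUnion_of_mem _ hs) (barycenter_mem_simplex (hcore s hs))
  · rw [mem_realization_colorfulChains_bdryOn] at hμ hμ'
    have key : ∀ {μ : Finset V →₀ ℝ}, IsColorfulWeight c σ μ →
        IsColorfulWeight c σ (rescale (fun s => 1 / ((core c σ s).card : ℝ)) μ) ∧
        rescale (fun s => ((core c σ s).card : ℝ))
          (rescale (fun s => 1 / ((core c σ s).card : ℝ)) μ) = μ := fun {μ} h => by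
      refine ⟨h.rescale (fun s => by positivity) fun s hs =>
        one_div_ne_zero (h.card_core_ne_zero s hs), ?_⟩
      have := rescale_inv_rescale (w := fun s => 1 / ((core c σ s).card : ℝ)) (μ := μ)
        fun s hs => one_div_ne_zero (h.card_core_ne_zero s hs)
      simpa only [one_div_one_div] using this
    rw [← (key hμ.1).2, ← (key hμ'.1).2, (key hμ.1).1.eq_of_weight_core_eq (key hμ'.1).1]
    intro v
    rw [← coreMap_apply, ← coreMap_apply, h]
  · rw [mem_realization] at hy
    obtain ⟨ν, hν, hνy⟩ := exists_isColorfulWeight hσ hy.1 hy.2.2.1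
      (fun v hv => (hy.2.2.2.1 v hv).1) fun i => hy.2.2.2.2 i (Finset.mem_univ i)
    have hcard := hν.card_core_ne_zero
    obtain ⟨μ, hμ⟩ : ∃ μ, μ = rescale (fun s => ((core c σ s).card : ℝ)) ν := ⟨_, rfl⟩
    have hμw : IsColorfulWeight c σ μ := hμ ▸ hν.rescale (fun s => Nat.cast_nonneg _) hcard
    have hμy : coreMap c σ μ = y := by
      ext v
      rw [coreMap_apply, hμ, rescale_inv_rescale hcard, hνy]
    refine ⟨μ, mem_realization_colorfulChains_bdryOn.2 ⟨hμw, ?_⟩, hμy⟩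
    rw [← hy.2.1, ← hμy]
    refine (mass_map_of_vertices _ (s := μ.support) (fun s hs => ?_) subset_rfl).symm
    rw [coreMap_single]
    exact (mem_simplex.1 (barycenter_mem_simplex
      ((hμw.colorful s hs).core_nonempty (hμw.not_subset s hs)))).2.1
  · rw [mem_realization_colorfulChains_bdryOn] at hμ
    exact Finset.mem_powerset.2 (hμ.1.subset s hs)

/-- The colorful chains in the boundary of a simplex form a sphere. -/
theorem plHomeomorphic_colorfulChains_bdryOn [Fintype C] [Nonempty C] {c : V → C} {σ : Finset V}
    (hσ : IsColorful c σ) : Fintype.card C ≤ σ.card ∧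
      PLHomeomorphic (colorfulChains (bdryOn σ) c)
        (simplexBoundary (σ.card - Fintype.card C)) := by
  have h := plHomeomorphic_blockJoin hσ Finset.univ
  rw [Finset.filter_true_of_mem fun _ _ => Finset.mem_univ _, Finset.card_univ] at h
  exact ⟨h.1, (plHomeomorphic_colorfulChains_blockJoin hσ).trans h.2⟩

end Core

/-! ### Links of colorful chains -/

section ChainLinks

variable {V C : Type*} [DecidableEq V]

theorem link_empty (K : PreAbstractSimplicialComplex V) : link K ∅ = K := complex_ext fun t => by
  rw [mem_link, Finset.union_empty]
  exact ⟨fun h => h.2.1, fun h => ⟨face_nonempty h, h, Finset.disjoint_empty_right t⟩⟩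

/-- The members of a chain in the link of `S` are either contained in the largest member `s` of `S`
or contain it; the latter correspond to faces of the link of `s`. -/
theorem plHomeomorphic_link_colorfulChains {K : PreAbstractSimplicialComplex V} {c : V → C}
    {S : Finset (Finset V)} (hS : S ∈ colorfulChains K c) {s : Finset V} (hs : s ∈ S)
    (hmax : ∀ t ∈ S, t ⊆ s) :
    PLHomeomorphic (link (colorfulChains K c) S)
      (join (link (colorfulChains (bdryOn s) c) (S.erase s))
        (barycentricSubdivision (link K s))) := by
  rw [mem_colorfulChains] at hS
  obtain ⟨hsK, hsc⟩ := hS.2.1 s hs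
  let φ : Finset V → Finset V ⊕ Finset V := fun t => if t ⊆ s then Sum.inl t else Sum.inr (t \ s)
  let ψ : Finset V ⊕ Finset V → Finset V := Sum.elim id (· ∪ s)
  have hsup : ∀ T ∈ link (colorfulChains K c) S, ∀ t ∈ T, ¬ t ⊆ s → t \ s ∪ s = t :=
    fun T hT t ht h => by
      rw [mem_link, mem_colorfulChains] at hT
      exact Finset.sdiff_union_of_subset ((hT.2.1.2.2 t (Finset.mem_union_left _ ht) s
        (Finset.mem_union_right _ hs)).resolve_left h)
  refine (isPLHomeo_of_iso (K := link (colorfulChains K c) S)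
    (L := join (link (colorfulChains (bdryOn s) c) (S.erase s))
      (barycentricSubdivision (link K s))) φ ψ (fun T hT => ?_) (fun T hT => ?_)
    (fun t ht => ?_) fun t ht => ?_).plHomeomorphic
  · have hl : ∀ t, t ∈ (T.image φ).toLeft ↔ t ∈ T ∧ t ⊆ s := fun t => by
      rw [Finset.mem_toLeft, Finset.mem_image]
      constructor
      · rintro ⟨w, hw, h⟩
        by_cases hc : w ⊆ s
        · simp only [φ, if_pos hc, Sum.inl.injEq] at h
          exact h ▸ ⟨hw, hc⟩
        · simp [φ, if_neg hc] at h
      · rintro ⟨hv, hc⟩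
        exact ⟨t, hv, if_pos hc⟩
    have hr : ∀ u ∈ (T.image φ).toRight, ∃ t ∈ T, ¬ t ⊆ s ∧ t \ s = u := fun u hu => by
      rw [Finset.mem_toRight, Finset.mem_image] at hu
      obtain ⟨w, hw, h⟩ := hu
      by_cases hc : w ⊆ s
      · simp [φ, if_pos hc] at h
      · simp only [φ, if_neg hc, Sum.inr.injEq] at h
        exact ⟨w, hw, hc, h⟩
    have hT' := hT
    rw [mem_link, mem_colorfulChains] at hT'
    obtain ⟨hTne, ⟨_, hTm, hTc⟩, hTd⟩ := hT'
    refine mem_join.2 ⟨hTne.image φ, (Finset.eq_empty_or_nonempty _).imp_right fun h => ?_,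
      (Finset.eq_empty_or_nonempty _).imp_right fun h => ?_⟩
    · rw [mem_link, mem_colorfulChains_bdryOn]
      have hsub : (T.image φ).toLeft ∪ S.erase s ⊆ T ∪ S := fun t ht => by
        rcases Finset.mem_union.1 ht with ht | ht
        · exact Finset.mem_union_left _ ((hl t).1 ht).1
        · exact Finset.mem_union_right _ (Finset.mem_of_mem_erase ht)
      refine ⟨h, ⟨h.mono Finset.subset_union_left, fun t ht => ?_, hTc.mono hsub⟩, ?_⟩
      · obtain ⟨h1, h2⟩ := hTm t (hsub ht)
        refine ⟨⟨face_nonempty h1, ?_⟩, h2⟩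
        rcases Finset.mem_union.1 ht with ht | ht
        · obtain ⟨htT, hts⟩ := (hl t).1 ht
          refine ⟨hts, fun hst => Finset.disjoint_left.1 hTd htT ?_⟩
          rwa [hts.antisymm hst]
        · obtain ⟨htne, htS⟩ := Finset.mem_erase.1 ht
          exact ⟨hmax t htS, fun hst => htne ((hmax t htS).antisymm hst)⟩
      · exact hTd.mono (fun t ht => ((hl t).1 ht).1) (Finset.erase_subset _ _)
    · refine mem_barycentricSubdivision.2 ⟨h, fun u hu => ?_, fun u hu u' hu' => ?_⟩
      · obtain ⟨t, ht, hts, rfl⟩ := hr u hu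
        rw [mem_link, hsup T hT t ht hts]
        exact ⟨Finset.sdiff_nonempty.2 hts, (hTm t (Finset.mem_union_left _ ht)).1,
          Finset.sdiff_disjoint⟩
      · obtain ⟨t, ht, _, rfl⟩ := hr u hu
        obtain ⟨t', ht', _, rfl⟩ := hr u' hu'
        exact (hTc t (Finset.mem_union_left _ ht) t' (Finset.mem_union_left _ ht')).imp
          (fun h => Finset.sdiff_subset_sdiff h subset_rfl)
          fun h => Finset.sdiff_subset_sdiff h subset_rfl
  · obtain ⟨hTne, hTl, hTr⟩ := mem_join.1 hT
    have hl : ∀ t ∈ T.toLeft, ((t.Nonempty ∧ t ⊆ s ∧ ¬ s ⊆ t) ∧ IsColorful c t) ∧ t ∉ S := by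
      intro t ht
      have := hTl.resolve_left (Finset.ne_empty_of_mem ht)
      rw [mem_link, mem_colorfulChains_bdryOn] at this
      have h1 := this.2.1.2.1 t (Finset.mem_union_left _ ht)
      refine ⟨h1, fun htS => Finset.disjoint_left.1 this.2.2 ht (Finset.mem_erase.2 ⟨?_, htS⟩)⟩
      rintro rfl
      exact h1.1.2.2 subset_rfl
    have hlc : IsFinsetChain (T.toLeft ∪ S.erase s) := by
      rcases hTl with h | h
      · rw [h, Finset.empty_union]
        exact hS.2.2.mono (Finset.erase_subset _ _)
      · rw [mem_link, mem_colorfulChains_bdryOn] at h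
        exact h.2.1.2.2
    have hr : ∀ u ∈ T.toRight, u ∈ link K s := fun u hu =>
      (hTr.resolve_left (Finset.ne_empty_of_mem hu)).2.1 u hu
    have hrc : IsFinsetChain T.toRight := by
      rcases hTr with h | h
      · rw [h]
        exact fun u hu => absurd hu (Finset.notMem_empty u)
      · exact h.2.2
    have hm : ∀ t ∈ T.image ψ ∪ S,
        (t ∈ T.toLeft ∪ S.erase s ∨ ∃ u, (u = ∅ ∨ u ∈ T.toRight) ∧ u ∪ s = t) := fun t ht => by
      rcases Finset.mem_union.1 ht with ht | ht
      · obtain ⟨w | w, hw, rfl⟩ := Finset.mem_image.1 ht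
        · exact Or.inl (Finset.mem_union_left _ (Finset.mem_toLeft.2 hw))
        · exact Or.inr ⟨w, Or.inr (Finset.mem_toRight.2 hw), rfl⟩
      · by_cases hts : t = s
        · exact Or.inr ⟨∅, Or.inl rfl, by rw [hts, Finset.empty_union]⟩
        · exact Or.inl (Finset.mem_union_right _ (Finset.mem_erase.2 ⟨hts, ht⟩))
    have hle : ∀ t ∈ T.toLeft ∪ S.erase s, t ⊆ s := fun t ht => by
      rcases Finset.mem_union.1 ht with ht | ht
      · exact (hl t ht).1.1.2.1
      · exact hmax t (Finset.mem_of_mem_erase ht)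
    rw [mem_link, mem_colorfulChains]
    refine ⟨hTne.image ψ, ⟨hS.1.mono Finset.subset_union_right, fun t ht => ?_,
      fun t ht t' ht' => ?_⟩, Finset.disjoint_left.2 fun t ht htS => ?_⟩
    · rcases Finset.mem_union.1 ht with ht | ht
      · obtain ⟨w | w, hw, rfl⟩ := Finset.mem_image.1 ht
        · obtain ⟨⟨⟨h1, h2, _⟩, h3⟩, _⟩ := hl w (Finset.mem_toLeft.2 hw)
          exact ⟨face_of_subset hsK h2 h1, h3⟩
        · exact ⟨(hr w (Finset.mem_toRight.2 hw)).2.1, hsc.mono Finset.subset_union_right⟩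
      · exact hS.2.1 t ht
    · rcases hm t ht with h | ⟨u, hu, rfl⟩ <;> rcases hm t' ht' with h' | ⟨u', hu', rfl⟩
      · exact hlc t h t' h'
      · exact Or.inl ((hle t h).trans Finset.subset_union_right)
      · exact Or.inr ((hle t' h').trans Finset.subset_union_right)
      · have : u ⊆ u' ∨ u' ⊆ u := by
          rcases hu with rfl | hu
          · exact Or.inl (Finset.empty_subset _)
          · rcases hu' with rfl | hu'
            · exact Or.inr (Finset.empty_subset _)
            · exact hrc u hu u' hu'
        exact this.imp (fun h => Finset.union_subset_union_left h)
          fun h => Finset.union_subset_union_left h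
    · obtain ⟨w | w, hw, rfl⟩ := Finset.mem_image.1 ht
      · exact (hl w (Finset.mem_toLeft.2 hw)).2 htS
      · obtain ⟨⟨v, hv⟩, _, hd⟩ := hr w (Finset.mem_toRight.2 hw)
        exact Finset.disjoint_left.1 hd hv (hmax _ htS (Finset.mem_union_left _ hv))
  · by_cases h : t ⊆ s
    · simp [φ, ψ, h]
    · simpa [φ, ψ, h] using hsup _ ht t (Finset.mem_singleton_self t) h
  · rw [mem_join] at ht
    rcases t with t | t
    · have hmem : t ∈ ({Sum.inl t} : Finset (Finset V ⊕ Finset V)).toLeft := by simp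
      have := ht.2.1.resolve_left (Finset.ne_empty_of_mem hmem)
      rw [mem_link, mem_colorfulChains_bdryOn] at this
      exact if_pos (this.2.1.2.1 t (Finset.mem_union_left _ hmem)).1.2.1
    · have hmem : t ∈ ({Sum.inr t} : Finset (Finset V ⊕ Finset V)).toRight := by simp
      obtain ⟨⟨v, hv⟩, _, hd⟩ := (ht.2.2.resolve_left (Finset.ne_empty_of_mem hmem)).2.1 t hmem
      have h : ¬ t ∪ s ⊆ s := fun h =>
        Finset.disjoint_left.1 hd hv (h (Finset.mem_union_left _ hv))
      change (if t ∪ s ⊆ s then Sum.inl (t ∪ s) else Sum.inr ((t ∪ s) \ s)) = _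
      rw [if_neg h, Finset.union_sdiff_cancel_right hd]

theorem link_bdryOn {σ s : Finset V} (hs : s ⊆ σ) : link (bdryOn σ) s = bdryOn (σ \ s) :=
  complex_ext fun t => by
    rw [mem_link, mem_bdryOn, mem_bdryOn]
    constructor
    · rintro ⟨h1, ⟨_, h2, h3⟩, h4⟩
      refine ⟨h1, fun v hv => Finset.mem_sdiff.2 ⟨h2 (Finset.mem_union_left _ hv),
        Finset.disjoint_left.1 h4 hv⟩, fun h => h3 fun v hv => ?_⟩
      by_cases hvs : v ∈ s
      · exact Finset.mem_union_right _ hvs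
      · exact Finset.mem_union_left _ (h (Finset.mem_sdiff.2 ⟨hv, hvs⟩))
    · rintro ⟨h1, h2, h3⟩
      refine ⟨h1, ⟨h1.mono Finset.subset_union_left,
        Finset.union_subset (h2.trans Finset.sdiff_subset) hs, fun h => h3 fun v hv => ?_⟩,
        Finset.disjoint_left.2 fun v hv => (Finset.mem_sdiff.1 (h2 hv)).2⟩
      obtain ⟨h4, h5⟩ := Finset.mem_sdiff.1 hv
      exact (Finset.mem_union.1 (h h4)).resolve_right h5

theorem erase_mem_colorfulChains_bdryOn {K : PreAbstractSimplicialComplex V} {c : V → C}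
    {S : Finset (Finset V)} (hS : S ∈ colorfulChains K c) {s : Finset V}
    (hmax : ∀ t ∈ S, t ⊆ s) : S.erase s = ∅ ∨ S.erase s ∈ colorfulChains (bdryOn s) c := by
  rw [mem_colorfulChains] at hS
  refine (Finset.eq_empty_or_nonempty _).imp_right fun h => mem_colorfulChains_bdryOn.2
    ⟨h, fun t ht => ?_, hS.2.2.mono (Finset.erase_subset _ _)⟩
  obtain ⟨h1, h2⟩ := Finset.mem_erase.1 ht
  obtain ⟨h3, h4⟩ := hS.2.1 t h2
  exact ⟨⟨face_nonempty h3, hmax t h2, fun h => h1 ((hmax t h2).antisymm h)⟩, h4⟩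

variable [Fintype C] [Nonempty C]

/-- In the sphere of colorful chains in the boundary of a simplex, all links are spheres. -/
theorem plHomeomorphic_link_colorfulChains_bdryOn {c : V → C} {σ : Finset V}
    (hσ : IsColorful c σ) {S : Finset (Finset V)}
    (hS : S = ∅ ∨ S ∈ colorfulChains (bdryOn σ) c) :
    S.card + Fintype.card C ≤ σ.card ∧ PLHomeomorphic (link (colorfulChains (bdryOn σ) c) S)
      (simplexBoundary (σ.card - Fintype.card C - S.card)) := by
  classical
  induction hn : S.card generalizing S σ with
  | zero =>
    rw [Finset.card_eq_zero] at hn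
    subst hn
    obtain ⟨h1, h2⟩ := plHomeomorphic_colorfulChains_bdryOn hσ
    rw [link_empty]
    exact ⟨by omega, h2⟩
  | succ n ih =>
    have hne : S.Nonempty := Finset.card_pos.1 (by omega)
    have hS := hS.resolve_left hne.ne_empty
    obtain ⟨_, hSm, hSc⟩ := mem_colorfulChains_bdryOn.1 hS
    obtain ⟨s, hs, hmax⟩ := hSc.exists_top hne
    obtain ⟨⟨_, hsσ, hσs⟩, hsc⟩ := hSm s hs
    obtain ⟨h1, h2⟩ := ih hsc (erase_mem_colorfulChains_bdryOn hS hmax)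
      (by rw [Finset.card_erase_of_mem hs]; omega)
    have hlt : s.card < σ.card :=
      Finset.card_lt_card ⟨hsσ, hσs⟩
    have hcard : (σ \ s).card = (σ.card - s.card - 1) + 1 := by
      rw [Finset.card_sdiff_of_subset hsσ]; omega
    refine ⟨by omega, ?_⟩
    have h3 := plHomeomorphic_barycentricSubdivision (link (bdryOn σ) s)
    rw [link_bdryOn hsσ] at h3
    have := ((plHomeomorphic_link_colorfulChains hS hs hmax).trans
      (h2.join (link_bdryOn hsσ ▸ h3.trans (plHomeomorphic_of_card hcard).2))).trans
      (join_simplexBoundary_simplexBoundary _ _)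
    rwa [show s.card - Fintype.card C - n + (σ.card - s.card - 1) =
      σ.card - Fintype.card C - (n + 1) by omega] at this

/-- The link of a colorful chain with largest member `s` is a suspension of the link of `s`,
possibly iterated. -/
theorem plHomeomorphic_link_colorfulChains_join {K : PreAbstractSimplicialComplex V} {c : V → C}
    {S : Finset (Finset V)} (hS : S ∈ colorfulChains K c) {s : Finset V} (hs : s ∈ S)
    (hmax : ∀ t ∈ S, t ⊆ s) : S.card + Fintype.card C ≤ s.card + 1 ∧
      PLHomeomorphic (link (colorfulChains K c) S)
        (join (simplexBoundary (s.card + 1 - Fintype.card C - S.card)) (link K s)) := by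
  have hsc := (mem_colorfulChains.1 hS).2.1 s hs
  obtain ⟨h1, h2⟩ := plHomeomorphic_link_colorfulChains_bdryOn hsc.2
    (erase_mem_colorfulChains_bdryOn hS hmax)
  have hpos := Finset.card_pos.2 ⟨s, hs⟩
  rw [Finset.card_erase_of_mem hs] at h1 h2
  rw [show s.card - Fintype.card C - (S.card - 1) = s.card + 1 - Fintype.card C - S.card by omega]
    at h2
  exact ⟨by omega, (plHomeomorphic_link_colorfulChains hS hs hmax).trans
    (h2.join (plHomeomorphic_barycentricSubdivision _))⟩

theorem linkSphere_colorfulChains {K : PreAbstractSimplicialComplex V} {c : V → C} {d : ℕ}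
    (hd : Fintype.card C ≤ d) {S : Finset (Finset V)} (hS : S ∈ colorfulChains K c)
    {s : Finset V} (hs : s ∈ S) (hmax : ∀ t ∈ S, t ⊆ s) (hsd : s.card ≤ d + 1)
    (h : LinkSphere K d s) : LinkSphere (colorfulChains K c) (d - Fintype.card C + 1) S := by
  obtain ⟨h1, h2⟩ := plHomeomorphic_link_colorfulChains_join hS hs hmax
  have := (h2.trans ((PLHomeomorphic.refl _).join h)).trans
    (join_simplexBoundary_simplexBoundary _ _)
  rwa [show s.card + 1 - Fintype.card C - S.card + (d + 1 - s.card) =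
    d - Fintype.card C + 1 + 1 - S.card by omega] at this

theorem linkDisk_colorfulChains {K : PreAbstractSimplicialComplex V} {c : V → C} {d : ℕ}
    (hd : Fintype.card C ≤ d) {S : Finset (Finset V)} (hS : S ∈ colorfulChains K c)
    {s : Finset V} (hs : s ∈ S) (hmax : ∀ t ∈ S, t ⊆ s)
    (h : LinkDisk K d s) : LinkDisk (colorfulChains K c) (d - Fintype.card C + 1) S := by
  obtain ⟨h1, h2⟩ := plHomeomorphic_link_colorfulChains_join hS hs hmax
  obtain ⟨h3, h4⟩ := h
  have := (h2.trans ((PLHomeomorphic.refl _).join h4)).trans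
    (join_simplexBoundary_fullSimplex _ _)
  rw [show s.card + 1 - Fintype.card C - S.card + (d - s.card) =
    d - Fintype.card C + 1 - S.card by omega] at this
  exact ⟨by omega, this⟩

end ChainLinks

/-! ### The color class in a combinatorial manifold -/

section Main

variable {V C : Type*} [DecidableEq V] [Fintype C] [Nonempty C]

/-- A face of the color class has a spherical link if and only if its largest member does, and the
largest member grows with the chain. -/
theorem isCombinatorialManifold_colorfulChains {M : PreAbstractSimplicialComplex V} {c : V → C}
    {d : ℕ} (hd : Fintype.card C ≤ d) (hM : IsCombinatorialManifold d M) :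
    IsCombinatorialManifold (d - Fintype.card C + 1) (colorfulChains M c) := by
  have hM' := isCombinatorialManifold_iff.1 hM
  refine isCombinatorialManifold_iff.2 ⟨fun S hS => ?_, fun S hS T hT hST hlink => ?_⟩
  · obtain ⟨hne, hm, hc⟩ := mem_colorfulChains.1 hS
    obtain ⟨s, hs, hmax⟩ := hc.exists_top hne
    obtain ⟨h1, h2⟩ := hM'.1 s (hm s hs).1
    have := (plHomeomorphic_link_colorfulChains_join hS hs hmax).1
    exact ⟨by omega, h2.imp (linkSphere_colorfulChains hd hS hs hmax h1)
      (linkDisk_colorfulChains hd hS hs hmax)⟩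
  · obtain ⟨hne, hm, hc⟩ := mem_colorfulChains.1 hS
    obtain ⟨s, hs, hmax⟩ := hc.exists_top hne
    obtain ⟨hneT, hmT, hcT⟩ := mem_colorfulChains.1 hT
    obtain ⟨t, ht, hmaxT⟩ := hcT.exists_top hneT
    have hsphere : LinkSphere M d s := (hM'.1 s (hm s hs).1).2.resolve_right fun h =>
      not_linkDisk_of_linkSphere hS hlink (linkDisk_colorfulChains hd hS hs hmax h)
    exact linkSphere_colorfulChains hd hT ht hmaxT (hM'.1 t (hmT t ht).1).1
      (hM'.2 s (hm s hs).1 t (hmT t ht).1 (hmaxT s (hST hs)) hsphere)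

/-- A colorful chain lies in the boundary if and only if its largest member does, and hence if and
only if all its members do. -/
theorem boundary_colorfulChains {M : PreAbstractSimplicialComplex V} {c : V → C}
    {d : ℕ} (hd : Fintype.card C ≤ d) (hM : IsCombinatorialManifold d M) :
    boundary (colorfulChains M c) =
      colorfulChains M c ⊓ barycentricSubdivision (boundary M) := complex_ext fun S => by
  have hM' := isCombinatorialManifold_iff.1 hM
  rw [mem_boundary_iff (isCombinatorialManifold_colorfulChains hd hM)]
  constructor
  · rintro ⟨hS, hdisk⟩
    obtain ⟨hne, hm, hc⟩ := mem_colorfulChains.1 hS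
    obtain ⟨s, hs, hmax⟩ := hc.exists_top hne
    have hsB : s ∈ boundary M := by
      obtain ⟨h1, h2⟩ := hM'.1 s (hm s hs).1
      exact (mem_boundary_iff hM).2 ⟨(hm s hs).1, h2.resolve_left fun h =>
        not_linkDisk_of_linkSphere hS (linkSphere_colorfulChains hd hS hs hmax h1 h) hdisk⟩
    exact ⟨hS, hne, fun t ht => face_of_subset hsB (hmax t ht) (face_nonempty (hm t ht).1), hc⟩
  · rintro ⟨hS, _, hB, _⟩
    obtain ⟨hne, _, hc⟩ := mem_colorfulChains.1 hS
    obtain ⟨s, hs, hmax⟩ := hc.exists_top hne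
    exact ⟨hS, linkDisk_colorfulChains hd hS hs hmax ((mem_boundary_iff hM).1 (hB s hs)).2⟩

theorem carrier_inf_barycentricSubdivision {C : Type*} (K L : PreAbstractSimplicialComplex V)
    (c : V → C) : carrier (colorfulChains K c ⊓ barycentricSubdivision L) =
      colorClass K c Set.univ ∩ realization L := by
  rw [carrier_eq_image]
  refine Set.Subset.antisymm ?_ fun x hx => ?_
  · rintro _ ⟨μ, hμ, rfl⟩
    exact ⟨baryMap_mem_colorClass (realization_mono
      (K := colorfulChains K c ⊓ barycentricSubdivision L) (fun _ h => h.1) hμ),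
      baryMap_mapsTo L (realization_mono
        (K := colorfulChains K c ⊓ barycentricSubdivision L) (fun _ h => h.2) hμ)⟩
  · obtain ⟨μ, hμ, hμx, hμs⟩ := exists_baryMap_eq_of_mem_colorClass hx.1
    refine ⟨μ, ?_, hμx⟩
    rw [mem_realization] at hμ ⊢
    obtain ⟨hne, hm, hc⟩ := mem_colorfulChains.1 hμ.2.2
    exact ⟨hμ.1, hμ.2.1, hμ.2.2, hne, fun s hs => face_of_subset (mem_realization.1 hx.2).2.2
      (hμs s hs) (face_nonempty (hm s hs).1), hc⟩

end Main

end ColoredManifold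

theorem lemma2p3 {V : Type*} [DecidableEq V] (M : PreAbstractSimplicialComplex V) (d k : ℕ)
    (hk : 2 ≤ k) (hkd : k ≤ d) (hM : ColoredManifold.IsCombinatorialManifold d M)
    (c : V → Fin k) :
    let X := ColoredManifold.colorClassComplex M c Set.univ
    -- the all-color class is the union of the simplices of `X`, a subcomplex of the subdivision
    X ≤ ColoredManifold.barycentricSubdivision M ∧
    ColoredManifold.carrier X = ColoredManifold.colorClass M c Set.univ ∧
    -- `X` is a combinatorial manifold, and its boundary is one without boundary
    ColoredManifold.IsCombinatorialManifold (d - k + 1) X ∧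
    ColoredManifold.IsClosedCombinatorialManifold (d - k) (ColoredManifold.boundary X) ∧
    -- the boundary of `X` is the intersection with the boundary of `M`, as complexes and as sets
    ColoredManifold.boundary X =
      X ⊓ ColoredManifold.barycentricSubdivision (ColoredManifold.boundary M) ∧
    ColoredManifold.carrier (ColoredManifold.boundary X) =
      ColoredManifold.colorClass M c Set.univ ∩
        ColoredManifold.realization (ColoredManifold.boundary M) := by
  have : NeZero k := ⟨by omega⟩
  have hd : Fintype.card (Fin k) ≤ d := by rwa [Fintype.card_fin]
  have hX := ColoredManifold.isCombinatorialManifold_colorfulChains (c := c) hd hM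
  have hbd := ColoredManifold.boundary_colorfulChains (c := c) hd hM
  have hclosed := ColoredManifold.isClosedCombinatorialManifold_boundary hX
  rw [Fintype.card_fin] at hX hclosed
  rw [ColoredManifold.colorClassComplex_univ]
  refine ⟨fun _ h => h.1, ColoredManifold.carrier_colorfulChains M c, hX, hclosed, hbd, ?_⟩
  rw [hbd]
  exact ColoredManifold.carrier_inf_barycentricSubdivision M _ c
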